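/- **Setting.** Let $(X,d)$ be a separable, connected, locally complete metric space with more than one point, regarded as an open subset of its completion $\overline X$, and let $m\neq 0$ be a locally finite Borel-regular outer measure on $X$. $B(x,r)$ is the closed ball $\{x'\in X: d(x,x')\le r\}$ and $B(S,r)=\{x': \mathrm{dist}(S,x')\le r\}$. For $S\subseteq S_0\subseteq X$ write $S\Subset S_0$ if $\mathrm{dist}(S,\overline X\setminus S_0)>0$, where $\mathrm{dist}(\cdot,\emptyset)=\mathrm{dist}(\emptyset,\cdot)=+\infty$. Let $p\in[1,\infty)$. Assume: * ($X$ is internally doubling) there is $C_D\ge 1$, and for each $S\Subset X$ some $R>0$, such that $0<m(B(x,2r))\le C_D\,m(B(x,r))<\infty$ for all $x\in B(S,R)$, $r\in(0,R]$; * ($X$ supports an internal $p$-Poincaré inequality) there are $C_P>0$, $\lambda\ge1$, and for each $S\Subset X$ some $R>0$, such that $0<m(B(x,r))<\infty$ for $x\in B(S,R)$, $r\in(0,\lambda R]$, and ⨍$_{B(x,r)}|u-\langle u\rangle_{B(x,r)}|\,dm\le C_P\,r\,\big($⨍$_{B(x,\lambda r)}\mathrm{lip}[u]^p\,dm\big)^{1/p}$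 for every Lipschitz $u:X\to\mathbb R$, $x\in B(S,R)$, $r\in(0,R]$. Here ⨍ is the mean value integral, $\langle u\rangle_B$ is the mean of $u$ over $B$, and $\mathrm{lip}[u](x)=\limsup_{x'\to x}\frac{|u(x)-u(x')|}{d(x,x')}$ (zero at isolated points). Let $\Omega\subseteq X$ be open, let $(Y,d_Y)$ be a metric space, and let $f:\Omega\to Y$ be an essentially separably valued Borel map (maps are considered up to $m$-a.e. equality). Put $d_f(x,x')=d_Y(f(x),f(x'))$. **Function classes.** $f\in L^p_{loc}(\Omega,Y)$ means that for some $y\in Y$ the function $d_Y(f(\cdot),y)^p$ is integrable on $\Omega\cap B(x,r)$ for every $x\in\Omega$ and some $r=r(x)>0$. For $u\in L^p_{loc}(\Omega)$ and an open $O\subseteq\Omega$, $E_p[u](O)$ is the infimum of $\liminf_n\int_O\mathrm{lip}[u_n]^p\,dm$ over all sequences of locally Lipschitz functions $u_n$ on $O$ that converge to $u$ in $L^p_{loc}(O)$; for arbitrary $S\subseteq\Omega$, $E_p[u](S)=\inf\{E_p[u](O): S\subseteq O\subseteq\Omega,\ O\text{ open}\}$. $E_p[f]$ is the lowest Borel-regular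 outer measure $\nu$ on $\Omega$ with $E_p[\phi\circ f](S)\le\nu(S)$ for all $S\subseteq\Omega$ and all bounded $1$-Lipschitz $\phi:Y\to\mathbb R$. $f\in S^{1,p}(\Omega,Y)$ means that $E_p[f](\Omega)<\infty$ and $E_p[f]\ll m$. **Energy densities.** For Borel $V\subseteq\Omega$ put $$\mathsf{ks}_p[f,V](x,r)=\frac1{m(B(x,r))}\int_{B(x,r)\cap V}\frac{d_f(x,x')^p}{r^p}\,dm(x')\quad\text{if }0<m(B(x,r))<\infty,$$ and $\mathsf{ks}_p[f,V](x,r)=0$ otherwise. A Borel function $e:\Omega\to[0,\infty)$ is the $p$-energy density of $f$, denoted $\mathsf e_p[f]$, if for every open $\Omega'\Subset\Omega$ one has $e\in L^1(\Omega')$ and $\mathsf{ks}_p[f,\Omega](\cdot,r)\to e$ as $r\searrow0$, both in $L^1(\Omega')$ and $m$-a.e. on $\Omega'$. **Mollifiers.** Let $\rho_\delta:X\times X\to[0,\infty)$, $\delta\in(0,1)$, be Borel. Put $\sigma(\delta,x,r)=\sup\{\rho_\delta(x,x'):x'\notin B(x,r)\}$ ($=0$ if there is no such $x'$). For $h>1$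 and $k\ge0$ let $D_0=\sigma(\delta,x,\tfrac rh)$ and $D_k=\big|\sigma(\delta,x,\tfrac r{h^{k+1}})-\sigma(\delta,x,\tfrac r{h^k})\big|$ for $k\ge1$, and $$\Pi_{L,k}(\delta,x,r,h)=D_k\;m\big(B(x,\tfrac r{h^{k+1}})\big)\big(\tfrac r{h^{k+1}}\big)^p,\qquad \Pi_{U,k}(\delta,x,r,h)=D_k\;m\big(B(x,\tfrac r{h^k})\big)\big(\tfrac r{h^k}\big)^p .$$ The family is *strongly $p$-admissible* if 1. $\limsup_{r\searrow0}\limsup_{\delta\searrow0}\sup_{x\in X}\int_{X\setminus B(x,r)}(\rho_\delta(x,x')+\rho_\delta(x',x))\,dm(x')=0$; 2. $\limsup_{r\searrow0}\limsup_{\delta\searrow0}\sigma(\delta,x,r)=0$ for all $x$; 3. $\rho_\delta(x,x_1)\ge\rho_\delta(x,x_2)$ whenever $x_1\ne x$ and $d(x,x_1)\le d(x,x_2)$; 4. $\limsup_{r\searrow0}\sigma(\delta,x,r)\,m(B(x,r))\,r^p=0$ for all $x,\delta$; 5. there is $C_M\ge1$ such that for all nonempty $S\Subset X$, $\frac1{C_M}\le\liminf_{r\searrow0}\liminf_{\delta\searrow0}\sum_k\inf_{x\in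 S}\Pi_{L,k}(\delta,x,r,2)$ and $\limsup_{r\searrow0}\limsup_{\delta\searrow0}\sum_k\sup_{x\in S}\Pi_{U,k}(\delta,x,r,2)\le C_M$; 6. $\limsup_{r\searrow0}\limsup_{\delta\searrow0}\sum_k\sup_{x\in S}\Pi_{U,k}(\delta,x,r,h)<\infty$ for all $S\Subset X$, $h>1$; 7. there is a Borel $\Theta_M:X\to[0,\infty)$ with $$\limsup_{h\searrow1}\ \operatorname*{ess\,sup}_{x\in X}\ \limsup_{r\searrow0}\limsup_{\delta\searrow0}\Big(\big|\Theta_M(x)-\textstyle\sum_k\Pi_{L,k}(\delta,x,r,h)\big|+\big|\Theta_M(x)-\sum_k\Pi_{U,k}(\delta,x,r,h)\big|\Big)=0 .$$ **Theorem.** Let $f\in L^p_{loc}(\Omega,Y)\cap S^{1,p}(\Omega,Y)$. Suppose there is a Borel function $e:\Omega\to[0,\infty)$ such that for $m$-a.e. $x\in\Omega$ there is a sequence $(V_{x,n})_{n\in\mathbb N}$ of Borel subsets of $\Omega$, each having $x$ as a density point (that is, $m(B(x,r))>0$ for all $r>0$ and $m(V_{x,n}\cap B(x,r))/m(B(x,r))\to1$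 as $r\searrow0$), with $$\limsup_{n\to\infty}\ \limsup_{r\searrow0}\ \big|\mathsf{ks}_p[f,V_{x,n}](x,r)-e(x)\big|=0 .$$ Then: (i) $e$ is the $p$-energy density $\mathsf e_p[f]$ of $f$; (ii) for every strongly $p$-admissible family $(\rho_\delta)_{\delta\in(0,1)}$, every function $\Theta_M$ as in 7, and every open $\Omega'\Subset\Omega$, $$\limsup_{r\searrow0}\limsup_{\delta\searrow0}\Big|\int_{\Omega'\cap B(x,r)}d_f(x,x')^p\rho_\delta(x,x')\,dm(x')-\Theta_M(x)\,\mathsf e_p[f](x)\Big|=0\quad\text{for }m\text{-a.e. }x\in\Omega',$$ $$\limsup_{r\searrow0}\limsup_{\delta\searrow0}\int_{\Omega'}\Big|\int_{\Omega'\cap B(x,r)}d_f(x,x')^p\rho_\delta(x,x')\,dm(x')-\Theta_M(x)\,\mathsf e_p[f](x)\Big|\,dm(x)=0 .$$ -/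

import Mathlib

open MeasureTheory Filter Topology Metric Set
open scoped ENNReal NNReal

noncomputable section

namespace MetricBBM

/-- The absolute value of the difference of two extended nonnegative numbers. -/
def absDiff (a b : ℝ≥0∞) : ℝ≥0∞ := (a - b) + (b - a)

section Space

variable {X : Type*} [MetricSpace X]

/-- Every point has a complete closed ball around it. -/
def LocallyComplete (X : Type*) [MetricSpace X] : Prop :=
  ∀ x : X, ∃ r : ℝ, 0 < r ∧ IsComplete (closedBall x r)

/-- `S` is a well-contained subset of `S₀`: the distance in the completion of `X` between `S` and
the complement of `S₀` in that completion is positive (the distance to the empty set is `+∞`). -/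
def WellContained (S S₀ : Set X) : Prop :=
  S ⊆ S₀ ∧ ∃ ε : ℝ, 0 < ε ∧ ∀ x ∈ S, ∀ y : UniformSpace.Completion X,
    y ∉ ((↑) : X → UniformSpace.Completion X) '' S₀ →
      ε ≤ dist (x : UniformSpace.Completion X) y

/-- The local Lipschitz constant. On an open set it only depends on the values of `u` there, and it
is `0` at isolated points, where the punctured neighbourhood filter is trivial. -/
def lip (u : X → ℝ) (x : X) : ℝ≥0∞ :=
  limsup (fun y => edist (u x) (u y) / edist x y) (𝓝[≠] x)

variable [MeasurableSpace X]

/-- `u n → u` in `L^p_loc(O)`. -/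
def TendstoLpLoc (μ : Measure X) (p : ℝ) (O : Set X) (u : ℕ → X → ℝ) (v : X → ℝ) : Prop :=
  ∀ x ∈ O, ∃ r : ℝ, 0 < r ∧
    Tendsto (fun n => ∫⁻ y in O ∩ closedBall x r, edist (u n y) (v y) ^ p ∂μ) atTop (𝓝 0)

/-- The Cheeger `p`-energy of the function `v` on the open set `O`, by relaxation. -/
def cheegerOpen (μ : Measure X) (p : ℝ) (v : X → ℝ) (O : Set X) : ℝ≥0∞ :=
  ⨅ (u : ℕ → X → ℝ) (_ : ∀ n, LocallyLipschitzOn O (u n)) (_ : TendstoLpLoc μ p O u v),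
    liminf (fun n => ∫⁻ x in O, lip (u n) x ^ p ∂μ) atTop

/-- The extension of the Cheeger `p`-energy of `v` to arbitrary subsets of the open set `Ω`. -/
def cheegerSet (μ : Measure X) (p : ℝ) (Ω : Set X) (v : X → ℝ) (S : Set X) : ℝ≥0∞ :=
  ⨅ (O : Set X) (_ : IsOpen O) (_ : O ⊆ Ω) (_ : S ⊆ O), cheegerOpen μ p v O

/-- `x` is a density point of `E`. -/
def IsDensityPoint (μ : Measure X) (E : Set X) (x : X) : Prop :=
  (∀ r : ℝ, 0 < r → 0 < μ (closedBall x r)) ∧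
    Tendsto (fun r : ℝ => μ (E ∩ closedBall x r) / μ (closedBall x r)) (𝓝[>] 0) (𝓝 1)

/-- The internal doubling condition. Here `cthickening R S` is the set of all points whose distance
to `S` is at most `R`. -/
def InternallyDoubling (μ : Measure X) : Prop :=
  ∃ C : ℝ≥0, 1 ≤ C ∧ ∀ S : Set X, WellContained S univ → ∃ R : ℝ, 0 < R ∧
    ∀ x ∈ cthickening R S, ∀ r : ℝ, 0 < r → r ≤ R →
      0 < μ (closedBall x (2 * r)) ∧
      μ (closedBall x (2 * r)) ≤ C * μ (closedBall x r) ∧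
      C * μ (closedBall x r) < ∞

/-- The internal `p`-Poincaré inequality. -/
def InternalPoincare (μ : Measure X) (p : ℝ) : Prop :=
  ∃ (C : ℝ≥0) (l : ℝ), 0 < C ∧ 1 ≤ l ∧
    ∀ S : Set X, WellContained S univ → ∃ R : ℝ, 0 < R ∧
      (∀ x ∈ cthickening R S, ∀ r : ℝ, 0 < r → r ≤ l * R →
        0 < μ (closedBall x r) ∧ μ (closedBall x r) < ∞) ∧
      ∀ u : X → ℝ, (∃ K : ℝ≥0, LipschitzWith K u) →
        ∀ x ∈ cthickening R S, ∀ r : ℝ, 0 < r → r ≤ R →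
          ⨍⁻ y in closedBall x r, edist (u y) (⨍ z in closedBall x r, u z ∂μ) ∂μ ≤
            C * ENNReal.ofReal r *
              (⨍⁻ y in closedBall x (l * r), lip u y ^ p ∂μ) ^ (1 / p)

end Space

section Maps

variable {X : Type*} [MetricSpace X] [MeasurableSpace X] {Y : Type*} [MetricSpace Y]

/-- `ν` is the Cheeger `p`-energy of the map `f` on `Ω`: the lowest measure that dominates the
energies of all postcompositions of `f` with bounded `1`-Lipschitz functions, on all subsets of `Ω`.
(A `Measure` is evaluated on all sets through its Borel-regular outer measure, and the lowest one
does not charge the complement of `Ω`.) -/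
def IsCheegerEnergy (μ : Measure X) (p : ℝ) (Ω : Set X) (f : X → Y) (ν : Measure X) : Prop :=
  IsLeast {ν' : Measure X | ∀ φ : Y → ℝ, LipschitzWith 1 φ → (∃ C : ℝ, ∀ y, |φ y| ≤ C) →
    ∀ S : Set X, S ⊆ Ω → cheegerSet μ p Ω (φ ∘ f) S ≤ ν' S} ν

/-- `f` belongs to the Sobolev class `S^{1,p}(Ω, Y)`: it is a.e. equal on `Ω` to a separably valued
Borel map, and its Cheeger `p`-energy is finite and absolutely continuous. -/
def MemSobolevClass (μ : Measure X) (p : ℝ) (Ω : Set X) (f : X → Y) : Prop :=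
  AEStronglyMeasurable f (μ.restrict Ω) ∧
    ∃ ν : Measure X, IsCheegerEnergy μ p Ω f ν ∧ ν Ω < ∞ ∧ ν ≪ μ.restrict Ω

/-- `f` belongs to `L^p_loc(Ω, Y)`. -/
def MemLpLoc (μ : Measure X) (p : ℝ) (Ω : Set X) (f : X → Y) : Prop :=
  AEStronglyMeasurable f (μ.restrict Ω) ∧
    ∃ y : Y, ∀ x ∈ Ω, ∃ r : ℝ, 0 < r ∧
      ∫⁻ z in Ω ∩ closedBall x r, edist (f z) y ^ p ∂μ < ∞

open Classical in
/-- The Korevaar–Schoen approximate `p`-energy density of `f` along `E` at the scale `r`. -/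
def ks (μ : Measure X) (p : ℝ) (f : X → Y) (E : Set X) (x : X) (r : ℝ) : ℝ≥0∞ :=
  if 0 < μ (closedBall x r) ∧ μ (closedBall x r) < ∞ then
    (μ (closedBall x r))⁻¹ *
      ∫⁻ y in closedBall x r ∩ E, edist (f x) (f y) ^ p / ENNReal.ofReal r ^ p ∂μ
  else 0

/-- `e` is the `p`-energy density of `f` on `Ω`. -/
def IsEnergyDensity (μ : Measure X) (p : ℝ) (Ω : Set X) (f : X → Y) (e : X → ℝ≥0) : Prop :=
  AEMeasurable e (μ.restrict Ω) ∧
    ∀ Ω' : Set X, IsOpen Ω' → WellContained Ω' Ω →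
      ∫⁻ x in Ω', e x ∂μ < ∞ ∧
      Tendsto (fun r : ℝ => ∫⁻ x in Ω', absDiff (ks μ p f Ω x r) (e x) ∂μ) (𝓝[>] 0) (𝓝 0) ∧
      ∀ᵐ x ∂μ.restrict Ω', Tendsto (fun r : ℝ => ks μ p f Ω x r) (𝓝[>] 0) (𝓝 (e x : ℝ≥0∞))

end Maps

section Mollifiers

variable {X : Type*} [MetricSpace X]

/-- The supremum of `ρ δ x` outside the closed ball `B(x, r)` (`0` if that complement is empty). -/
def molSup (ρ : ℝ → X → X → ℝ≥0) (δ : ℝ) (x : X) (r : ℝ) : ℝ≥0∞ :=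
  ⨆ (y : X) (_ : y ∉ closedBall x r), (ρ δ x y : ℝ≥0∞)

/-- The increment of `molSup` between consecutive radii of the grid `r / h ^ k`; the first one is
the value at `r / h`. -/
def molInc (ρ : ℝ → X → X → ℝ≥0) (δ : ℝ) (x : X) (r h : ℝ) (k : ℕ) : ℝ≥0∞ :=
  if k = 0 then molSup ρ δ x (r / h)
  else absDiff (molSup ρ δ x (r / h ^ (k + 1))) (molSup ρ δ x (r / h ^ k))

variable [MeasurableSpace X]

/-- The lower weight `Π_{L,k}`: the factor is evaluated at the inner radius `r / h ^ (k + 1)`. -/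
def piL (μ : Measure X) (p : ℝ) (ρ : ℝ → X → X → ℝ≥0) (k : ℕ) (δ : ℝ) (x : X) (r h : ℝ) : ℝ≥0∞ :=
  molInc ρ δ x r h k * μ (closedBall x (r / h ^ (k + 1))) * ENNReal.ofReal (r / h ^ (k + 1)) ^ p

/-- The upper weight `Π_{U,k}`: the factor is evaluated at the outer radius `r / h ^ k`. -/
def piU (μ : Measure X) (p : ℝ) (ρ : ℝ → X → X → ℝ≥0) (k : ℕ) (δ : ℝ) (x : X) (r h : ℝ) : ℝ≥0∞ :=
  molInc ρ δ x r h k * μ (closedBall x (r / h ^ k)) * ENNReal.ofReal (r / h ^ k) ^ p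

/-- `p`-admissible families of mollifiers; only the parameters `δ ∈ (0, 1)` matter. -/
structure Admissible (μ : Measure X) (p : ℝ) (ρ : ℝ → X → X → ℝ≥0) : Prop where
  measurable : ∀ δ ∈ Ioo (0 : ℝ) 1, Measurable (fun z : X × X => ρ δ z.1 z.2)
  tail : limsup (fun r : ℝ => limsup (fun δ : ℝ =>
      ⨆ x : X, ∫⁻ y in (closedBall x r)ᶜ, ((ρ δ x y : ℝ≥0∞) + ρ δ y x) ∂μ) (𝓝[>] 0)) (𝓝[>] 0) = 0
  tail_sup : ∀ x : X,
    limsup (fun r : ℝ => limsup (fun δ : ℝ => molSup ρ δ x r) (𝓝[>] 0)) (𝓝[>] 0) = 0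
  antitone : ∀ δ ∈ Ioo (0 : ℝ) 1, ∀ x y z : X, x ≠ y → dist x y ≤ dist x z → ρ δ x z ≤ ρ δ x y
  origin : ∀ x : X, ∀ δ ∈ Ioo (0 : ℝ) 1,
    limsup (fun r : ℝ => molSup ρ δ x r * μ (closedBall x r) * ENNReal.ofReal r ^ p) (𝓝[>] 0) = 0
  bounds : ∃ C : ℝ≥0, 1 ≤ C ∧ ∀ S : Set X, S.Nonempty → WellContained S univ →
    (C : ℝ≥0∞)⁻¹ ≤ liminf (fun r : ℝ => liminf (fun δ : ℝ =>
      ∑' k : ℕ, ⨅ x ∈ S, piL μ p ρ k δ x r 2) (𝓝[>] 0)) (𝓝[>] 0) ∧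
    limsup (fun r : ℝ => limsup (fun δ : ℝ =>
      ∑' k : ℕ, ⨆ x ∈ S, piU μ p ρ k δ x r 2) (𝓝[>] 0)) (𝓝[>] 0) ≤ C

/-- `Θ` is a limit density `Θ_M` of the family of mollifiers. -/
def IsMollifierDensity (μ : Measure X) (p : ℝ) (ρ : ℝ → X → X → ℝ≥0) (Θ : X → ℝ≥0) : Prop :=
  AEMeasurable Θ μ ∧
    limsup (fun h : ℝ => essSup (fun x : X =>
      limsup (fun r : ℝ => limsup (fun δ : ℝ =>
        absDiff (Θ x) (∑' k : ℕ, piL μ p ρ k δ x r h) +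
          absDiff (Θ x) (∑' k : ℕ, piU μ p ρ k δ x r h)) (𝓝[>] 0)) (𝓝[>] 0)) μ) (𝓝[>] 1) = 0

/-- Strongly `p`-admissible families of mollifiers. -/
structure StronglyAdmissible (μ : Measure X) (p : ℝ) (ρ : ℝ → X → X → ℝ≥0) : Prop
    extends Admissible μ p ρ where
  bounds_all : ∀ S : Set X, WellContained S univ → ∀ h : ℝ, 1 < h →
    limsup (fun r : ℝ => limsup (fun δ : ℝ =>
      ∑' k : ℕ, ⨆ x ∈ S, piU μ p ρ k δ x r h) (𝓝[>] 0)) (𝓝[>] 0) < ∞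
  density : ∃ Θ : X → ℝ≥0, IsMollifierDensity μ p ρ Θ

end Mollifiers

end MetricBBM

end

open MetricBBM

/-! The crux is that the limit of the Korevaar–Schoen energies along sets of density one already
determines the limit along all of Ω. Let g be the density of the Cheeger energy of f. The Poincaré
inequality, passed to relaxed energies and telescoped over the radii r / 2 ^ k, yields d_f(x,y)^p ≤
c r^p (T g(x) + T g(y)) for all x, y outside a null set with d(x,y) ≤ r, locally and at small scales
(`exists_null_edist_rpow_le`). Here T = `multiAvg`, at a scale comparable to r, is a geometrically
weighted sum of ball averages. Unlike a maximal operator, T is bounded on L¹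
(`lintegral_multiAvg_le`), so p = 1 needs no separate treatment.

This bound has two consequences. At Lebesgue points of g, sets of density zero contribute nothing in
the limit (`IncrementBound.tendsto_ks_zero`), so `ks` along Ω converges a.e. to e. Splitting g into
a bounded part and a part of small integral dominates `ks` by an integrable function up to a small
L¹ error (`IncrementBound.exists_dominating`), which upgrades a.e. convergence to L¹ convergence
(`tendsto_lintegral_absDiff`).

For the mollifiers, radial monotonicity squeezes ρ_δ(x,·) between two layer-cake sums of indicators
of balls with radii r / h ^ k. Integrating d_f^p turns these into sums of `ks` at those radii with
weights Π_L and Π_U. For small r each `ks` is close to e, and for h near 1 both sums of weights are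
close to Θ_M (`absDiff_mollified_le`). In L¹ the deviation of the weights is controlled by a reverse
Fatou lemma for iterated upper limits (`limsup_limsup_lintegral_le`). -/

namespace MetricBBM

/-! ### Ball averages and the multi-scale averaging operator. -/

section Averages

variable {X : Type*} [MetricSpace X] [MeasurableSpace X]

/-- Doubling with constant `C` for the balls with centre in `S` and radius at most `R`. -/
def DoublingOn (μ : Measure X) (C : ℝ≥0) (R : ℝ) (S : Set X) : Prop :=
  1 ≤ C ∧ ∀ x ∈ S, ∀ r : ℝ, 0 < r → r ≤ R →
    0 < μ (closedBall x r) ∧ μ (closedBall x r) < ∞ ∧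
      μ (closedBall x (2 * r)) ≤ C * μ (closedBall x r)

/-- The mean value of `w` over the closed ball with centre `x` and radius `s`. -/
noncomputable def ballAvg (μ : Measure X) (w : X → ℝ≥0∞) (s : ℝ) (x : X) : ℝ≥0∞ :=
  (μ (closedBall x s))⁻¹ * ∫⁻ y in closedBall x s, w y ∂μ

/-- A weighted sum of the mean values of `w` over the balls of radius `r / 2 ^ k`. -/
noncomputable def multiAvg (μ : Measure X) (w : X → ℝ≥0∞) (r : ℝ) (x : X) : ℝ≥0∞ :=
  ∑' k : ℕ, (3 / 4 : ℝ≥0∞) ^ k * ballAvg μ w (r / 2 ^ k) x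

lemma tsum_three_quarters : ∑' k : ℕ, (3 / 4 : ℝ≥0∞) ^ k = 4 := by
  rw [ENNReal.tsum_geometric]
  have : (1 - 3 / 4 : ℝ≥0∞) = 4⁻¹ := by
    refine (ENNReal.eq_sub_of_add_eq (by finiteness) ?_).symm
    rw [← one_div, ENNReal.div_add_div_same]
    norm_num
    exact ENNReal.div_self (by norm_num) (by norm_num)
  rw [this, inv_inv]

lemma inv_mul_self_le_one (a : ℝ≥0∞) : a⁻¹ * a ≤ 1 := by
  rw [mul_comm, ← div_eq_mul_inv]; exact ENNReal.div_self_le_one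

/-- Converts a doubling estimate into a comparison of the normalising factors of two averages; only
0 < C < ∞ matters, so degenerate values of a and b need no separate cases. -/
lemma inv_le_mul_inv {a b : ℝ≥0∞} {C : ℝ≥0} (hC : 1 ≤ C) (h : b ≤ C * a) :
    a⁻¹ ≤ C * b⁻¹ := by
  have hC0 : (C : ℝ≥0∞) ≠ 0 := by
    have : C ≠ 0 := (lt_of_lt_of_le one_pos hC).ne'
    exact_mod_cast this
  calc a⁻¹ = C * (C * a)⁻¹ := by
        rw [ENNReal.mul_inv (Or.inl hC0) (Or.inl ENNReal.coe_ne_top), ← mul_assoc,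
          ENNReal.mul_inv_cancel hC0 ENNReal.coe_ne_top, one_mul]
    _ ≤ C * b⁻¹ := by gcongr

variable {μ : Measure X}

lemma ballAvg_mono {v w : X → ℝ≥0∞} {s : ℝ} {x : X} (h : ∀ y ∈ closedBall x s, v y ≤ w y)
    [OpensMeasurableSpace X] :
    ballAvg μ v s x ≤ ballAvg μ w s x := by
  unfold ballAvg
  gcongr 1
  exact setLIntegral_mono' measurableSet_closedBall h

lemma ballAvg_add {v w : X → ℝ≥0∞} (hv : Measurable v) (s : ℝ) (x : X) :
    ballAvg μ (fun y => v y + w y) s x = ballAvg μ v s x + ballAvg μ w s x := by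
  unfold ballAvg
  rw [lintegral_add_left hv, mul_add]

lemma ballAvg_le_of_le [OpensMeasurableSpace X] {w : X → ℝ≥0∞} {s : ℝ} {x : X} {c : ℝ≥0∞}
    (h : ∀ y ∈ closedBall x s, w y ≤ c) : ballAvg μ w s x ≤ c := by
  refine (ballAvg_mono h).trans ?_
  unfold ballAvg
  rw [setLIntegral_const, mul_left_comm]
  calc c * ((μ (closedBall x s))⁻¹ * μ (closedBall x s)) ≤ c * 1 := by
        gcongr; exact inv_mul_self_le_one _
    _ = c := mul_one c

lemma multiAvg_mono [OpensMeasurableSpace X] {v w : X → ℝ≥0∞} {r : ℝ} {x : X}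
    (hr : 0 ≤ r) (h : ∀ y ∈ closedBall x r, v y ≤ w y) :
    multiAvg μ v r x ≤ multiAvg μ w r x := by
  refine ENNReal.tsum_le_tsum fun k => ?_
  gcongr 1
  refine ballAvg_mono fun y hy => h y (closedBall_subset_closedBall ?_ hy)
  exact div_le_self hr (one_le_pow₀ one_le_two)

lemma multiAvg_add {v w : X → ℝ≥0∞} (hv : Measurable v) (r : ℝ) (x : X) :
    multiAvg μ (fun y => v y + w y) r x = multiAvg μ v r x + multiAvg μ w r x := by
  unfold multiAvg
  simp_rw [ballAvg_add hv, mul_add]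
  exact ENNReal.tsum_add

lemma multiAvg_le_of_ballAvg_le {w : X → ℝ≥0∞} {r : ℝ} {x : X} {c : ℝ≥0∞}
    (h : ∀ k : ℕ, ballAvg μ w (r / 2 ^ k) x ≤ c) : multiAvg μ w r x ≤ 4 * c := by
  calc multiAvg μ w r x ≤ ∑' k : ℕ, (3 / 4 : ℝ≥0∞) ^ k * c :=
        ENNReal.tsum_le_tsum fun k => by gcongr; exact h k
    _ = 4 * c := by rw [ENNReal.tsum_mul_right, tsum_three_quarters]

lemma multiAvg_le_of_le [OpensMeasurableSpace X] {w : X → ℝ≥0∞} {r : ℝ} {x : X} {c : ℝ≥0∞}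
    (hr : 0 ≤ r) (h : ∀ y ∈ closedBall x r, w y ≤ c) : multiAvg μ w r x ≤ 4 * c :=
  multiAvg_le_of_ballAvg_le fun _ => ballAvg_le_of_le fun y hy =>
    h y (closedBall_subset_closedBall (div_le_self hr (one_le_pow₀ one_le_two)) hy)

variable [BorelSpace X] [SecondCountableTopology X] [SFinite μ]

lemma measurable_setLIntegral_closedBall {w : X → X → ℝ≥0∞} (hw : Measurable (Function.uncurry w))
    (s : ℝ) : Measurable fun x => ∫⁻ y in closedBall x s, w x y ∂μ := by
  have hset : MeasurableSet {z : X × X | dist z.2 z.1 ≤ s} :=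
    measurableSet_le (measurable_snd.dist measurable_fst) measurable_const
  have : ∀ x, ∫⁻ y in closedBall x s, w x y ∂μ =
      ∫⁻ y, {z : X × X | dist z.2 z.1 ≤ s}.indicator (Function.uncurry w) (x, y) ∂μ := by
    intro x
    rw [← lintegral_indicator measurableSet_closedBall]
    refine lintegral_congr fun y => ?_
    by_cases h : dist y x ≤ s <;> simp [indicator, h, Function.uncurry]
  simp_rw [this]
  exact (hw.indicator hset).lintegral_prod_right'

lemma measurable_measure_closedBall (s : ℝ) : Measurable fun x => μ (closedBall x s) := by
  have := measurable_setLIntegral_closedBall (μ := μ) (w := fun _ _ => 1) measurable_const s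
  simpa using this

lemma measurable_ballAvg {w : X → ℝ≥0∞} (hw : Measurable w) (s : ℝ) :
    Measurable (ballAvg μ w s) :=
  (measurable_measure_closedBall s).inv.mul
    (measurable_setLIntegral_closedBall (w := fun _ y => w y) (hw.comp measurable_snd) s)

lemma measurable_multiAvg {w : X → ℝ≥0∞} (hw : Measurable w) (r : ℝ) :
    Measurable (multiAvg μ w r) :=
  Measurable.tsum fun _ => (measurable_ballAvg hw _).const_mul _

/-- Tonelli: for fixed y the variable x runs over points of E with d(x,y) ≤ s. There B(y,s) ⊆
B(x,2s), so 1/μ(B(x,s)) is at most C/μ(B(y,s)) and the kernel integrates in x to at most C. -/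
lemma lintegral_ballAvg_le {C : ℝ≥0} {R s : ℝ} {S E F : Set X} (hD : DoublingOn μ C R S)
    (hs : 0 < s) (hsR : s ≤ R) (hE : MeasurableSet E) (hES : E ⊆ S)
    (hEF : ∀ x ∈ E, closedBall x s ⊆ F) {w : X → ℝ≥0∞} (hw : Measurable w) :
    ∫⁻ x in E, ballAvg μ w s x ∂μ ≤ C * ∫⁻ x in F, w x ∂μ := by
  have hset : MeasurableSet {z : X × X | dist z.2 z.1 ≤ s} :=
    measurableSet_le (measurable_snd.dist measurable_fst) measurable_const
  set K : X × X → ℝ≥0∞ := {z : X × X | dist z.2 z.1 ≤ s}.indicator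
    (fun z => (μ (closedBall z.1 s))⁻¹ * w z.2) with hK
  have hKm : Measurable K := by
    refine Measurable.indicator ?_ hset
    exact ((measurable_measure_closedBall s).comp measurable_fst).inv.mul (hw.comp measurable_snd)
  have h1 : ∀ x, ballAvg μ w s x = ∫⁻ y, K (x, y) ∂μ := by
    intro x
    unfold ballAvg
    rw [← lintegral_const_mul _ hw, ← lintegral_indicator measurableSet_closedBall]
    refine lintegral_congr fun y => ?_
    by_cases h : dist y x ≤ s <;> simp [hK, indicator, h]
  simp_rw [h1]
  rw [lintegral_lintegral_swap (f := fun x y => K (x, y)) hKm.aemeasurable]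
  have h2 : ∀ y, ∫⁻ x in E, K (x, y) ∂μ ≤ C * F.indicator w y := by
    intro y
    by_cases hy : y ∈ F
    · rw [indicator_of_mem hy]
      calc ∫⁻ x in E, K (x, y) ∂μ
          ≤ ∫⁻ x in E, (closedBall y s).indicator
              (fun _ => C * (μ (closedBall y s))⁻¹ * w y) x ∂μ := by
            refine setLIntegral_mono' hE fun x hx => ?_
            by_cases h : dist y x ≤ s
            · have h' : dist x y ≤ s := by rwa [dist_comm]
              have hle : μ (closedBall y s) ≤ C * μ (closedBall x s) :=
                (measure_mono (closedBall_subset_closedBall' (by linarith))).trans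
                  (hD.2 x (hES hx) s hs hsR).2.2
              simp only [hK, indicator, mem_ofPred_eq, h, h', mem_closedBall, if_true]
              gcongr
              exact inv_le_mul_inv hD.1 hle
            · simp [hK, indicator, h]
        _ ≤ ∫⁻ x, (closedBall y s).indicator
              (fun _ => C * (μ (closedBall y s))⁻¹ * w y) x ∂μ := setLIntegral_le_lintegral _ _
        _ = C * w y * ((μ (closedBall y s))⁻¹ * μ (closedBall y s)) := by
            rw [lintegral_indicator measurableSet_closedBall, setLIntegral_const]; ring
        _ ≤ C * w y * 1 := by gcongr; exact inv_mul_self_le_one _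
        _ = C * w y := mul_one _
    · have : ∀ x ∈ E, K (x, y) = 0 := by
        intro x hx
        have : ¬ dist y x ≤ s := fun h => hy (hEF x hx h)
        simp [hK, this]
      rw [setLIntegral_congr_fun hE this]
      simp
  calc ∫⁻ y, ∫⁻ x in E, K (x, y) ∂μ ∂μ ≤ ∫⁻ y, C * F.indicator w y ∂μ := lintegral_mono h2
    _ = C * ∫⁻ y, F.indicator w y ∂μ := lintegral_const_mul' _ _ ENNReal.coe_ne_top
    _ ≤ C * ∫⁻ x in F, w x ∂μ := by gcongr 1; exact lintegral_indicator_le _ _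

/-- Each scale costs the factor C, and the weights sum to 4. This strong L¹ bound is what a maximal
function would lack. -/
lemma lintegral_multiAvg_le {C : ℝ≥0} {R r : ℝ} {S E F : Set X} (hD : DoublingOn μ C R S)
    (hr : 0 < r) (hrR : r ≤ R) (hE : MeasurableSet E) (hES : E ⊆ S)
    (hEF : ∀ x ∈ E, closedBall x r ⊆ F) {w : X → ℝ≥0∞} (hw : Measurable w) :
    ∫⁻ x in E, multiAvg μ w r x ∂μ ≤ 4 * C * ∫⁻ x in F, w x ∂μ := by
  unfold multiAvg
  rw [lintegral_tsum fun k => ((measurable_ballAvg hw _).const_mul _).aemeasurable]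
  calc ∑' k : ℕ, ∫⁻ x in E, (3 / 4 : ℝ≥0∞) ^ k * ballAvg μ w (r / 2 ^ k) x ∂μ
      ≤ ∑' k : ℕ, (3 / 4 : ℝ≥0∞) ^ k * (C * ∫⁻ x in F, w x ∂μ) := by
        refine ENNReal.tsum_le_tsum fun k => ?_
        have hle : r / 2 ^ k ≤ r := div_le_self hr.le (one_le_pow₀ one_le_two)
        rw [lintegral_const_mul _ (measurable_ballAvg hw _)]
        gcongr
        exact lintegral_ballAvg_le hD (by positivity) (hle.trans hrR) hE hES
          (fun x hx => (closedBall_subset_closedBall hle).trans (hEF x hx)) hw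
    _ = 4 * C * ∫⁻ x in F, w x ∂μ := by
        rw [ENNReal.tsum_mul_right, tsum_three_quarters, mul_assoc]

end Averages

/-! ### Well-contained sets and the completion. -/

section Completion

variable {X : Type*} [MetricSpace X]

/-- When no point missing from X is within r of x, the ball of X coincides with the closed ball of
the completion. -/
lemma isComplete_closedBall_of_lt_dist {x : X} {r : ℝ}
    (h : ∀ y : UniformSpace.Completion X, y ∉ range ((↑) : X → UniformSpace.Completion X) →
      r < dist (x : UniformSpace.Completion X) y) : IsComplete (closedBall x r) := by
  rw [← (UniformSpace.Completion.isUniformInducing_coe X).isComplete_iff]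
  have : ((↑) : X → UniformSpace.Completion X) '' closedBall x r =
      closedBall (x : UniformSpace.Completion X) r := by
    ext y
    constructor
    · rintro ⟨z, hz, rfl⟩
      rw [mem_closedBall, UniformSpace.Completion.dist_eq]
      exact hz
    · intro hy
      by_cases hyr : y ∈ range ((↑) : X → UniformSpace.Completion X)
      · obtain ⟨z, rfl⟩ := hyr
        rw [mem_closedBall, UniformSpace.Completion.dist_eq] at hy
        exact ⟨z, hy, rfl⟩
      · rw [mem_closedBall, dist_comm] at hy
        exact absurd hy (not_le.2 (h y hyr))
  rw [this]
  exact isClosed_closedBall.isComplete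

/-- A complete ball is closed in the completion, and any point of the completion at distance less
than r from the centre is a limit of points of that ball, hence lies in X. -/
lemma LocallyComplete.wellContained_singleton (hX : LocallyComplete X) (x : X) :
    WellContained {x} (univ : Set X) := by
  obtain ⟨r, hr, hc⟩ := hX x
  refine ⟨subset_univ _, r, hr, ?_⟩
  rintro z rfl y hy
  by_contra! hlt
  rw [← (UniformSpace.Completion.isUniformInducing_coe X).isComplete_iff] at hc
  have hmem : y ∈ closure (((↑) : X → UniformSpace.Completion X) '' closedBall z r) := by
    rw [Metric.mem_closure_iff]
    intro ε hε
    obtain ⟨w, hw⟩ := (UniformSpace.Completion.denseRange_coe (α := X)).exists_dist_lt y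
      (lt_min hε (sub_pos.2 hlt))
    refine ⟨w, ⟨w, ?_, rfl⟩, hw.trans_le (min_le_left _ _)⟩
    rw [mem_closedBall, ← UniformSpace.Completion.dist_eq]
    have h1 := hw.trans_le (min_le_right _ _)
    have h2 := dist_triangle_left (w : UniformSpace.Completion X) z y
    rw [dist_comm y (z : UniformSpace.Completion X)] at h2
    linarith
  rw [hc.isClosed.closure_eq] at hmem
  exact hy (image_mono (subset_univ _) hmem)

lemma WellContained.to_univ {S Ω : Set X} (h : WellContained S Ω) : WellContained S univ := by
  obtain ⟨h1, ε, hε, h2⟩ := h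
  exact ⟨subset_univ _, ε, hε, fun x hx y hy => h2 x hx y fun h' => hy (image_mono (subset_univ _) h')⟩

end Completion

/-! ### Compactness of small balls and uniform local constants. -/

section LocalGeometry

variable {X : Type*} [MetricSpace X] [MeasurableSpace X] {μ : Measure X}

lemma DoublingOn.mono {C : ℝ≥0} {R R' : ℝ} {S S' : Set X} (hD : DoublingOn μ C R S)
    (hR : R' ≤ R) (hS : S' ⊆ S) : DoublingOn μ C R' S' :=
  ⟨hD.1, fun x hx r hr hrR => hD.2 x (hS hx) r hr (hrR.trans hR)⟩

lemma DoublingOn.measure_pow_le {C : ℝ≥0} {R : ℝ} {S : Set X} (hD : DoublingOn μ C R S) {x : X}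
    (hx : x ∈ S) {s : ℝ} (hs : 0 < s) (N : ℕ) (hN : 2 ^ N * s ≤ 2 * R) :
    μ (closedBall x (2 ^ N * s)) ≤ C ^ N * μ (closedBall x s) := by
  induction N with
  | zero => simp
  | succ N ih =>
    have h0 : 0 < 2 ^ N * s := by positivity
    have h1 : 2 ^ N * s ≤ R := by rw [pow_succ] at hN; linarith
    calc μ (closedBall x (2 ^ (N + 1) * s)) = μ (closedBall x (2 * (2 ^ N * s))) := by
          congr 2; ring
      _ ≤ C * μ (closedBall x (2 ^ N * s)) := (hD.2 x hx _ h0 h1).2.2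
      _ ≤ C * (C ^ N * μ (closedBall x s)) := by gcongr; exact ih (by linarith)
      _ = C ^ (N + 1) * μ (closedBall x s) := by ring

/-- Total boundedness by volume counting: an infinite ε-separated sequence in the ball would give
infinitely many disjoint small balls inside B(x,2r), each of measure at least a fixed fraction of
that of B(x,r). -/
lemma DoublingOn.isCompact_closedBall [OpensMeasurableSpace X] {C : ℝ≥0} {R : ℝ} {S : Set X}
    (hD : DoublingOn μ C R S) {x : X} {r : ℝ} (hr : 0 < r) (hrR : 2 * r ≤ R)
    (hS : closedBall x r ⊆ S) (hc : IsComplete (closedBall x r)) :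
    IsCompact (closedBall x r) := by
  refine TotallyBounded.isCompact_of_isComplete ?_ hc
  rw [Metric.totallyBounded_iff]
  by_contra! hcon
  obtain ⟨ε, hε, hcon⟩ := hcon
  have hseq : ∃ u : ℕ → X, ∀ n, u n ∈ closedBall x r ∧ ∀ z ∈ u '' Iio n, ε ≤ dist (u n) z := by
    refine seq_of_forall_finite_exists
      (P := fun a t => a ∈ closedBall x r ∧ ∀ z ∈ t, ε ≤ dist a z) fun t ht => ?_
    have := hcon t ht
    obtain ⟨z, hz, hzt⟩ := not_subset.1 this
    refine ⟨z, hz, fun y hy => ?_⟩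
    by_contra! hlt
    exact hzt (mem_iUnion₂.2 ⟨y, hy, hlt⟩)
  obtain ⟨u, hu⟩ := hseq
  obtain ⟨N, hN⟩ := pow_unbounded_of_one_lt (6 * r / ε + 2) one_lt_two
  set s : ℝ := 2 * r / 2 ^ N with hs
  have hpow : (0 : ℝ) < 2 ^ N := by positivity
  have hs0 : 0 < s := by positivity
  have hdiv : 0 < 6 * r / ε := by positivity
  have hsr : s ≤ r := by
    rw [hs, div_le_iff₀ hpow]; nlinarith
  have hsε : 2 * s < ε := by
    have h1 : 6 * r / ε < 2 ^ N := by linarith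
    rw [div_lt_iff₀ hε] at h1
    have : s * 2 ^ N = 2 * r := by rw [hs]; field_simp
    by_contra! hle
    nlinarith
  have hNs : 2 ^ N * s = 2 * r := by rw [hs]; field_simp
  have hxS : x ∈ S := hS (mem_closedBall_self hr.le)
  have hlow : ∀ n, μ (closedBall x r) ≤ C ^ N * μ (closedBall (u n) s) := by
    intro n
    have h1 := (hD.measure_pow_le (hS (hu n).1) hs0 N (by rw [hNs]; linarith))
    rw [hNs] at h1
    refine (measure_mono (closedBall_subset_closedBall' ?_)).trans h1
    have := (hu n).1
    rw [mem_closedBall, dist_comm] at this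
    linarith
  have hdist : ∀ m n, m < n → ε ≤ dist (u n) (u m) := fun m n hmn =>
    (hu n).2 _ ⟨m, hmn, rfl⟩
  have hdisj : Pairwise (Function.onFun Disjoint fun n => closedBall (u n) s) := by
    intro m n hmn
    refine closedBall_disjoint_closedBall ?_
    rcases lt_or_gt_of_ne hmn with h | h
    · rw [dist_comm]; linarith [hdist m n h]
    · linarith [hdist n m h]
  have hsum : ∑' n, μ (closedBall (u n) s) ≤ μ (closedBall x (2 * r)) := by
    rw [← measure_iUnion hdisj fun _ => measurableSet_closedBall]
    refine measure_mono (iUnion_subset fun n => closedBall_subset_closedBall' ?_)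
    have := (hu n).1
    rw [mem_closedBall] at this
    linarith
  have hfin : μ (closedBall x (2 * r)) < ∞ := (hD.2 x hxS _ (by linarith) hrR).2.1
  have hpos : 0 < μ (closedBall x r) := (hD.2 x hxS r hr (by linarith)).1
  have htop : ∑' _ : ℕ, μ (closedBall x r) ≤ C ^ N * μ (closedBall x (2 * r)) :=
    calc ∑' _ : ℕ, μ (closedBall x r) ≤ ∑' n, C ^ N * μ (closedBall (u n) s) :=
          ENNReal.tsum_le_tsum hlow
      _ = C ^ N * ∑' n, μ (closedBall (u n) s) := ENNReal.tsum_mul_left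
      _ ≤ _ := by gcongr
  rw [ENNReal.tsum_const_eq_top_of_ne_zero hpos.ne'] at htop
  exact absurd htop (by
    rw [not_le]
    exact ENNReal.mul_lt_top (by finiteness) hfin)

/-- The local hypotheses at scale `R` for centres in `S`: doubling, compactness of balls, inclusion
of balls in `Ω`, and the Poincaré inequality for Lipschitz functions. -/
structure LocalPoincare (μ : Measure X) (p : ℝ) (Ω : Set X) (C P : ℝ≥0) (l R : ℝ) (S : Set X) :
    Prop where
  doubling : DoublingOn μ C R S
  one_le : 1 ≤ l
  compact : ∀ x ∈ S, ∀ r : ℝ, 0 < r → r ≤ R → IsCompact (closedBall x r)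
  subset : ∀ x ∈ S, ∀ r : ℝ, r ≤ R → closedBall x r ⊆ Ω
  poincare : ∀ u : X → ℝ, (∃ K : ℝ≥0, LipschitzWith K u) → ∀ x ∈ S, ∀ r : ℝ, 0 < r → r ≤ R →
    ⨍⁻ y in closedBall x r, edist (u y) (⨍ z in closedBall x r, u z ∂μ) ∂μ ≤
      P * ENNReal.ofReal r * (⨍⁻ y in closedBall x (l * r), lip u y ^ p ∂μ) ^ (1 / p)

lemma InternallyDoubling.doublingOn (hD : InternallyDoubling μ) :
    ∃ C : ℝ≥0, ∀ S : Set X, WellContained S univ → ∃ R : ℝ, 0 < R ∧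
      DoublingOn μ C R (cthickening R S) := by
  obtain ⟨C, hC, h⟩ := hD
  refine ⟨C, fun S hS => ?_⟩
  obtain ⟨R, hR, h⟩ := h S hS
  refine ⟨R, hR, hC, fun x hx r hr hrR => ?_⟩
  obtain ⟨h1, h2, h3⟩ := h x hx r hr hrR
  have hC0 : (C : ℝ≥0∞) ≠ 0 := by
    have : C ≠ 0 := (lt_of_lt_of_le one_pos hC).ne'
    exact_mod_cast this
  refine ⟨?_, ?_, h2⟩
  · by_contra h0
    have h0 : μ (closedBall x r) = 0 := by simpa using h0
    rw [h0, mul_zero] at h2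
    exact absurd h1 (not_lt.2 h2)
  · by_contra h0
    have h0 : μ (closedBall x r) = ∞ := by simpa using h0
    rw [h0, ENNReal.mul_top hC0] at h3
    exact lt_irrefl _ h3

lemma exists_localPoincare [OpensMeasurableSpace X] {p : ℝ} {Ω S : Set X}
    (hD : InternallyDoubling μ) (hP : InternalPoincare μ p) (hS : WellContained S Ω) :
    ∃ (C P : ℝ≥0) (l R : ℝ), 0 < R ∧ LocalPoincare μ p Ω C P l R (cthickening R S) := by
  obtain ⟨C, hD⟩ := hD.doublingOn
  obtain ⟨P, l, -, hl, hP⟩ := hP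
  obtain ⟨R₁, hR₁, hD⟩ := hD S hS.to_univ
  obtain ⟨R₂, hR₂, -, hP⟩ := hP S hS.to_univ
  obtain ⟨-, ε, hε, hS⟩ := hS
  -- With R ≤ R₁ / 2, balls of radius R about points of the R-thickening stay in the R₁-thickening,
  -- where doubling holds. Such points are within 2 R of S, so their R-balls stay within 3 R < ε of
  -- S, away from the complement of Ω and from the points missing from X.
  set R := min (R₁ / 2) (min R₂ (ε / 4)) with hRdef
  have hR : 0 < R := by positivity
  have hRR₁ : R ≤ R₁ / 2 := min_le_left _ _
  have hRR₂ : R ≤ R₂ := (min_le_right _ _).trans (min_le_left _ _)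
  have hRε : R ≤ ε / 4 := (min_le_right _ _).trans (min_le_right _ _)
  have hnear : ∀ x ∈ cthickening R S, ∃ x' ∈ S, dist x x' < 2 * R := fun x hx =>
    mem_thickening_iff.1 (cthickening_subset_thickening' (by linarith) (by linarith) S hx)
  have hball : ∀ x ∈ cthickening R S, ∀ r ≤ R, closedBall x r ⊆ cthickening R₁ S := by
    intro x hx r hr z hz
    refine cthickening_mono (by linarith : R + R ≤ R₁) S
      (cthickening_cthickening_subset hR.le hR.le S ?_)
    exact mem_cthickening_of_dist_le z x R _ hx (hz.trans hr)
  refine ⟨C, P, l, R, hR, hD.mono (by linarith) (cthickening_mono (by linarith) S), hl, ?_, ?_, ?_⟩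
  · intro x hx r hr hrR
    refine hD.isCompact_closedBall hr (by linarith) (hball x hx r hrR)
      (isComplete_closedBall_of_lt_dist fun y hy => ?_)
    obtain ⟨x', hx', hd⟩ := hnear x hx
    have h1 := hS x' hx' y fun h => hy (image_subset_range _ _ h)
    have h2 := dist_triangle (x' : UniformSpace.Completion X) x y
    rw [UniformSpace.Completion.dist_eq, dist_comm x' x] at h2
    linarith
  · intro x hx r hrR z hz
    by_contra hzΩ
    obtain ⟨x', hx', hd⟩ := hnear x hx
    have h1 := hS x' hx' z fun ⟨w, hw, hwz⟩ =>
      hzΩ (UniformSpace.Completion.coe_injective X hwz ▸ hw)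
    rw [UniformSpace.Completion.dist_eq] at h1
    have h2 := dist_triangle_left x' z x
    rw [mem_closedBall, dist_comm] at hz
    linarith
  · intro u hu x hx r hr hrR
    exact hP u hu x (cthickening_mono hRR₂ S hx) r hr (hrR.trans hRR₂)

end LocalGeometry

/-! ### The Poincaré inequality for relaxed energies. -/

lemma le_add_mul_rpow {a η : ℝ≥0∞} {p : ℝ} (hp : 1 ≤ p) (h0 : η ≠ 0) (ht : η ≠ ∞) :
    a ≤ η + (η ^ (p - 1))⁻¹ * a ^ p := by
  rcases le_total a η with h | h
  · exact h.trans le_self_add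
  · refine le_trans ?_ le_add_self
    have h1 : η ^ (p - 1) ≠ 0 := by
      simp [ENNReal.rpow_eq_zero_iff, h0, ht]
    have h2 : η ^ (p - 1) ≠ ∞ := ENNReal.rpow_ne_top_of_nonneg (by linarith) ht
    have h3 : a ^ p = a ^ (p - 1) * a := by
      have : p = (p - 1) + 1 := by ring
      conv_lhs => rw [this, ENNReal.rpow_add_of_nonneg _ _ (by linarith) zero_le_one,
        ENNReal.rpow_one]
    calc a = (η ^ (p - 1))⁻¹ * η ^ (p - 1) * a := by rw [ENNReal.inv_mul_cancel h1 h2, one_mul]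
      _ ≤ (η ^ (p - 1))⁻¹ * a ^ (p - 1) * a := by
          gcongr
      _ = (η ^ (p - 1))⁻¹ * a ^ p := by rw [h3, mul_assoc]

/-- The g n are not assumed measurable, so the pointwise bound a ≤ η + η^(1-p) a^p takes the place
of Hölder's inequality; η is sent to 0 at the end. -/
lemma tendsto_setLIntegral_of_rpow {X : Type*} [MeasurableSpace X] {μ : Measure X} {p : ℝ}
    (hp : 1 ≤ p) {K : Set X} (hK : μ K ≠ ∞)
    {g : ℕ → X → ℝ≥0∞} (h : Tendsto (fun n => ∫⁻ x in K, g n x ^ p ∂μ) atTop (𝓝 0)) :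
    Tendsto (fun n => ∫⁻ x in K, g n x ∂μ) atTop (𝓝 0) := by
  have key : ∀ η : ℝ≥0, 0 < η → ∀ᶠ n in atTop,
      ∫⁻ x in K, g n x ∂μ ≤ η * μ K + η := by
    intro η hη
    have h0 : (η : ℝ≥0∞) ≠ 0 := by exact_mod_cast hη.ne'
    set c : ℝ≥0∞ := ((η : ℝ≥0∞) ^ (p - 1))⁻¹ with hc
    have hct : c ≠ ∞ := by
      simp [hc, ENNReal.rpow_eq_zero_iff, h0]
    have h1 : Tendsto (fun n => c * ∫⁻ x in K, g n x ^ p ∂μ) atTop (𝓝 0) := by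
      simpa using ENNReal.Tendsto.const_mul h (Or.inr hct)
    filter_upwards [h1.eventually (gt_mem_nhds (pos_iff_ne_zero.2 h0))] with n hn
    calc ∫⁻ x in K, g n x ∂μ ≤ ∫⁻ x in K, (η + c * g n x ^ p) ∂μ :=
          lintegral_mono fun x => le_add_mul_rpow hp h0 ENNReal.coe_ne_top
      _ = η * μ K + c * ∫⁻ x in K, g n x ^ p ∂μ := by
          rw [lintegral_add_left measurable_const, setLIntegral_const,
            lintegral_const_mul' _ _ hct]
      _ ≤ η * μ K + η := by gcongr
  rw [ENNReal.tendsto_nhds_zero]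
  intro ε hε
  rcases eq_or_ne ε ∞ with rfl | hεt
  · simp
  have hlim : Tendsto (fun η : ℝ≥0 => (η : ℝ≥0∞) * μ K + η) (𝓝[>] 0) (𝓝 0) := by
    have h1 : Tendsto (fun η : ℝ≥0 => (η : ℝ≥0∞)) (𝓝[>] 0) (𝓝 0) := by
      have := (ENNReal.continuous_coe.tendsto (0 : ℝ≥0)).mono_left
        (nhdsWithin_le_nhds (s := Ioi 0))
      simpa using this
    simpa using (ENNReal.Tendsto.mul_const h1 (Or.inr hK)).add h1
  obtain ⟨η, hη, hη0⟩ := ((hlim.eventually (gt_mem_nhds hε)).and self_mem_nhdsWithin).exists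
  filter_upwards [key η hη0] with n hn
  exact hn.trans hη.le

section Relaxation

variable {X : Type*} [MetricSpace X]

lemma lip_congr_of_eqOn {u v : X → ℝ} {K : Set X} (h : EqOn u v K) {x : X} (hx : K ∈ 𝓝 x) :
    lip u x = lip v x := by
  unfold lip
  refine limsup_congr ?_
  filter_upwards [mem_nhdsWithin_of_mem_nhds hx] with y hy
  rw [h hy, h (mem_of_mem_nhds hx)]

variable [MeasurableSpace X] {μ : Measure X}

lemma TendstoLpLoc.tendsto_setLIntegral {p : ℝ} {O K : Set X} {u : ℕ → X → ℝ} {v : X → ℝ}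
    (h : TendstoLpLoc μ p O u v) (hK : IsCompact K) (hKO : K ⊆ O) :
    Tendsto (fun n => ∫⁻ y in K, edist (u n y) (v y) ^ p ∂μ) atTop (𝓝 0) := by
  have mono : ∀ s t : Set X, s ⊆ t →
      Tendsto (fun n => ∫⁻ y in t, edist (u n y) (v y) ^ p ∂μ) atTop (𝓝 0) →
      Tendsto (fun n => ∫⁻ y in s, edist (u n y) (v y) ^ p ∂μ) atTop (𝓝 0) := fun s t hst ht =>
    tendsto_of_tendsto_of_tendsto_of_le_of_le tendsto_const_nhds ht (fun _ => zero_le)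
      fun n => lintegral_mono_set hst
  refine hK.induction_on
    (p := fun s => Tendsto (fun n => ∫⁻ y in s, edist (u n y) (v y) ^ p ∂μ) atTop (𝓝 0))
    (by simp) (fun s t hst ht => mono s t hst ht) (fun s t hs ht => ?_) fun x hx => ?_
  · refine tendsto_of_tendsto_of_tendsto_of_le_of_le tendsto_const_nhds
      (by simpa using hs.add ht) (fun _ => zero_le) fun n => lintegral_union_le _ _ _
  · obtain ⟨r, hr, hlim⟩ := h x (hKO hx)
    exact ⟨K ∩ closedBall x r, inter_mem self_mem_nhdsWithin
      (mem_nhdsWithin_of_mem_nhds (closedBall_mem_nhds x hr)), mono _ _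
      (inter_subset_inter_left _ hKO) hlim⟩

/-- Lipschitz functions that approximate `u` on a ball and whose energy is controlled by a measure
dominating the relaxed energies of `u`. -/
lemma LocalPoincare.exists_lipschitz_approx [OpensMeasurableSpace X] {p : ℝ} (hp : 1 ≤ p)
    {Ω : Set X} {C P : ℝ≥0} {l R : ℝ} {S : Set X} (hL : LocalPoincare μ p Ω C P l R S)
    {u : X → ℝ} {ν : Measure X} (hu : ∀ T : Set X, T ⊆ Ω → cheegerSet μ p Ω u T ≤ ν T)
    (hν : ν Ω ≠ ∞) {x : X} (hx : x ∈ S) {s : ℝ} (hs : 0 < s) (hsR : 2 * (l * s) ≤ R)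
    {ε : ℝ≥0∞} (hε : ε ≠ 0) :
    ∃ w : X → ℝ, (∃ K, LipschitzWith K w) ∧ ∫⁻ y in closedBall x s, edist (w y) (u y) ∂μ ≤ ε ∧
      ∫⁻ y in closedBall x (l * s), lip w y ^ p ∂μ ≤ ν (closedBall x (2 * (l * s))) + ε := by
  have hl := hL.one_le
  have hls : 0 < l * s := by positivity
  -- Doubling the radius makes B a neighbourhood of every point of B(x, l s), so functions that
  -- agree on B have the same `lip` there.
  set B := closedBall x (2 * (l * s)) with hB
  have hBc : IsCompact B := hL.compact x hx _ (by linarith) hsR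
  have hBΩ : B ⊆ Ω := hL.subset x hx _ hsR
  have hνB : ν B ≠ ∞ := ((measure_mono hBΩ).trans_lt hν.lt_top).ne
  have h1 : cheegerSet μ p Ω u B < ν B + ε :=
    (hu B hBΩ).trans_lt (ENNReal.lt_add_right hνB hε)
  unfold cheegerSet at h1
  simp only [iInf_lt_iff] at h1
  obtain ⟨O, hO, hOΩ, hBO, h1⟩ := h1
  unfold cheegerOpen at h1
  simp only [iInf_lt_iff] at h1
  obtain ⟨v, hv, hvu, h1⟩ := h1
  -- The lower limit gives small energy only for infinitely many n; closeness to u holds eventually,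
  -- so some n has both.
  have hfreq := frequently_lt_of_liminf_lt (by isBoundedDefault) h1
  have hμB : μ B ≠ ∞ := (hL.doubling.2 x hx _ (by linarith) hsR).2.1.ne
  have hev := (tendsto_setLIntegral_of_rpow hp hμB (hvu.tendsto_setLIntegral hBc hBO)).eventually
    (gt_mem_nhds (pos_iff_ne_zero.2 hε))
  obtain ⟨n, hn1, hn2⟩ := (hfreq.and_eventually hev).exists
  -- On the compact ball, locally Lipschitz means Lipschitz; a McShane extension then gives a
  -- Lipschitz function on X, as the Poincaré inequality requires.
  obtain ⟨K, hK⟩ := ((hv n).mono hBO).exists_lipschitzOnWith_of_compact hBc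
  obtain ⟨w, hw, hwv⟩ := hK.extend_real
  refine ⟨w, ⟨K, hw⟩, ?_, ?_⟩
  · have hsub : closedBall x s ⊆ B := closedBall_subset_closedBall (by nlinarith)
    calc ∫⁻ y in closedBall x s, edist (w y) (u y) ∂μ
        = ∫⁻ y in closedBall x s, edist (v n y) (u y) ∂μ :=
          setLIntegral_congr_fun measurableSet_closedBall fun y hy => by
            simp only [hwv (hsub hy)]
      _ ≤ ∫⁻ y in B, edist (v n y) (u y) ∂μ := lintegral_mono_set hsub
      _ ≤ ε := hn2.le
  · calc ∫⁻ y in closedBall x (l * s), lip w y ^ p ∂μ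
        = ∫⁻ y in closedBall x (l * s), lip (v n) y ^ p ∂μ :=
          setLIntegral_congr_fun measurableSet_closedBall fun y hy => by
            have : B ∈ 𝓝 y := mem_of_superset
              (isOpen_ball.mem_nhds (show y ∈ ball x (2 * (l * s)) from
                (mem_closedBall.1 hy).trans_lt (by linarith))) ball_subset_closedBall
            simp only [lip_congr_of_eqOn hwv this]
      _ ≤ ∫⁻ y in O, lip (v n) y ^ p ∂μ :=
          lintegral_mono_set ((closedBall_subset_closedBall (by linarith)).trans hBO)
      _ ≤ ν B + ε := hn1.le

/-- The mean oscillation of `u` on a ball. -/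
noncomputable def ballOsc (μ : Measure X) (u : X → ℝ) (s : ℝ) (x : X) : ℝ≥0∞ :=
  ballAvg μ (fun w => ballAvg μ (fun z => edist (u w) (u z)) s x) s x

lemma ballAvg_const_le [OpensMeasurableSpace X] (c : ℝ≥0∞) (s : ℝ) (x : X) :
    ballAvg μ (fun _ => c) s x ≤ c := ballAvg_le_of_le fun _ _ => le_rfl

lemma ballOsc_le [OpensMeasurableSpace X] {u : X → ℝ} {g : X → ℝ≥0∞} (hg : Measurable g)
    {s : ℝ} {x : X} (h : ∀ w z, edist (u w) (u z) ≤ g w + g z) :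
    ballOsc μ u s x ≤ 2 * ballAvg μ g s x := by
  unfold ballOsc
  calc ballAvg μ (fun w => ballAvg μ (fun z => edist (u w) (u z)) s x) s x
      ≤ ballAvg μ (fun w => g w + ballAvg μ g s x) s x := by
        refine ballAvg_mono fun w _ => ?_
        refine (ballAvg_mono fun z _ => h w z).trans ?_
        rw [ballAvg_add measurable_const]
        gcongr
        exact ballAvg_const_le _ _ _
    _ ≤ ballAvg μ g s x + ballAvg μ g s x := by
        rw [ballAvg_add hg]
        gcongr
        exact ballAvg_const_le _ _ _
    _ = 2 * ballAvg μ g s x := (two_mul _).symm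

/-- The Poincaré inequality for a function whose relaxed energies are dominated by `g μ`. -/
lemma LocalPoincare.ballOsc_le [OpensMeasurableSpace X] {p : ℝ} (hp : 1 ≤ p)
    {Ω : Set X} {C P : ℝ≥0} {l R : ℝ} {S : Set X} (hL : LocalPoincare μ p Ω C P l R S)
    {u : X → ℝ} (hum : Measurable u) {ν : Measure X}
    (hu : ∀ T : Set X, T ⊆ Ω → cheegerSet μ p Ω u T ≤ ν T)
    (hν : ν Ω ≠ ∞) {g : X → ℝ≥0∞} (hg : ν = μ.withDensity g)
    {x : X} (hx : x ∈ S) {s : ℝ} (hs : 0 < s) (hsR : 2 * (l * s) ≤ R) :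
    ballOsc μ u s x ≤
      2 * (P * ENNReal.ofReal s * (C * ballAvg μ g (2 * (l * s)) x) ^ (1 / p)) := by
  have hl := hL.one_le
  have hls : 0 < l * s := by positivity
  have hsl : s ≤ l * s := by nlinarith
  have hp0 : 0 < p := by linarith
  obtain ⟨hm0, hmt, -⟩ := hL.doubling.2 x hx s hs (by linarith)
  obtain ⟨hn0, hnt, hn2⟩ := hL.doubling.2 x hx (l * s) hls (by linarith)
  have hbound : ∀ ε : ℝ≥0∞, ε ≠ 0 → ballOsc μ u s x ≤
      2 * ((μ (closedBall x s))⁻¹ * ε + P * ENNReal.ofReal s *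
        ((ν (closedBall x (2 * (l * s))) + ε) / μ (closedBall x (l * s))) ^ (1 / p)) := by
    intro ε hε
    obtain ⟨w, ⟨K, hK⟩, h1, h2⟩ := hL.exists_lipschitz_approx hp hu hν hx hs hsR hε
    set c := ⨍ z in closedBall x s, w z ∂μ with hc
    have hwm : Measurable w := hK.continuous.measurable
    have hP := hL.poincare w ⟨K, hK⟩ x hx s hs (by linarith)
    rw [setLAverage_eq, setLAverage_eq] at hP
    -- The oscillation of u is bounded through w and its mean c; the two copies of this bound
    -- produce the factor 2.
    refine (MetricBBM.ballOsc_le (g := fun y => edist (w y) (u y) + edist (w y) c)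
      ((hwm.edist hum).add (hwm.edist measurable_const)) fun y z => ?_).trans ?_
    · calc edist (u y) (u z) ≤ edist (u y) (w y) + edist (w y) (u z) := edist_triangle _ _ _
        _ ≤ edist (u y) (w y) + (edist (w y) c + edist c (u z)) := by
            gcongr; exact edist_triangle _ _ _
        _ ≤ edist (u y) (w y) + (edist (w y) c + (edist c (w z) + edist (w z) (u z))) := by
            gcongr; exact edist_triangle _ _ _
        _ = _ := by rw [edist_comm (u y), edist_comm c]; ring
    · rw [ballAvg_add (hwm.edist hum)]
      gcongr
      · unfold ballAvg; gcongr
      · unfold ballAvg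
        rw [mul_comm, ← div_eq_mul_inv]
        refine hP.trans ?_
        gcongr
  -- The approximation error ε = 1/n is sent to 0. One doubling then replaces the normalisation by
  -- B(x, l s) with that by B(x, 2 l s).
  have hlim : Tendsto (fun n : ℕ => 2 * ((μ (closedBall x s))⁻¹ * (n : ℝ≥0∞)⁻¹ +
      P * ENNReal.ofReal s * ((ν (closedBall x (2 * (l * s))) + (n : ℝ≥0∞)⁻¹) /
        μ (closedBall x (l * s))) ^ (1 / p))) atTop
      (𝓝 (2 * ((μ (closedBall x s))⁻¹ * 0 +
      P * ENNReal.ofReal s * ((ν (closedBall x (2 * (l * s))) + 0) /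
        μ (closedBall x (l * s))) ^ (1 / p)))) := by
    have h0 := ENNReal.tendsto_inv_nat_nhds_zero
    refine ENNReal.Tendsto.const_mul (Tendsto.add
      (ENNReal.Tendsto.const_mul h0 (Or.inr (by simpa using hm0.ne')))
      (ENNReal.Tendsto.const_mul ?_ (Or.inr (by finiteness)))) (Or.inr (by simp))
    exact (ENNReal.continuous_rpow_const.tendsto _).comp
      (ENNReal.Tendsto.div_const (tendsto_const_nhds.add h0) (Or.inr hn0.ne'))
  refine (ge_of_tendsto' hlim fun n => hbound _ (by simp)).trans ?_
  rw [mul_zero, zero_add, add_zero]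
  gcongr
  rw [hg, withDensity_apply _ measurableSet_closedBall]
  unfold ballAvg
  rw [div_eq_mul_inv, mul_comm]
  exact (mul_le_mul_left (inv_le_mul_inv hL.doubling.1 hn2) _).trans_eq (mul_assoc _ _ _)

end Relaxation

/-! ### Telescoping over dyadic radii and the two-point estimate. -/

lemma tsum_two_thirds : ∑' k : ℕ, (2 / 3 : ℝ≥0∞) ^ k = 3 := by
  rw [ENNReal.tsum_geometric]
  have : (1 - 2 / 3 : ℝ≥0∞) = 3⁻¹ := by
    refine (ENNReal.eq_sub_of_add_eq (by finiteness) ?_).symm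
    rw [← one_div, ENNReal.div_add_div_same]
    norm_num
    exact ENNReal.div_self (by norm_num) (by norm_num)
  rw [this, inv_inv]

/-- The origin of the weight 3/4 in `multiAvg`: in 1/2 = (2/3)(3/4) the second factor moves inside
the p-th root, since (3/4)^k ≤ ((3/4)^k)^(1/p). Each root is at most the root of the whole sum, and
the first factor sums to 3. -/
lemma tsum_half_pow_mul_le {p : ℝ} (hp : 1 ≤ p) (c : ℕ → ℝ≥0∞) :
    ∑' k : ℕ, (2⁻¹ : ℝ≥0∞) ^ k * c k ^ (1 / p) ≤
      3 * (∑' k : ℕ, (3 / 4 : ℝ≥0∞) ^ k * c k) ^ (1 / p) := by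
  have hp0 : 0 < p := by linarith
  have h34 : (3 / 4 : ℝ≥0∞) ≤ 1 := by
    rw [ENNReal.div_le_iff (by norm_num) (by norm_num)]; norm_num
  have h12 : (2⁻¹ : ℝ≥0∞) = 2 / 3 * (3 / 4) := by
    rw [div_eq_mul_inv, div_eq_mul_inv, mul_assoc, ← mul_assoc 3⁻¹,
      ENNReal.inv_mul_cancel (by norm_num) (by norm_num), one_mul,
      show (4 : ℝ≥0∞) = 2 * 2 by norm_num, ENNReal.mul_inv (by norm_num) (by norm_num), ← mul_assoc,
      ENNReal.mul_inv_cancel (by norm_num) (by norm_num), one_mul]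
  refine le_trans ?_ (le_of_eq (congrArg (· * _) tsum_two_thirds))
  rw [← ENNReal.tsum_mul_right]
  refine ENNReal.tsum_le_tsum fun k => ?_
  rw [h12, mul_pow, mul_assoc]
  gcongr
  calc (3 / 4 : ℝ≥0∞) ^ k * c k ^ (1 / p)
      ≤ ((3 / 4 : ℝ≥0∞) ^ k) ^ (1 / p) * c k ^ (1 / p) := by
        gcongr
        conv_lhs => rw [← ENNReal.rpow_one ((3 / 4 : ℝ≥0∞) ^ k)]
        exact ENNReal.rpow_le_rpow_of_exponent_ge (pow_le_one' h34 k)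
          (by rw [div_le_one hp0]; exact hp)
    _ = ((3 / 4 : ℝ≥0∞) ^ k * c k) ^ (1 / p) :=
        (ENNReal.mul_rpow_of_nonneg _ _ (by positivity)).symm
    _ ≤ _ := by
        gcongr
        exact ENNReal.le_tsum k

section Telescoping

variable {X : Type*} [MetricSpace X] [MeasurableSpace X] {μ : Measure X}

lemma ballAvg_le_of_subset {v : X → ℝ≥0∞} {s t : ℝ} {x y : X} {c : ℝ≥0∞}
    (hst : closedBall x s ⊆ closedBall y t)
    (hc : (μ (closedBall x s))⁻¹ ≤ c * (μ (closedBall y t))⁻¹) :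
    ballAvg μ v s x ≤ c * ballAvg μ v t y := by
  unfold ballAvg
  rw [← mul_assoc]
  gcongr

variable [OpensMeasurableSpace X]

/-- The triangle inequality through a point w is averaged over w in the smaller ball; enlarging that
ball in the oscillation term costs C. -/
lemma ballAvg_edist_le_add {u : X → ℝ} (hu : Measurable u) (x : X) {s t : ℝ} (hts : t ≤ s)
    {C : ℝ≥0} (h0 : μ (closedBall x t) ≠ 0) (h1 : μ (closedBall x t) ≠ ∞)
    (hC : (μ (closedBall x t))⁻¹ ≤ C * (μ (closedBall x s))⁻¹) :
    ballAvg μ (fun z => edist (u x) (u z)) s x ≤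
      ballAvg μ (fun z => edist (u x) (u z)) t x + C * ballOsc μ u s x := by
  have hm : Measurable fun z => edist (u x) (u z) := measurable_const.edist hu
  set A := ballAvg μ (fun z => edist (u x) (u z)) s x with hA
  have hpt : ∀ w, A ≤ edist (u x) (u w) + ballAvg μ (fun z => edist (u w) (u z)) s x := by
    intro w
    calc A ≤ ballAvg μ (fun z => edist (u x) (u w) + edist (u w) (u z)) s x :=
          ballAvg_mono fun z _ => edist_triangle _ _ _
      _ ≤ _ := by
          rw [ballAvg_add measurable_const]
          gcongr
          exact ballAvg_const_le _ _ _
  have hA' : A = ballAvg μ (fun _ => A) t x := by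
    unfold ballAvg
    rw [setLIntegral_const, mul_left_comm, ENNReal.inv_mul_cancel h0 h1, mul_one]
  calc A = ballAvg μ (fun _ => A) t x := hA'
    _ ≤ ballAvg μ (fun w => edist (u x) (u w) + ballAvg μ (fun z => edist (u w) (u z)) s x) t x :=
        ballAvg_mono fun w _ => hpt w
    _ = ballAvg μ (fun w => edist (u x) (u w)) t x +
        ballAvg μ (fun w => ballAvg μ (fun z => edist (u w) (u z)) s x) t x := ballAvg_add hm _ _
    _ ≤ _ := by
        gcongr
        exact ballAvg_le_of_subset (closedBall_subset_closedBall hts) hC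

/-- Telescoping down the radii r / 2 ^ k; the last term vanishes in the limit because x is a
Lebesgue point of u. -/
lemma ballAvg_edist_le_tsum {u : X → ℝ} (hu : Measurable u) {C : ℝ≥0} {R : ℝ} {S : Set X}
    (hD : DoublingOn μ C R S) {x : X} (hx : x ∈ S) {r : ℝ} (hr : 0 < r) (hrR : r ≤ R)
    (hlim : Tendsto (fun s => ballAvg μ (fun z => edist (u x) (u z)) s x) (𝓝[>] 0) (𝓝 0)) :
    ballAvg μ (fun z => edist (u x) (u z)) r x ≤ C * ∑' k : ℕ, ballOsc μ u (r / 2 ^ k) x := by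
  set a : ℕ → ℝ≥0∞ := fun k => ballAvg μ (fun z => edist (u x) (u z)) (r / 2 ^ k) x with ha
  have hpos : ∀ k : ℕ, 0 < r / 2 ^ k := fun k => by positivity
  have hle : ∀ k : ℕ, r / 2 ^ k ≤ R := fun k =>
    (div_le_self hr.le (one_le_pow₀ one_le_two)).trans hrR
  have hstep : ∀ k, a k ≤ a (k + 1) + C * ballOsc μ u (r / 2 ^ k) x := by
    intro k
    obtain ⟨h0, h1, h2⟩ := hD.2 x hx _ (hpos (k + 1)) (hle (k + 1))
    have heq : 2 * (r / 2 ^ (k + 1)) = r / 2 ^ k := by rw [pow_succ]; field_simp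
    rw [heq] at h2
    exact ballAvg_edist_le_add hu x (by rw [← heq]; linarith [hpos (k + 1)]) h0.ne' h1.ne
      (inv_le_mul_inv hD.1 h2)
  have hsum : ∀ n, a 0 ≤ a n + ∑ k ∈ Finset.range n, C * ballOsc μ u (r / 2 ^ k) x := by
    intro n
    induction n with
    | zero => simp
    | succ n ih =>
      rw [Finset.sum_range_succ, add_comm (∑ k ∈ _, _), ← add_assoc]
      exact ih.trans (by gcongr; exact hstep n)
  have hr0 : Tendsto (fun k : ℕ => r / 2 ^ k) atTop (𝓝[>] 0) := by
    refine tendsto_nhdsWithin_iff.2 ⟨?_, Eventually.of_forall hpos⟩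
    exact tendsto_const_nhds.div_atTop (tendsto_pow_atTop_atTop_of_one_lt one_lt_two)
  have hlim' : Tendsto (fun n => a n + C * ∑' k : ℕ, ballOsc μ u (r / 2 ^ k) x) atTop
      (𝓝 (0 + C * ∑' k : ℕ, ballOsc μ u (r / 2 ^ k) x)) :=
    (hlim.comp hr0).add tendsto_const_nhds
  rw [zero_add] at hlim'
  have h0 : a 0 = ballAvg μ (fun z => edist (u x) (u z)) r x := by simp [ha]
  rw [← h0]
  refine ge_of_tendsto' hlim' fun n => (hsum n).trans ?_
  gcongr
  rw [← ENNReal.tsum_mul_left]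
  exact ENNReal.sum_le_tsum _

/-- The Poincaré inequality bounds the oscillation at radius r / 2 ^ k by 2^(-k) r times a p-th root
of an average of g, so the telescoped series collapses to one p-th root of `multiAvg`. The constant
is C · 2 P C · 3. -/
lemma LocalPoincare.ballAvg_edist_le {p : ℝ} (hp : 1 ≤ p)
    {Ω : Set X} {C P : ℝ≥0} {l R : ℝ} {S : Set X} (hL : LocalPoincare μ p Ω C P l R S)
    {u : X → ℝ} (hum : Measurable u) {ν : Measure X}
    (hu : ∀ T : Set X, T ⊆ Ω → cheegerSet μ p Ω u T ≤ ν T)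
    (hν : ν Ω ≠ ∞) {g : X → ℝ≥0∞} (hg : ν = μ.withDensity g)
    {x : X} (hx : x ∈ S) {r : ℝ} (hr : 0 < r) (hrR : 2 * (l * r) ≤ R)
    (hlim : Tendsto (fun s => ballAvg μ (fun z => edist (u x) (u z)) s x) (𝓝[>] 0) (𝓝 0)) :
    ballAvg μ (fun z => edist (u x) (u z)) r x ≤
      6 * P * C ^ 2 * ENNReal.ofReal r * multiAvg μ g (2 * (l * r)) x ^ (1 / p) := by
  have hl := hL.one_le
  have hp0 : 0 < p := by linarith
  have hC1 : (1 : ℝ≥0∞) ≤ C := by exact_mod_cast hL.doubling.1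
  have hCp : (C : ℝ≥0∞) ^ (1 / p) ≤ C := by
    conv_rhs => rw [← ENNReal.rpow_one (C : ℝ≥0∞)]
    exact ENNReal.rpow_le_rpow_of_exponent_le hC1 (by rw [div_le_one hp0]; exact hp)
  have hlr : 0 < l * r := by positivity
  refine (ballAvg_edist_le_tsum hum hL.doubling hx hr (by nlinarith) hlim).trans ?_
  have hosc : ∀ k : ℕ, ballOsc μ u (r / 2 ^ k) x ≤ 2 * P * C * ENNReal.ofReal r *
      ((2⁻¹ : ℝ≥0∞) ^ k * ballAvg μ g (2 * (l * r) / 2 ^ k) x ^ (1 / p)) := by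
    intro k
    have h2k : (1 : ℝ) ≤ 2 ^ k := one_le_pow₀ one_le_two
    have heq : 2 * (l * (r / 2 ^ k)) = 2 * (l * r) / 2 ^ k := by ring
    have h := hL.ballOsc_le hp hum hu hν hg hx (s := r / 2 ^ k) (by positivity)
      (by rw [heq]; exact (div_le_self (by positivity) h2k).trans hrR)
    rw [heq] at h
    refine h.trans ?_
    rw [ENNReal.mul_rpow_of_nonneg _ _ (by positivity)]
    have hofr : ENNReal.ofReal (r / 2 ^ k) = ENNReal.ofReal r * (2⁻¹ : ℝ≥0∞) ^ k := by
      rw [ENNReal.ofReal_div_of_pos (by positivity), div_eq_mul_inv,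
        ENNReal.ofReal_pow zero_le_two, ENNReal.ofReal_ofNat, ENNReal.inv_pow]
    rw [hofr]
    calc 2 * (P * (ENNReal.ofReal r * 2⁻¹ ^ k) *
          ((C : ℝ≥0∞) ^ (1 / p) * ballAvg μ g (2 * (l * r) / 2 ^ k) x ^ (1 / p)))
        ≤ 2 * (P * (ENNReal.ofReal r * 2⁻¹ ^ k) *
          (C * ballAvg μ g (2 * (l * r) / 2 ^ k) x ^ (1 / p))) := by gcongr
      _ = _ := by ring
  calc C * ∑' k : ℕ, ballOsc μ u (r / 2 ^ k) x
      ≤ C * ∑' k : ℕ, 2 * P * C * ENNReal.ofReal r *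
      ((2⁻¹ : ℝ≥0∞) ^ k * ballAvg μ g (2 * (l * r) / 2 ^ k) x ^ (1 / p)) := by
        gcongr with k; exact hosc k
    _ = C * (2 * P * C * ENNReal.ofReal r * ∑' k : ℕ,
      ((2⁻¹ : ℝ≥0∞) ^ k * ballAvg μ g (2 * (l * r) / 2 ^ k) x ^ (1 / p))) := by
        rw [ENNReal.tsum_mul_left]
    _ ≤ C * (2 * P * C * ENNReal.ofReal r *
        (3 * multiAvg μ g (2 * (l * r)) x ^ (1 / p))) := by
        gcongr
        exact tsum_half_pow_mul_le hp _
    _ = _ := by ring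

/-- The pointwise estimate at two Lebesgue points. -/
lemma LocalPoincare.edist_rpow_le {p : ℝ} (hp : 1 ≤ p)
    {Ω : Set X} {C P : ℝ≥0} {l R : ℝ} {S : Set X} (hL : LocalPoincare μ p Ω C P l R S)
    {u : X → ℝ} (hum : Measurable u) {ν : Measure X}
    (hu : ∀ T : Set X, T ⊆ Ω → cheegerSet μ p Ω u T ≤ ν T)
    (hν : ν Ω ≠ ∞) {g : X → ℝ≥0∞} (hg : ν = μ.withDensity g)
    {x y : X} (hx : x ∈ S) (hy : y ∈ S) {r : ℝ} (hr : 0 < r) (hrR : 4 * (l * r) ≤ R)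
    (hxy : dist x y ≤ r)
    (hlimx : Tendsto (fun s => ballAvg μ (fun z => edist (u x) (u z)) s x) (𝓝[>] 0) (𝓝 0))
    (hlimy : Tendsto (fun s => ballAvg μ (fun z => edist (u y) (u z)) s y) (𝓝[>] 0) (𝓝 0)) :
    edist (u x) (u y) ≤ (24 * P * C ^ 4 * ENNReal.ofReal r) *
      (multiAvg μ g (4 * (l * r)) x + multiAvg μ g (4 * (l * r)) y) ^ (1 / p) := by
  have hl := hL.one_le
  have hp0 : 0 < p := by linarith
  have hlr : r ≤ l * r := by nlinarith
  obtain ⟨h0, h1, -⟩ := hL.doubling.2 x hx r hr (by linarith)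
  have hC2 : 1 ≤ C ^ 2 := one_le_pow₀ hL.doubling.1
  have h4 : μ (closedBall x (4 * r)) ≤ (C ^ 2 : ℝ≥0) * μ (closedBall x r) := by
    have := hL.doubling.measure_pow_le hx hr 2 (by linarith)
    norm_num at this
    simpa using this
  have hsub1 : closedBall x r ⊆ closedBall x (2 * r) := closedBall_subset_closedBall (by linarith)
  have hsub2 : closedBall x r ⊆ closedBall y (2 * r) := closedBall_subset_closedBall' (by linarith)
  have hinv1 : (μ (closedBall x r))⁻¹ ≤ (C ^ 2 : ℝ≥0) * (μ (closedBall x (2 * r)))⁻¹ :=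
    inv_le_mul_inv hC2 ((measure_mono (closedBall_subset_closedBall (by linarith))).trans h4)
  have hinv2 : (μ (closedBall x r))⁻¹ ≤ (C ^ 2 : ℝ≥0) * (μ (closedBall y (2 * r)))⁻¹ :=
    inv_le_mul_inv hC2 ((measure_mono (closedBall_subset_closedBall'
      (by rw [dist_comm]; linarith))).trans h4)
  -- The balls of radius 2 r about x and y both contain B(x,r), with measures comparable up to C ^
  -- 2. Each side contributes C ^ 2 · 6 P C ^ 2 · 2 r, which explains the constant 24 and the scale
  -- 4 l r.
  have hX := hL.ballAvg_edist_le hp hum hu hν hg hx (r := 2 * r) (by linarith)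
    (by nlinarith) hlimx
  have hY := hL.ballAvg_edist_le hp hum hu hν hg hy (r := 2 * r) (by linarith)
    (by nlinarith) hlimy
  have heq : 2 * (l * (2 * r)) = 4 * (l * r) := by ring
  have hof : ENNReal.ofReal (2 * r) = 2 * ENNReal.ofReal r := by
    rw [ENNReal.ofReal_mul zero_le_two, ENNReal.ofReal_ofNat]
  rw [heq, hof] at hX hY
  set A := multiAvg μ g (4 * (l * r)) x
  set B := multiAvg μ g (4 * (l * r)) y
  calc edist (u x) (u y) = ballAvg μ (fun _ => edist (u x) (u y)) r x := by
        unfold ballAvg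
        rw [setLIntegral_const, mul_left_comm, ENNReal.inv_mul_cancel h0.ne' h1.ne, mul_one]
    _ ≤ ballAvg μ (fun z => edist (u x) (u z) + edist (u y) (u z)) r x :=
        ballAvg_mono fun z _ => by
          rw [edist_comm (u y)]; exact edist_triangle _ _ _
    _ = ballAvg μ (fun z => edist (u x) (u z)) r x + ballAvg μ (fun z => edist (u y) (u z)) r x :=
        ballAvg_add (measurable_const.edist hum) _ _
    _ ≤ (C ^ 2 : ℝ≥0) * ballAvg μ (fun z => edist (u x) (u z)) (2 * r) x +
        (C ^ 2 : ℝ≥0) * ballAvg μ (fun z => edist (u y) (u z)) (2 * r) y :=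
        add_le_add (ballAvg_le_of_subset hsub1 hinv1) (ballAvg_le_of_subset hsub2 hinv2)
    _ ≤ (C ^ 2 : ℝ≥0) * (6 * P * C ^ 2 * (2 * ENNReal.ofReal r) * (A + B) ^ (1 / p)) +
        (C ^ 2 : ℝ≥0) * (6 * P * C ^ 2 * (2 * ENNReal.ofReal r) * (A + B) ^ (1 / p)) := by
        gcongr
        · refine hX.trans ?_
          gcongr
          exact le_self_add
        · refine hY.trans ?_
          gcongr
          exact le_add_self
    _ = _ := by push_cast; ring

end Telescoping

/-! ### Lebesgue points. -/

section Lebesgue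

variable {X : Type*} [MetricSpace X] [MeasurableSpace X] [BorelSpace X]
  [SecondCountableTopology X] {μ : Measure X} [IsLocallyFiniteMeasure μ]

/-- Lebesgue differentiation for the Vitali family of balls. Singletons are well contained, so
internal doubling gives at every point the tripling bound with the common constant C ^ 2. -/
lemma ae_tendsto_ballAvg_edist (hX : LocallyComplete X) (hD : InternallyDoubling μ)
    {u : X → ℝ} (hu : LocallyIntegrable u μ) :
    ∀ᵐ x ∂μ, Tendsto (fun s => ballAvg μ (fun z => edist (u x) (u z)) s x) (𝓝[>] 0) (𝓝 0) := by
  obtain ⟨C, hD⟩ := hD.doublingOn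
  have hdoub : ∀ x, ∀ᶠ r : ℝ in 𝓝[>] 0,
      μ (closedBall x (3 * r)) ≤ (C ^ 2 : ℝ≥0) * μ (closedBall x r) := by
    intro x
    obtain ⟨R, hR, hDx⟩ := hD {x} (hX.wellContained_singleton x)
    have hx : x ∈ cthickening R {x} := self_subset_cthickening _ rfl
    have : Ioc (0 : ℝ) (R / 2) ∈ 𝓝[>] (0 : ℝ) := Ioc_mem_nhdsGT (by positivity)
    filter_upwards [this] with r hr
    have h4 := hDx.measure_pow_le hx hr.1 2 (by linarith [hr.2])
    refine (measure_mono (closedBall_subset_closedBall ?_)).trans (h4.trans_eq (by push_cast; rfl))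
    linarith [hr.1]
  set v := Vitali.vitaliFamily μ (C ^ 2) fun x => (hdoub x).frequently with hv
  filter_upwards [v.ae_tendsto_lintegral_enorm_sub_div hu] with x hx
  have hfil : Tendsto (fun r : ℝ => closedBall x r) (𝓝[>] 0) (v.filterAt x) := by
    rw [VitaliFamily.tendsto_filterAt_iff]
    constructor
    · filter_upwards [hdoub x, self_mem_nhdsWithin] with r hr hr0
      exact ⟨isClosed_closedBall, (nonempty_ball.2 hr0).mono ball_subset_interior_closedBall,
        r, Subset.rfl, hr⟩
    · intro ε hε
      filter_upwards [Ioc_mem_nhdsGT hε] with r hr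
      exact closedBall_subset_closedBall hr.2
  refine (hx.comp hfil).congr fun r => ?_
  simp only [Function.comp, ballAvg]
  rw [mul_comm, ← div_eq_mul_inv]
  simp_rw [edist_comm (u x), edist_eq_enorm_sub]

end Lebesgue

/-! ### From real functions to maps into a metric space. -/

section Maps

variable {X : Type*} {Y : Type*} [MetricSpace Y]

/-- The tests are truncated distances min(d(·, d_k), n) to a dense sequence. Letting d_k approach f
x with n ≥ d(f x, f y) recovers d(f x, f y). Countability allows a single null set for all tests. -/
lemma exists_bounded_lipschitz_tests [TopologicalSpace X] [MeasurableSpace X] [Nonempty X]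
    {f : X → Y} (hf : StronglyMeasurable f) :
    ∃ φ : ℕ × ℕ → Y → ℝ, (∀ i, LipschitzWith 1 (φ i)) ∧ (∀ i, ∃ M : ℝ, ∀ y, |φ i y| ≤ M) ∧
      ∀ (x y : X) (B : ℝ≥0∞), (∀ i, edist (φ i (f x)) (φ i (f y)) ≤ B) →
        edist (f x) (f y) ≤ B := by
  obtain ⟨c, hc, hfc⟩ := hf.isSeparable_range
  have hne : c.Nonempty := by
    have x : X := Classical.arbitrary X
    exact closure_nonempty_iff.1 ⟨f x, hfc ⟨x, rfl⟩⟩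
  obtain ⟨d, rfl⟩ := hc.exists_eq_range hne
  refine ⟨fun i y => min (dist y (d i.1)) i.2, fun i => ?_, fun i => ⟨i.2, fun y => ?_⟩, ?_⟩
  · exact (LipschitzWith.dist_left (d i.1)).min_const _
  · rw [abs_of_nonneg (by positivity)]
    exact min_le_right _ _
  · intro x y B hB
    obtain ⟨n, hn⟩ := exists_nat_ge (dist (f x) (f y))
    obtain ⟨s, hs, hlim⟩ := mem_closure_iff_seq_limit.1 (hfc ⟨x, rfl⟩)
    choose k hk using hs
    have h1 : Tendsto (fun j => edist (min (dist (f x) (s j)) n) (min (dist (f y) (s j)) n)) atTop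
        (𝓝 (edist (min (dist (f x) (f x)) n) (min (dist (f y) (f x)) n))) :=
      ((tendsto_const_nhds.dist hlim).min tendsto_const_nhds).edist
        ((tendsto_const_nhds.dist hlim).min tendsto_const_nhds)
    have h2 : edist (min (dist (f x) (f x)) n) (min (dist (f y) (f x)) n) = edist (f x) (f y) := by
      rw [dist_self, min_eq_left (by positivity), dist_comm, min_eq_left hn, edist_dist, edist_dist,
        Real.dist_eq, zero_sub, abs_neg, abs_of_nonneg dist_nonneg]
    rw [h2] at h1
    refine le_of_tendsto' h1 fun j => ?_
    have := hB (k j, n)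
    simpa only [hk] using this

variable [MetricSpace X] [MeasurableSpace X] [BorelSpace X]
  [SecondCountableTopology X] {μ : Measure X} [IsLocallyFiniteMeasure μ]

/-- Outside a null set, the increments of `f` are controlled by mean values of the density of its
energy. -/
lemma exists_null_edist_rpow_le [Nonempty X] (hX : LocallyComplete X) (hD : InternallyDoubling μ)
    {p : ℝ} (hp : 1 ≤ p) {Ω : Set X} {f : X → Y} (hf : StronglyMeasurable f) {ν : Measure X}
    (hfν : ∀ φ : Y → ℝ, LipschitzWith 1 φ → (∃ C : ℝ, ∀ y, |φ y| ≤ C) →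
      ∀ S : Set X, S ⊆ Ω → cheegerSet μ p Ω (φ ∘ f) S ≤ ν S)
    (hν : ν Ω ≠ ∞) {g : X → ℝ≥0∞} (hg : ν = μ.withDensity g) :
    ∃ N : Set X, μ N = 0 ∧ ∀ {C P : ℝ≥0} {l R : ℝ} {S : Set X}, LocalPoincare μ p Ω C P l R S →
      ∀ x ∈ S \ N, ∀ y ∈ S \ N, ∀ r : ℝ, 0 < r → 4 * (l * r) ≤ R → dist x y ≤ r →
        edist (f x) (f y) ^ p ≤ (24 * P * C ^ 4 * ENNReal.ofReal r) ^ p *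
          (multiAvg μ g (4 * (l * r)) x + multiAvg μ g (4 * (l * r)) y) := by
  obtain ⟨φ, hφ1, hφ2, hφ3⟩ := exists_bounded_lipschitz_tests hf
  have hp0 : 0 < p := by linarith
  have hm : ∀ i, Measurable (φ i ∘ f) := fun i =>
    ((hφ1 i).continuous.comp_stronglyMeasurable hf).measurable
  -- The exceptional set consists of the non-Lebesgue points of the tests, so it depends on neither
  -- the set S nor the local constants.
  have hae : ∀ᵐ x ∂μ, ∀ i, Tendsto
      (fun s => ballAvg μ (fun z => edist ((φ i ∘ f) x) ((φ i ∘ f) z)) s x) (𝓝[>] 0) (𝓝 0) := by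
    rw [ae_all_iff]
    intro i
    refine ae_tendsto_ballAvg_edist hX hD ?_
    obtain ⟨M, hM⟩ := hφ2 i
    refine (locallyIntegrable_const M).mono (hm i).aestronglyMeasurable
      (Eventually.of_forall fun x => ?_)
    exact (hM (f x)).trans (le_abs_self M)
  refine ⟨_, hae, fun {C P l R S} hL x hx y hy r hr hrR hxy => ?_⟩
  have hx' := not_not.1 hx.2
  have hy' := not_not.1 hy.2
  have h : edist (f x) (f y) ≤ (24 * P * C ^ 4 * ENNReal.ofReal r) *
      (multiAvg μ g (4 * (l * r)) x + multiAvg μ g (4 * (l * r)) y) ^ (1 / p) :=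
    hφ3 x y _ fun i => hL.edist_rpow_le hp (hm i) (hfν _ (hφ1 i) (hφ2 i)) hν hg hx.1 hy.1 hr hrR
      hxy (hx' i) (hy' i)
  calc edist (f x) (f y) ^ p ≤ ((24 * P * C ^ 4 * ENNReal.ofReal r) *
      (multiAvg μ g (4 * (l * r)) x + multiAvg μ g (4 * (l * r)) y) ^ (1 / p)) ^ p := by gcongr
    _ = _ := by
        rw [ENNReal.mul_rpow_of_nonneg _ _ hp0.le, ← ENNReal.rpow_mul, one_div_mul_cancel hp0.ne',
          ENNReal.rpow_one]

end Maps

/-! ### Absolute differences and a generalised dominated convergence theorem. -/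

section AbsDiff

lemma absDiff_comm (a b : ℝ≥0∞) : absDiff a b = absDiff b a := add_comm _ _

lemma absDiff_triangle (a b c : ℝ≥0∞) : absDiff a c ≤ absDiff a b + absDiff b c := by
  unfold absDiff
  calc a - c + (c - a) ≤ (a - b + (b - c)) + (c - b + (b - a)) :=
        add_le_add tsub_le_tsub_add_tsub tsub_le_tsub_add_tsub
    _ = _ := by ring

lemma le_add_absDiff (a b : ℝ≥0∞) : a ≤ b + absDiff a b :=
  le_add_tsub.trans (by unfold absDiff; gcongr; exact le_self_add)

lemma absDiff_le_add {a b c d : ℝ≥0∞} (h1 : a ≤ b + c) (h2 : b ≤ a + d) : absDiff a b ≤ c + d :=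
  add_le_add (tsub_le_iff_left.2 h1) (tsub_le_iff_left.2 h2)

lemma absDiff_add_le (a b c : ℝ≥0∞) : absDiff (a + b) c ≤ absDiff a c + b := by
  unfold absDiff
  calc a + b - c + (c - (a + b)) ≤ (a - c + b) + (c - a) := by
        gcongr
        · rw [tsub_le_iff_left, ← add_assoc]
          gcongr
          exact le_add_tsub
        · exact le_self_add
    _ = _ := by ring

lemma absDiff_le_max (a b : ℝ≥0∞) : absDiff a b ≤ max a b := by
  rcases le_total a b with h | h
  · simp [absDiff, tsub_eq_zero_of_le h]
  · simp [absDiff, tsub_eq_zero_of_le h]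

lemma absDiff_le_add_self (a b : ℝ≥0∞) : absDiff a b ≤ a + b :=
  add_le_add tsub_le_self tsub_le_self

lemma absDiff_min_right (a h : ℝ≥0∞) : absDiff a (min a h) = a - h := by
  unfold absDiff
  rw [tsub_min, tsub_eq_zero_of_le (min_le_left a h), add_zero]

lemma tendsto_absDiff {ι : Type*} {l : Filter ι} {F : ι → ℝ≥0∞} {a : ℝ≥0∞} (ha : a ≠ ∞)
    (h : Tendsto F l (𝓝 a)) : Tendsto (fun i => absDiff (F i) a) l (𝓝 0) := by
  have h1 := ENNReal.Tendsto.sub h tendsto_const_nhds (Or.inr ha)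
  have h2 := ENNReal.Tendsto.sub tendsto_const_nhds h (Or.inl ha)
  simpa [absDiff] using h1.add h2

lemma tendsto_of_absDiff {ι : Type*} {l : Filter ι} {F : ι → ℝ≥0∞} {a : ℝ≥0∞} (ha : a ≠ ∞)
    (h : Tendsto (fun i => absDiff (F i) a) l (𝓝 0)) : Tendsto F l (𝓝 a) := by
  have h1 : Tendsto (fun i => a - absDiff (F i) a) l (𝓝 (a - 0)) :=
    ENNReal.Tendsto.sub tendsto_const_nhds h (Or.inl ha)
  have h2 : Tendsto (fun i => a + absDiff (F i) a) l (𝓝 (a + 0)) := tendsto_const_nhds.add h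
  rw [tsub_zero] at h1
  rw [add_zero] at h2
  refine tendsto_of_tendsto_of_tendsto_of_le_of_le h1 h2 (fun i => ?_) fun i => le_add_absDiff _ _
  rw [tsub_le_iff_right, absDiff_comm]
  exact le_add_absDiff _ _

lemma tendsto_zero_of_limsup_eq_zero {ι : Type*} {l : Filter ι} {F : ι → ℝ≥0∞}
    (h : limsup F l = 0) : Tendsto F l (𝓝 0) :=
  tendsto_of_le_liminf_of_limsup_le bot_le h.le

lemma measurable_absDiff {α : Type*} [MeasurableSpace α] {F G : α → ℝ≥0∞} (hF : Measurable F)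
    (hG : Measurable G) : Measurable fun x => absDiff (F x) (G x) :=
  (hF.sub hG).add (hG.sub hF)

lemma aemeasurable_absDiff {α : Type*} [MeasurableSpace α] {m : Measure α} {F G : α → ℝ≥0∞}
    (hF : AEMeasurable F m) (hG : AEMeasurable G m) :
    AEMeasurable (fun x => absDiff (F x) (G x)) m :=
  (hF.sub hG).add (hG.sub hF)

/-- A family that is dominated by integrable functions up to arbitrarily small errors and converges
almost everywhere also converges in `L¹`. -/
lemma tendsto_lintegral_absDiff {α ι : Type*} [MeasurableSpace α] {m : Measure α} {l : Filter ι}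
    [l.IsCountablyGenerated] [l.NeBot] {F : ι → α → ℝ≥0∞} {e : α → ℝ≥0}
    (hF : ∀ i, Measurable (F i)) (he : AEMeasurable e m)
    (hlim : ∀ᵐ x ∂m, Tendsto (fun i => F i x) l (𝓝 (e x)))
    (hdom : ∀ ε : ℝ≥0∞, ε ≠ 0 → ∃ H : α → ℝ≥0∞, Measurable H ∧ ∫⁻ x, H x ∂m ≠ ∞ ∧
      ∀ᶠ i in l, ∫⁻ x, (F i x - H x) ∂m ≤ ε) :
    ∫⁻ x, e x ∂m < ∞ ∧ Tendsto (fun i => ∫⁻ x, absDiff (F i x) (e x) ∂m) l (𝓝 0) := by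
  have he' : AEMeasurable (fun x => (e x : ℝ≥0∞)) m := he.coe_nnreal_ennreal
  -- By Fatou along a sequence, the limit e inherits the bound on the excess over H.
  have htail : ∀ (ε : ℝ≥0∞) (H : α → ℝ≥0∞), Measurable H →
      (∀ᶠ i in l, ∫⁻ x, (F i x - H x) ∂m ≤ ε) → ∫⁻ x, ((e x : ℝ≥0∞) - H x) ∂m ≤ ε := by
    intro ε H hH hev
    obtain ⟨s, hs⟩ := l.exists_seq_tendsto
    calc ∫⁻ x, ((e x : ℝ≥0∞) - H x) ∂m
        ≤ ∫⁻ x, liminf (fun n => F (s n) x - H x) atTop ∂m := by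
          refine lintegral_mono_ae ?_
          filter_upwards [hlim] with x hx
          have := ENNReal.Tendsto.sub (hx.comp hs) (tendsto_const_nhds (x := H x))
            (Or.inl ENNReal.coe_ne_top)
          exact this.liminf_eq.ge
      _ ≤ liminf (fun n => ∫⁻ x, (F (s n) x - H x) ∂m) atTop :=
          lintegral_liminf_le fun n => (hF _).sub hH
      _ ≤ ε := by
          refine liminf_le_of_frequently_le' ?_
          exact (hs.eventually hev).frequently
  constructor
  · obtain ⟨H, hH, hHfin, hev⟩ := hdom 1 one_ne_zero
    calc ∫⁻ x, e x ∂m ≤ ∫⁻ x, (H x + ((e x : ℝ≥0∞) - H x)) ∂m :=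
          lintegral_mono fun x => le_add_tsub
      _ = ∫⁻ x, H x ∂m + ∫⁻ x, ((e x : ℝ≥0∞) - H x) ∂m := lintegral_add_left hH _
      _ < ∞ := ENNReal.add_lt_top.2
          ⟨hHfin.lt_top, (htail 1 H hH hev).trans_lt ENNReal.one_lt_top⟩
  · rw [ENNReal.tendsto_nhds_zero]
    intro ε hε
    have hε3 : ε / 3 ≠ 0 := (ENNReal.div_pos hε.ne' (by norm_num)).ne'
    obtain ⟨H, hH, hHfin, hev⟩ := hdom (ε / 3) hε3
    -- Truncation at H makes ordinary dominated convergence applicable; what is cut off are the two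
    -- excesses, each with integral at most ε / 3.
    have hdct : Tendsto (fun i => ∫⁻ x, absDiff (min (F i x) (H x)) (min (e x) (H x)) ∂m) l
        (𝓝 (∫⁻ _, 0 ∂m)) := by
      refine tendsto_lintegral_filter_of_dominated_convergence' H (Eventually.of_forall fun i => ?_)
        (Eventually.of_forall fun i => Eventually.of_forall fun x => ?_) hHfin ?_
      · exact aemeasurable_absDiff ((hF i).min hH).aemeasurable (he'.min hH.aemeasurable)
      · exact (absDiff_le_max _ _).trans (max_le (min_le_right _ _) (min_le_right _ _))
      · filter_upwards [hlim] with x hx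
        exact tendsto_absDiff (((min_le_left _ _).trans_lt ENNReal.coe_lt_top).ne)
          (hx.min tendsto_const_nhds)
    rw [lintegral_zero, ENNReal.tendsto_nhds_zero] at hdct
    filter_upwards [hdct (ε / 3) (pos_iff_ne_zero.2 hε3), hev] with i h1 h2
    calc ∫⁻ x, absDiff (F i x) (e x) ∂m
        ≤ ∫⁻ x, (absDiff (min (F i x) (H x)) (min (e x) (H x)) +
            ((F i x - H x) + ((e x : ℝ≥0∞) - H x))) ∂m := by
          refine lintegral_mono fun x => ?_
          calc absDiff (F i x) (e x) ≤ absDiff (F i x) (min (F i x) (H x)) +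
                (absDiff (min (F i x) (H x)) (min (e x) (H x)) +
                  absDiff (min (e x) (H x)) (e x)) :=
                (absDiff_triangle _ _ _).trans (by gcongr; exact absDiff_triangle _ _ _)
            _ = _ := by
                rw [absDiff_min_right, absDiff_comm _ (e x : ℝ≥0∞), absDiff_min_right]; ring
      _ = ∫⁻ x, absDiff (min (F i x) (H x)) (min (e x) (H x)) ∂m +
            (∫⁻ x, (F i x - H x) ∂m + ∫⁻ x, ((e x : ℝ≥0∞) - H x) ∂m) := by
          have hm : AEMeasurable (fun x => F i x - H x + ((e x : ℝ≥0∞) - H x)) m :=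
            ((hF i).sub hH).aemeasurable.add (he'.sub hH.aemeasurable)
          rw [lintegral_add_right' _ hm, lintegral_add_left (f := fun x => F i x - H x) ((hF i).sub hH)]
      _ ≤ ε / 3 + (ε / 3 + ε / 3) := by
          gcongr
          exact htail _ H hH hev
      _ = ε := by rw [← add_assoc, ENNReal.add_thirds]

end AbsDiff

/-! ### Splitting an integrable density. -/

section Splitting

variable {X : Type*} [MetricSpace X] [MeasurableSpace X] [BorelSpace X]
  [SecondCountableTopology X] {μ : Measure X} [IsLocallyFiniteMeasure μ]

/-- An integrable function is the sum of a bounded one, vanishing near the complement of a set of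
finite measure, and one with small integral. -/
lemma exists_bounded_add_small [Nonempty X] {g : X → ℝ≥0∞} (hg : Measurable g)
    (hfin : ∫⁻ x, g x ∂μ ≠ ∞) {ε : ℝ≥0∞} (hε : ε ≠ 0) :
    ∃ (g₁ g₂ : X → ℝ≥0∞) (n : ℕ) (D : Set X) (r : ℝ), Measurable g₁ ∧ Measurable g₂ ∧
      (∀ x, g x = g₁ x + g₂ x) ∧ (∀ x, g₁ x ≤ n) ∧ ∫⁻ x, g₂ x ∂μ ≤ ε ∧ MeasurableSet D ∧
      μ D ≠ ∞ ∧ 0 < r ∧ ∀ x ∉ D, ∀ z ∈ closedBall x r, g₁ z = 0 := by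
  have hloc : ∀ x : X, ∃ r : ℝ, 0 < r ∧ μ (closedBall x (2 * r)) < ∞ := by
    intro x
    obtain ⟨s, hs, hμ⟩ := μ.finiteAt_nhds x
    obtain ⟨r, hr, hrs⟩ := Metric.nhds_basis_closedBall.mem_iff.1 hs
    exact ⟨r / 2, by positivity, (measure_mono (by rwa [mul_div_cancel₀ r two_ne_zero])).trans_lt hμ⟩
  choose ρ hρ hρμ using hloc
  obtain ⟨t, htc, ht⟩ := TopologicalSpace.countable_cover_nhds
    fun x => closedBall_mem_nhds x (hρ x)
  have htne : t.Nonempty := by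
    by_contra h
    rw [not_nonempty_iff_eq_empty] at h
    simp only [h, biUnion_empty] at ht
    exact empty_ne_univ ht
  obtain ⟨c, rfl⟩ := htc.exists_eq_range htne
  -- Finite unions exhausting X; g is cut off outside A n and at height n.
  set A : ℕ → Set X := fun n => ⋃ i ∈ Finset.range (n + 1), closedBall (c i) (ρ (c i)) with hA
  have hAm : ∀ n, MeasurableSet (A n) := fun n =>
    Finset.measurableSet_biUnion _ fun _ _ => measurableSet_closedBall
  set G : ℕ → X → ℝ≥0∞ := fun n => (A n).indicator fun x => min (g x) n with hG
  have hGm : ∀ n, Measurable (G n) := fun n => (hg.min measurable_const).indicator (hAm n)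
  have hGle : ∀ n x, G n x ≤ g x := fun n x =>
    (indicator_le_self _ _ x).trans (min_le_left _ _)
  have hgae : ∀ᵐ x ∂μ, g x < ∞ := ae_lt_top hg hfin
  have hlim : Tendsto (fun n => ∫⁻ x, (g x - G n x) ∂μ) atTop (𝓝 (∫⁻ _, 0 ∂μ)) := by
    refine tendsto_lintegral_of_dominated_convergence g (fun n => hg.sub (hGm n))
      (fun n => Eventually.of_forall fun x => tsub_le_self) hfin ?_
    filter_upwards [hgae] with x hx
    refine tendsto_const_nhds.congr' ?_
    obtain ⟨N, hN⟩ := ENNReal.exists_nat_gt hx.ne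
    have hxU : x ∈ ⋃ y ∈ range c, closedBall y (ρ y) := by rw [ht]; trivial
    simp only [mem_iUnion] at hxU
    obtain ⟨_, ⟨i, rfl⟩, hi⟩ := hxU
    filter_upwards [eventually_ge_atTop (max N i)] with n hn
    have h1 : x ∈ A n := mem_iUnion₂.2
      ⟨i, Finset.mem_range.2 (by have := le_max_right N i; omega), hi⟩
    have h2 : g x ≤ n := hN.le.trans (by exact_mod_cast (le_max_left N i).trans hn)
    simp [hG, indicator_of_mem h1, min_eq_left h2]
  rw [lintegral_zero, ENNReal.tendsto_nhds_zero] at hlim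
  obtain ⟨n, hn⟩ := (hlim ε (pos_iff_ne_zero.2 hε)).exists
  -- D doubles the radii of the finitely many balls, which still have finite measure. With r the
  -- least of these radii, a point within r of A n lies in D.
  obtain ⟨j, -, hj⟩ := (Finset.range (n + 1)).exists_min_image (fun i => ρ (c i)) ⟨0, by simp⟩
  refine ⟨G n, fun x => g x - G n x, n, ⋃ i ∈ Finset.range (n + 1), closedBall (c i) (2 * ρ (c i)),
    ρ (c j), hGm n, hg.sub (hGm n), fun x => (add_tsub_cancel_of_le (hGle n x)).symm,
    fun x => ?_, hn, Finset.measurableSet_biUnion _ fun _ _ => measurableSet_closedBall, ?_, hρ _,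
    fun x hx z hz => ?_⟩
  · exact (indicator_le_self _ _ x).trans (min_le_right _ _)
  · exact ((measure_biUnion_lt_top (Finset.finite_toSet _) fun i _ => hρμ (c i))).ne
  · refine indicator_of_notMem (fun hzA => hx ?_) _
    obtain ⟨i, hi, hzi⟩ := mem_iUnion₂.1 hzA
    refine mem_iUnion₂.2 ⟨i, hi, ?_⟩
    have h1 := hj i hi
    have h2 := dist_triangle_left x (c i) z
    rw [mem_closedBall] at hz hzi ⊢
    linarith

end Splitting

lemma measurable_edist_of_stronglyMeasurable {X Y : Type*} [MeasurableSpace X] [MetricSpace Y]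
    {f : X → Y} (hf : StronglyMeasurable f) :
    Measurable fun z : X × X => edist (f z.1) (f z.2) :=
  (continuous_edist.comp_stronglyMeasurable
    ((hf.comp_measurable measurable_fst).prodMk (hf.comp_measurable measurable_snd))).measurable

lemma tendsto_const_mul_nhdsGT {c : ℝ} (hc : 0 < c) :
    Tendsto (fun r : ℝ => c * r) (𝓝[>] 0) (𝓝[>] 0) := by
  refine tendsto_nhdsWithin_iff.2 ⟨?_, ?_⟩
  · have : Tendsto (fun r : ℝ => c * r) (𝓝 0) (𝓝 (c * 0)) := tendsto_id.const_mul c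
    rw [mul_zero] at this
    exact this.mono_left nhdsWithin_le_nhds
  · filter_upwards [self_mem_nhdsWithin] with r hr
    exact mul_pos hc hr

lemma coe_le_coe_add_edist (a b : ℝ≥0) : (b : ℝ≥0∞) ≤ a + edist (a : ℝ) (b : ℝ) := by
  rw [← ENNReal.ofReal_coe_nnreal, ← ENNReal.ofReal_coe_nnreal (p := a), edist_dist,
    ← ENNReal.ofReal_add a.coe_nonneg dist_nonneg]
  refine ENNReal.ofReal_le_ofReal ?_
  have := neg_abs_le ((a : ℝ) - b)
  rw [Real.dist_eq]
  linarith

/-! ### Consequences of the increment bound for Korevaar–Schoen energies. -/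

section KorevaarSchoen

variable {X : Type*} [MetricSpace X] [MeasurableSpace X] {Y : Type*} [MetricSpace Y]

/-- The increments of `f` at scales up to `R / m` between points of `S` outside the null set `N` are
controlled by mean values of `g`. -/
structure IncrementBound (μ : Measure X) (p : ℝ) (f : X → Y) (g : X → ℝ≥0∞) (C : ℝ≥0) (L : ℝ≥0∞)
    (m R : ℝ) (S N : Set X) : Prop where
  doubling : DoublingOn μ C R S
  null : μ N = 0
  one_le : 1 ≤ m
  ne_top : L ≠ ∞
  bound : ∀ x ∈ S \ N, ∀ y ∈ S \ N, ∀ r : ℝ, 0 < r → m * r ≤ R → dist x y ≤ r →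
    edist (f x) (f y) ^ p / ENNReal.ofReal r ^ p ≤
      L * (multiAvg μ g (m * r) x + multiAvg μ g (m * r) y)

variable {μ : Measure X} {p : ℝ} {f : X → Y} {g : X → ℝ≥0∞} {C : ℝ≥0} {L : ℝ≥0∞} {m R : ℝ}
  {S N : Set X}

lemma ks_union {V E : Set X} (hV : MeasurableSet V) (hVE : V ⊆ E) (x : X) (r : ℝ)
    [OpensMeasurableSpace X] :
    ks μ p f E x r = ks μ p f V x r + ks μ p f (E \ V) x r := by
  unfold ks
  split_ifs
  · rw [← mul_add, ← lintegral_inter_add_sdiff (A := closedBall x r ∩ E) (B := V) _ hV]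
    congr 3
    · rw [inter_assoc, inter_eq_self_of_subset_right hVE]
    · rw [inter_sdiff_assoc]
  · simp

variable [BorelSpace X]

/-- The increment bound is integrated over E, keeping the relative measure of E in the ball: this is
the factor that vanishes at points of density zero. -/
lemma IncrementBound.ks_le (h : IncrementBound μ p f g C L m R S N) {E : Set X}
    (hE : MeasurableSet E) {x : X} (hx : x ∈ S \ N) {r : ℝ} (hr : 0 < r)
    (hrR : m * r ≤ R) (hS : closedBall x r ⊆ S) :
    ks μ p f E x r ≤ L * (multiAvg μ g (m * r) x *
      ((μ (closedBall x r))⁻¹ * μ (closedBall x r ∩ E)) +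
      (μ (closedBall x r))⁻¹ * ∫⁻ y in closedBall x r ∩ E, multiAvg μ g (m * r) y ∂μ) := by
  unfold ks
  split_ifs
  · calc (μ (closedBall x r))⁻¹ *
          ∫⁻ y in closedBall x r ∩ E, edist (f x) (f y) ^ p / ENNReal.ofReal r ^ p ∂μ
        ≤ (μ (closedBall x r))⁻¹ * ∫⁻ y in closedBall x r ∩ E,
            L * (multiAvg μ g (m * r) x + multiAvg μ g (m * r) y) ∂μ := by
          gcongr 1
          refine setLIntegral_mono_ae' (measurableSet_closedBall.inter hE) ?_
          have hN : ∀ᵐ y ∂μ, y ∉ N := measure_eq_zero_iff_ae_notMem.1 h.null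
          filter_upwards [hN] with y hy hyB
          exact h.bound x hx y ⟨hS hyB.1, hy⟩ r hr hrR (by rw [dist_comm]; exact hyB.1)
      _ = _ := by
          rw [lintegral_const_mul' _ _ h.ne_top, lintegral_add_left measurable_const,
            setLIntegral_const]
          ring
  · exact zero_le

lemma IncrementBound.ks_le_ballAvg (h : IncrementBound μ p f g C L m R S N) {E : Set X}
    (hE : MeasurableSet E) {x : X} (hx : x ∈ S \ N) {r : ℝ} (hr : 0 < r)
    (hrR : m * r ≤ R) (hS : closedBall x r ⊆ S) :
    ks μ p f E x r ≤ L * (multiAvg μ g (m * r) x + ballAvg μ (multiAvg μ g (m * r)) r x) := by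
  refine (h.ks_le hE hx hr hrR hS).trans ?_
  gcongr
  · calc multiAvg μ g (m * r) x * ((μ (closedBall x r))⁻¹ * μ (closedBall x r ∩ E))
        ≤ multiAvg μ g (m * r) x * ((μ (closedBall x r))⁻¹ * μ (closedBall x r)) := by
          gcongr; exact inter_subset_left
      _ ≤ multiAvg μ g (m * r) x * 1 := by gcongr; exact inv_mul_self_le_one _
      _ = _ := mul_one _
  · unfold ballAvg
    gcongr
    exact inter_subset_left

variable [SecondCountableTopology X] [SFinite μ]

lemma measurable_ks (hf : StronglyMeasurable f) (E : Set X) (r : ℝ) :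
    Measurable fun x => ks μ p f E x r := by
  unfold ks
  have hmeas := measurable_measure_closedBall (μ := μ) r
  refine Measurable.ite ((measurableSet_lt measurable_const hmeas).inter
    (measurableSet_lt hmeas measurable_const)) (hmeas.inv.mul ?_) measurable_const
  simp_rw [← Measure.restrict_restrict measurableSet_closedBall]
  refine measurable_setLIntegral_closedBall (μ := μ.restrict E)
    (w := fun x y => edist (f x) (f y) ^ p / ENNReal.ofReal r ^ p) ?_ r
  exact ((measurable_edist_of_stronglyMeasurable hf).pow_const p).div_const _

/-- At a Lebesgue point of the density of the energy, sets of density zero do not contribute to the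
Korevaar–Schoen energy. -/
lemma IncrementBound.tendsto_ks_zero {g : X → ℝ≥0}
    (h : IncrementBound μ p f (fun x => g x) C L m R S N) (hg : Measurable g) (hR : 0 < R)
    {E : Set X} (hE : MeasurableSet E) {x : X} (hx : x ∈ S \ N) {ρ : ℝ} (hρ : 0 < ρ)
    (hS : closedBall x ρ ⊆ S)
    (hleb : Tendsto (fun s => ballAvg μ (fun z => edist (g x : ℝ) (g z : ℝ)) s x) (𝓝[>] 0) (𝓝 0))
    (hEx : Tendsto (fun r => (μ (closedBall x r))⁻¹ * μ (closedBall x r ∩ E)) (𝓝[>] 0) (𝓝 0)) :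
    Tendsto (fun r => ks μ p f E x r) (𝓝[>] 0) (𝓝 0) := by
  have hm := h.one_le
  set k : X → ℝ≥0∞ := fun z => edist (g x : ℝ) (g z : ℝ) with hk
  have hkm : Measurable k := measurable_const.edist hg.coe_nnreal_real
  -- The exponent n counts the doublings needed to pass from B(x,r) to B(x,(1+m)r), which contains
  -- every ball of radius m r centred in B(x,r).
  obtain ⟨n, hn⟩ := pow_unbounded_of_one_lt (1 + m) one_lt_two
  have hC1 : (1 : ℝ≥0) ≤ C := h.doubling.1
  have hk1 : ∀ᶠ s in 𝓝[>] (0 : ℝ), ballAvg μ k s x ≤ 1 :=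
    (hleb.eventually (gt_mem_nhds one_pos)).mono fun _ hs => hs.le
  obtain ⟨s₀, hs₀, hk1⟩ := mem_nhdsGT_iff_exists_Ioc_subset.1 hk1
  have hs₀ : 0 < s₀ := hs₀
  set q : ℝ → ℝ≥0∞ := fun r => (μ (closedBall x r))⁻¹ * μ (closedBall x r ∩ E) with hq
  set t : ℝ := min (min ρ (R / 2 ^ n)) (s₀ / m) with ht
  have ht0 : 0 < t := by positivity
  -- The density is compared with its value at the Lebesgue point x; the deviation k has vanishing
  -- averages at x.
  have hgk : ∀ (s : ℝ), 0 ≤ s → ∀ z, multiAvg μ (fun x => (g x : ℝ≥0∞)) s z ≤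
      4 * g x + multiAvg μ k s z := by
    intro s hs z
    calc multiAvg μ (fun x => (g x : ℝ≥0∞)) s z ≤ multiAvg μ (fun y => g x + k y) s z :=
          multiAvg_mono hs fun y _ => coe_le_coe_add_edist _ _
      _ = multiAvg μ (fun _ => (g x : ℝ≥0∞)) s z + multiAvg μ k s z :=
          multiAvg_add measurable_const _ _
      _ ≤ _ := by
          gcongr
          exact multiAvg_le_of_le hs fun _ _ => le_rfl
  have hbound : ∀ᶠ r in 𝓝[>] (0 : ℝ), ks μ p f E x r ≤ L * ((4 * g x + 4) * q r +
      (4 * g x * q r + 4 * C * (C ^ n * ballAvg μ k ((1 + m) * r) x))) := by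
    filter_upwards [Ioc_mem_nhdsGT ht0] with r hr
    obtain ⟨hr0, hrt⟩ := hr
    have hrρ : r ≤ ρ := hrt.trans ((min_le_left _ _).trans (min_le_left _ _))
    have hrR : r * 2 ^ n ≤ R := by
      have : r ≤ R / 2 ^ n := hrt.trans ((min_le_left _ _).trans (min_le_right _ _))
      rwa [le_div_iff₀ (by positivity)] at this
    have hrs : m * r ≤ s₀ := by
      have : r ≤ s₀ / m := hrt.trans (min_le_right _ _)
      rwa [le_div_iff₀ (by positivity), mul_comm] at this
    have hmr : m * r ≤ R := by nlinarith
    have hrR' : r ≤ R := by nlinarith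
    have hBS : closedBall x r ⊆ S := (closedBall_subset_closedBall hrρ).trans hS
    have hmr0 : 0 < m * r := by positivity
    refine (h.ks_le hE hx hr0 hmr hBS).trans ?_
    gcongr
    · refine (hgk _ hmr0.le x).trans ?_
      gcongr
      -- Boundedness suffices here, since this term is multiplied by the relative measure of E.
      calc multiAvg μ k (m * r) x ≤ 4 * 1 := multiAvg_le_of_ballAvg_le fun j =>
            hk1 ⟨by positivity, (div_le_self hmr0.le (one_le_pow₀ one_le_two)).trans hrs⟩
        _ = 4 := mul_one _
    · calc (μ (closedBall x r))⁻¹ * ∫⁻ y in closedBall x r ∩ E,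
              multiAvg μ (fun x => (g x : ℝ≥0∞)) (m * r) y ∂μ
          ≤ (μ (closedBall x r))⁻¹ * ∫⁻ y in closedBall x r ∩ E,
              (4 * g x + multiAvg μ k (m * r) y) ∂μ := by
            gcongr with y; exact hgk _ hmr0.le y
        _ = 4 * g x * q r + (μ (closedBall x r))⁻¹ *
              ∫⁻ y in closedBall x r ∩ E, multiAvg μ k (m * r) y ∂μ := by
            rw [lintegral_add_left measurable_const, setLIntegral_const]; ring
        _ ≤ 4 * g x * q r + (μ (closedBall x r))⁻¹ *
              (4 * C * ∫⁻ y in closedBall x ((1 + m) * r), k y ∂μ) := by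
            gcongr
            refine (lintegral_mono_set inter_subset_left).trans ?_
            -- The L¹ bound replaces the integral of the multi-scale average of k by that of k
            -- itself over a comparable ball, where the Lebesgue point property applies.
            refine lintegral_multiAvg_le h.doubling hmr0 hmr measurableSet_closedBall hBS
              (fun y hy => closedBall_subset_closedBall' ?_) hkm
            rw [mem_closedBall] at hy
            linarith
        _ = 4 * g x * q r + 4 * C * ((μ (closedBall x r))⁻¹ *
              ∫⁻ y in closedBall x ((1 + m) * r), k y ∂μ) := by ring
        _ ≤ _ := by
            gcongr 4 * g x * q r + 4 * C * ?_
            unfold ballAvg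
            rw [← mul_assoc]
            gcongr
            have h1 := h.doubling.measure_pow_le hx.1 hr0 n (by nlinarith)
            have h2 : μ (closedBall x ((1 + m) * r)) ≤ (C ^ n : ℝ≥0) * μ (closedBall x r) := by
              push_cast
              exact (measure_mono (closedBall_subset_closedBall (by nlinarith))).trans h1
            have := inv_le_mul_inv (one_le_pow₀ hC1) h2
            push_cast at this
            exact this
  have hlim : Tendsto (fun r => L * ((4 * g x + 4) * q r +
      (4 * g x * q r + 4 * C * (C ^ n * ballAvg μ k ((1 + m) * r) x)))) (𝓝[>] 0)
      (𝓝 (L * ((4 * g x + 4) * 0 + (4 * g x * 0 + 4 * C * (C ^ n * 0))))) := by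
    have h1 : Tendsto (fun r => ballAvg μ k ((1 + m) * r) x) (𝓝[>] 0) (𝓝 0) :=
      hleb.comp (tendsto_const_mul_nhdsGT (by linarith))
    refine ENNReal.Tendsto.const_mul ?_ (Or.inr h.ne_top)
    refine (ENNReal.Tendsto.const_mul hEx (Or.inr (by finiteness))).add
      ((ENNReal.Tendsto.const_mul hEx (Or.inr (by finiteness))).add
        (ENNReal.Tendsto.const_mul (ENNReal.Tendsto.const_mul h1 (Or.inr (by finiteness)))
          (Or.inr (by finiteness))))
  simp only [mul_zero, add_zero] at hlim
  exact tendsto_of_tendsto_of_tendsto_of_le_of_le' tendsto_const_nhds hlim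
    (Eventually.of_forall fun _ => zero_le) hbound

/-- The Korevaar–Schoen energies are dominated by integrable functions up to small errors. -/
lemma IncrementBound.exists_dominating [IsLocallyFiniteMeasure μ]
    (h : IncrementBound μ p f g C L m R S N) (hg : Measurable g) (hgfin : ∫⁻ x, g x ∂μ ≠ ∞)
    (hR : 0 < R) (hSm : MeasurableSet S) {E : Set X} (hE : MeasurableSet E) {Ω' : Set X}
    (hΩm : MeasurableSet Ω') {ρ : ℝ} (hρ : 0 < ρ) (hΩ' : ∀ x ∈ Ω', closedBall x ρ ⊆ S)
    {ε : ℝ≥0∞} (hε : ε ≠ 0) :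
    ∃ H : X → ℝ≥0∞, Measurable H ∧ ∫⁻ x in Ω', H x ∂μ ≠ ∞ ∧
      ∀ᶠ r in 𝓝[>] (0 : ℝ), ∫⁻ x in Ω', (ks μ p f E x r - H x) ∂μ ≤ ε := by
  have hm := h.one_le
  rcases isEmpty_or_nonempty X with hX | hX
  · exact ⟨0, measurable_zero, by simp, by simp [Measure.eq_zero_of_isEmpty μ]⟩
  -- A bounds the L¹ norm of the operator taking g₂ to L times its multi-scale average plus the ball
  -- average of the latter.
  set A : ℝ≥0∞ := L * (4 * C + C * (4 * C)) with hA
  have hAt : A ≠ ∞ := by have := h.ne_top; finiteness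
  have hεA : ε / A ≠ 0 := by simp [ENNReal.div_eq_zero_iff, hε, hAt]
  obtain ⟨g₁, g₂, n, D, r₁, hg₁, hg₂, hgg, hg₁n, hg₂ε, hDm, hDfin, hr₁, hD⟩ :=
    exists_bounded_add_small hg hgfin hεA
  set H : X → ℝ≥0∞ := D.indicator fun _ => L * (4 * n + 4 * n) with hH
  refine ⟨H, measurable_const.indicator hDm, ?_, ?_⟩
  · refine ((setLIntegral_le_lintegral _ _).trans_lt ?_).ne
    rw [hH, lintegral_indicator hDm, setLIntegral_const]
    have := h.ne_top
    finiteness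
  · set t : ℝ := min ρ (min (R / m) (r₁ / (1 + m))) with ht
    have ht0 : 0 < t := by positivity
    filter_upwards [Ioc_mem_nhdsGT ht0] with r hr
    obtain ⟨hr0, hrt⟩ := hr
    have hrρ : r ≤ ρ := hrt.trans (min_le_left _ _)
    have hmr : m * r ≤ R := by
      have : r ≤ R / m := hrt.trans ((min_le_right _ _).trans (min_le_left _ _))
      rwa [le_div_iff₀ (by positivity), mul_comm] at this
    have hr1 : (1 + m) * r ≤ r₁ := by
      have : r ≤ r₁ / (1 + m) := hrt.trans ((min_le_right _ _).trans (min_le_right _ _))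
      rwa [le_div_iff₀ (by positivity), mul_comm] at this
    have hmr0 : 0 < m * r := by positivity
    have hrR : r ≤ R := by nlinarith
    have hBS : ∀ x ∈ Ω', closedBall x r ⊆ S := fun x hx =>
      (closedBall_subset_closedBall hrρ).trans (hΩ' x hx)
    have hΩS : Ω' ⊆ S := fun x hx => hBS x hx (mem_closedBall_self hr0.le)
    have hT₁ : ∀ x y, y ∈ closedBall x r → multiAvg μ g₁ (m * r) y ≤
        D.indicator (fun _ => 4 * (n : ℝ≥0∞)) x := by
      intro x y hy
      by_cases hxD : x ∈ D
      · rw [indicator_of_mem hxD]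
        exact multiAvg_le_of_le hmr0.le fun z _ => hg₁n z
      · rw [indicator_of_notMem hxD]
        refine (multiAvg_le_of_le (c := 0) hmr0.le fun z hz => ?_).trans_eq (mul_zero _)
        refine (hD x hxD z ?_).le
        rw [mem_closedBall] at hy hz ⊢
        linarith [dist_triangle z y x]
    have hTadd : multiAvg μ g (m * r) = fun y =>
        multiAvg μ g₁ (m * r) y + multiAvg μ g₂ (m * r) y := by
      ext y
      rw [← multiAvg_add hg₁]
      congr 1
      ext z
      exact hgg z
    have hTm₁ := measurable_multiAvg (μ := μ) hg₁ (m * r)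
    have hTm₂ := measurable_multiAvg (μ := μ) hg₂ (m * r)
    have hpt : ∀ x ∈ Ω' \ N, ks μ p f E x r - H x ≤
        L * (multiAvg μ g₂ (m * r) x + ballAvg μ (multiAvg μ g₂ (m * r)) r x) := by
      intro x hx
      rw [tsub_le_iff_left]
      refine (h.ks_le_ballAvg hE ⟨hΩS hx.1, hx.2⟩ hr0 hmr (hBS x hx.1)).trans ?_
      have hHx : H x = L * (D.indicator (fun _ => 4 * (n : ℝ≥0∞)) x +
          D.indicator (fun _ => 4 * (n : ℝ≥0∞)) x) := by
        by_cases hxD : x ∈ D <;> simp [hH, hxD]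
      rw [hHx, ← mul_add, hTadd, ballAvg_add hTm₁]
      gcongr L * ?_
      rw [add_add_add_comm]
      gcongr
      · exact hT₁ x x (mem_closedBall_self hr0.le)
      · exact ballAvg_le_of_le fun y hy => hT₁ x y hy
    have hN : ∀ᵐ y ∂μ, y ∉ N := measure_eq_zero_iff_ae_notMem.1 h.null
    calc ∫⁻ x in Ω', (ks μ p f E x r - H x) ∂μ
        ≤ ∫⁻ x in Ω', L * (multiAvg μ g₂ (m * r) x +
            ballAvg μ (multiAvg μ g₂ (m * r)) r x) ∂μ := by
          refine setLIntegral_mono_ae' hΩm ?_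
          filter_upwards [hN] with x hxN hx
          exact hpt x ⟨hx, hxN⟩
      _ = L * (∫⁻ x in Ω', multiAvg μ g₂ (m * r) x ∂μ +
            ∫⁻ x in Ω', ballAvg μ (multiAvg μ g₂ (m * r)) r x ∂μ) := by
          rw [lintegral_const_mul' _ _ h.ne_top, lintegral_add_left hTm₂]
      _ ≤ L * (4 * C * ∫⁻ x in univ, g₂ x ∂μ + C * (4 * C * ∫⁻ x in univ, g₂ x ∂μ)) := by
          gcongr
          · exact lintegral_multiAvg_le h.doubling hmr0 hmr hΩm hΩS
              (fun _ _ => subset_univ _) hg₂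
          · refine (lintegral_ballAvg_le h.doubling hr0 hrR hΩm hΩS hBS hTm₂).trans ?_
            gcongr
            exact lintegral_multiAvg_le h.doubling hmr0 hmr hSm Subset.rfl
              (fun _ _ => subset_univ _) hg₂
      _ = A * ∫⁻ x, g₂ x ∂μ := by rw [Measure.restrict_univ, hA]; ring
      _ ≤ A * (ε / A) := by gcongr
      _ ≤ ε := ENNReal.mul_div_le

end KorevaarSchoen

/-! ### Changes on null sets, density points, and the density of the energy. -/

section Congruence

variable {X : Type*} [MetricSpace X] [MeasurableSpace X] {Y : Type*} [MetricSpace Y]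
  {μ : Measure X} {p : ℝ} {Ω : Set X}

lemma TendstoLpLoc.congr {O : Set X} {u : ℕ → X → ℝ} {v w : X → ℝ}
    (h : TendstoLpLoc μ p O u v) (hvw : v =ᵐ[μ.restrict O] w) : TendstoLpLoc μ p O u w := by
  intro x hx
  obtain ⟨r, hr, hlim⟩ := h x hx
  refine ⟨r, hr, hlim.congr fun n => ?_⟩
  refine lintegral_congr_ae ?_
  filter_upwards [ae_mono (Measure.restrict_mono inter_subset_left le_rfl) hvw] with y hy
  simp only [hy]

lemma cheegerSet_le_of_ae_eq {v w : X → ℝ} (h : v =ᵐ[μ.restrict Ω] w) (S : Set X) :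
    cheegerSet μ p Ω w S ≤ cheegerSet μ p Ω v S := by
  unfold cheegerSet
  refine iInf_mono fun O => iInf_mono fun hO => iInf_mono fun hOΩ => iInf_mono fun hSO => ?_
  unfold cheegerOpen
  refine iInf_mono fun u => iInf_mono fun hu => ?_
  refine iInf_mono' fun hlim => ⟨hlim.congr (ae_mono (Measure.restrict_mono hOΩ le_rfl) h), le_rfl⟩

lemma ks_congr {f f' : X → Y} (h : f =ᵐ[μ.restrict Ω] f') {E : Set X} (hE : E ⊆ Ω) {x : X}
    (hx : f x = f' x) (r : ℝ) : ks μ p f E x r = ks μ p f' E x r := by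
  unfold ks
  split_ifs
  · congr 1
    refine lintegral_congr_ae ?_
    filter_upwards [ae_mono (Measure.restrict_mono (inter_subset_right.trans hE) le_rfl) h]
      with y hy
    simp only [hy, hx]
  · rfl

lemma IsDensityPoint.tendsto_compl [OpensMeasurableSpace X] {V E : Set X} {x : X}
    (hV : MeasurableSet V) (h : IsDensityPoint μ V x)
    (hfin : ∀ᶠ r in 𝓝[>] (0 : ℝ), μ (closedBall x r) < ∞) (hEV : Disjoint E V) :
    Tendsto (fun r => (μ (closedBall x r))⁻¹ * μ (closedBall x r ∩ E)) (𝓝[>] 0) (𝓝 0) := by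
  have hlim := ENNReal.Tendsto.sub (tendsto_const_nhds (x := (1 : ℝ≥0∞))) h.2
    (Or.inl ENNReal.one_ne_top)
  rw [tsub_self] at hlim
  refine tendsto_of_tendsto_of_tendsto_of_le_of_le' tendsto_const_nhds hlim
    (Eventually.of_forall fun _ => zero_le) ?_
  filter_upwards [hfin, self_mem_nhdsWithin] with r hr hr0
  have h0 := (h.1 r hr0).ne'
  have hsum : μ (closedBall x r ∩ E) + μ (V ∩ closedBall x r) ≤ μ (closedBall x r) := by
    rw [← measure_union (hEV.mono inter_subset_right inter_subset_left)
      (hV.inter measurableSet_closedBall)]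
    exact measure_mono (union_subset inter_subset_left inter_subset_right)
  have hVfin : μ (V ∩ closedBall x r) / μ (closedBall x r) ≠ ∞ :=
    (ENNReal.div_lt_top ((measure_mono inter_subset_right).trans_lt hr).ne h0).ne
  refine ENNReal.le_sub_of_add_le_right hVfin ?_
  rw [mul_comm, ← div_eq_mul_inv, ENNReal.div_add_div_same]
  exact (ENNReal.div_le_div_right hsum _).trans ENNReal.div_self_le_one

end Congruence

lemma limsup_eq_zero_of_forall_le {a : ℝ≥0∞} {c : ℕ → ℝ≥0∞} (h : ∀ n, a ≤ c n)
    (hc : limsup c atTop = 0) : a = 0 := by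
  refine le_antisymm ?_ zero_le
  rw [← hc]
  exact (limsup_const a (f := (atTop : Filter ℕ))).ge.trans
    (limsup_le_limsup (Eventually.of_forall h))

/-- Radon–Nikodym: absolute continuity with respect to the restriction forces ν to vanish off Ω, so
ν is finite and its density is integrable and may be taken finite everywhere. -/
lemma exists_density {X : Type*} [MeasurableSpace X] {μ ν : Measure X} [SigmaFinite μ]
    {Ω : Set X} (hΩ : MeasurableSet Ω) (hfin : ν Ω < ∞)
    (hac : ν ≪ μ.restrict Ω) : ∃ g : X → ℝ≥0, Measurable g ∧
      ν = μ.withDensity (fun x => g x) ∧ ∫⁻ x, g x ∂μ ≠ ∞ := by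
  have hc : ν Ωᶜ = 0 := hac (by rw [Measure.restrict_apply hΩ.compl]; simp)
  have huniv : ν univ < ∞ := by
    rw [← union_compl_self Ω]
    exact (measure_union_le _ _).trans_lt (by rw [hc, add_zero]; exact hfin)
  have : IsFiniteMeasure ν := ⟨huniv⟩
  have hac' : ν ≪ μ := hac.trans Measure.absolutelyContinuous_restrict
  have heq : ν = μ.withDensity (fun x => ((ν.rnDeriv μ x).toNNReal : ℝ≥0∞)) := by
    conv_lhs => rw [← Measure.withDensity_rnDeriv_eq ν μ hac']
    refine withDensity_congr_ae ?_
    filter_upwards [ν.rnDeriv_lt_top μ] with x hx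
    exact (ENNReal.coe_toNNReal hx.ne).symm
  refine ⟨fun x => (ν.rnDeriv μ x).toNNReal, (ν.measurable_rnDeriv μ).ennreal_toNNReal, heq, ?_⟩
  rw [← setLIntegral_univ, ← withDensity_apply _ MeasurableSet.univ, ← heq]
  exact huniv.ne

/-! ### Convergence of the Korevaar–Schoen energies. -/

section EnergyDensity

variable {X : Type*} [MetricSpace X] [MeasurableSpace X] [BorelSpace X]
  [SecondCountableTopology X] {Y : Type*} [MetricSpace Y]
  {μ : Measure X} [IsLocallyFiniteMeasure μ] {p : ℝ} {Ω : Set X}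

/-- Korevaar–Schoen convergence on a well-contained set, pointwise and in `L¹`, along any open set
in between. -/
lemma tendsto_ks_of_wellContained [Nonempty X] (hX : LocallyComplete X) (hp : 1 ≤ p)
    (hD : InternallyDoubling μ) (hP : InternalPoincare μ p) (hΩ : IsOpen Ω)
    {f : X → Y} (hf : StronglyMeasurable f) {ν : Measure X}
    (hfν : ∀ φ : Y → ℝ, LipschitzWith 1 φ → (∃ C : ℝ, ∀ y, |φ y| ≤ C) →
      ∀ S : Set X, S ⊆ Ω → cheegerSet μ p Ω (φ ∘ f) S ≤ ν S)
    (hν : ν Ω < ∞) (hac : ν ≪ μ.restrict Ω) {e : X → ℝ≥0} (he : AEMeasurable e (μ.restrict Ω))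
    (hV : ∀ᵐ x ∂μ.restrict Ω, ∃ V : ℕ → Set X,
      (∀ n, MeasurableSet (V n) ∧ V n ⊆ Ω ∧ IsDensityPoint μ (V n) x) ∧
      limsup (fun n : ℕ => limsup (fun r : ℝ =>
        absDiff (ks μ p f (V n) x r) (e x)) (𝓝[>] 0)) atTop = 0)
    {Ω' : Set X} (hΩ' : IsOpen Ω') (hW : WellContained Ω' Ω) {E : Set X} (hE : IsOpen E)
    (hΩE : Ω' ⊆ E) (hEΩ : E ⊆ Ω) :
    (∀ᵐ x ∂μ.restrict Ω', Tendsto (fun r : ℝ => ks μ p f E x r) (𝓝[>] 0) (𝓝 (e x : ℝ≥0∞))) ∧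
      ∫⁻ x in Ω', e x ∂μ < ∞ ∧
      Tendsto (fun r : ℝ => ∫⁻ x in Ω', absDiff (ks μ p f E x r) (e x) ∂μ) (𝓝[>] 0) (𝓝 0) := by
  have hp0 : 0 < p := by linarith
  obtain ⟨g, hg, hνg, hgfin⟩ := exists_density hΩ.measurableSet hν hac
  obtain ⟨N, hN, hbound⟩ := exists_null_edist_rpow_le hX hD hp hf hfν hν.ne hνg
  obtain ⟨C, P, l, R, hR, hL⟩ := exists_localPoincare hD hP hW
  have hl := hL.one_le
  set S := cthickening R Ω' with hS
  -- Dividing the pointwise estimate by r^p leaves the constant (24 P C^4)^p and averages at scale 4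
  -- l r.
  have hI : IncrementBound μ p f (fun x => (g x : ℝ≥0∞)) C ((24 * P * C ^ 4 : ℝ≥0∞) ^ p)
      (4 * l) R S N := by
    refine ⟨hL.doubling, hN, by linarith, ENNReal.rpow_ne_top_of_nonneg hp0.le (by finiteness),
      fun x hx y hy r hr hrR hxy => ?_⟩
    have h := hbound hL x hx y hy r hr (by linarith) hxy
    have hr0 : ENNReal.ofReal r ^ p ≠ 0 := by
      simp [ENNReal.rpow_eq_zero_iff, hr]
    have hrt : ENNReal.ofReal r ^ p ≠ ∞ :=
      ENNReal.rpow_ne_top_of_nonneg hp0.le ENNReal.ofReal_ne_top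
    rw [ENNReal.div_le_iff hr0 hrt]
    refine h.trans_eq ?_
    rw [ENNReal.mul_rpow_of_nonneg _ _ hp0.le, mul_assoc 4 l r]
    ring
  have hSball : ∀ x ∈ Ω', closedBall x R ⊆ S := fun x hx =>
    closedBall_subset_cthickening hx R
  have hgloc : LocallyIntegrable (fun x => (g x : ℝ)) μ := by
    refine Integrable.locallyIntegrable ⟨hg.coe_nnreal_real.aestronglyMeasurable, ?_⟩
    rw [hasFiniteIntegral_iff_enorm]
    simpa using hgfin.lt_top
  have hptΩ : ∀ᵐ x ∂μ.restrict Ω',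
      Tendsto (fun r : ℝ => ks μ p f Ω x r) (𝓝[>] 0) (𝓝 (e x : ℝ≥0∞)) := by
    have hNae : ∀ᵐ y ∂μ, y ∉ N := measure_eq_zero_iff_ae_notMem.1 hN
    filter_upwards [ae_mono (Measure.restrict_mono hW.1 le_rfl) hV,
      ae_restrict_of_ae (ae_tendsto_ballAvg_edist hX hD hgloc), ae_restrict_of_ae hNae,
      ae_restrict_mem hΩ'.measurableSet] with x ⟨V, hVx, hVlim⟩ hleb hxN hxΩ
    have hxS : x ∈ S := hSball x hxΩ (mem_closedBall_self hR.le)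
    have hfin : ∀ᶠ r in 𝓝[>] (0 : ℝ), μ (closedBall x r) < ∞ := by
      filter_upwards [Ioc_mem_nhdsGT hR] with r hr
      exact (hL.doubling.2 x hxS r hr.1 hr.2).2.1
    refine tendsto_of_absDiff ENNReal.coe_ne_top (tendsto_zero_of_limsup_eq_zero
      (limsup_eq_zero_of_forall_le (fun n => ?_) hVlim))
    obtain ⟨hVm, hVΩ, hVd⟩ := hVx n
    have hzero := hI.tendsto_ks_zero hg hR (hΩ.measurableSet.diff hVm) ⟨hxS, hxN⟩ hR
      (hSball x hxΩ) hleb (hVd.tendsto_compl hVm hfin disjoint_sdiff_left)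
    -- The complement of V n in Ω has density zero at x and drops out. The upper limit along Ω is
    -- thus bounded by that along V n for every n, hence is 0.
    calc limsup (fun r => absDiff (ks μ p f Ω x r) (e x)) (𝓝[>] 0)
        ≤ limsup ((fun r => absDiff (ks μ p f (V n) x r) (e x)) +
            fun r => ks μ p f (Ω \ V n) x r) (𝓝[>] 0) := by
          refine limsup_le_limsup (Eventually.of_forall fun r => ?_)
          simp only [Pi.add_apply]
          rw [ks_union hVm hVΩ]
          exact absDiff_add_le _ _ _
      _ = _ := ENNReal.limsup_add_of_right_tendsto_zero hzero _
  have hptE : ∀ᵐ x ∂μ.restrict Ω',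
      Tendsto (fun r : ℝ => ks μ p f E x r) (𝓝[>] 0) (𝓝 (e x : ℝ≥0∞)) := by
    filter_upwards [hptΩ, ae_restrict_mem hΩ'.measurableSet] with x hx hxΩ
    -- Small balls about x lie in the open set E, so the energies along E and along Ω eventually
    -- coincide.
    obtain ⟨s, hs, hsE⟩ := Metric.nhds_basis_closedBall.mem_iff.1 (hE.mem_nhds (hΩE hxΩ))
    refine hx.congr' ?_
    filter_upwards [Ioc_mem_nhdsGT hs] with r hr
    have hrE : closedBall x r ⊆ E := (closedBall_subset_closedBall hr.2).trans hsE
    unfold ks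
    rw [inter_eq_self_of_subset_left hrE, inter_eq_self_of_subset_left (hrE.trans hEΩ)]
  have h := tendsto_lintegral_absDiff (m := μ.restrict Ω') (l := 𝓝[>] (0 : ℝ))
    (F := fun r x => ks μ p f E x r) (fun r => measurable_ks hf E r)
    (he.mono_measure (Measure.restrict_mono hW.1 le_rfl)) hptE
    (fun ε hε => hI.exists_dominating hg.coe_nnreal_ennreal hgfin hR
      isClosed_cthickening.measurableSet hE.measurableSet hΩ'.measurableSet hR hSball hε)
  exact ⟨hptE, h.1, h.2⟩

end EnergyDensity

/-! ### Iterated upper limits. -/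

section IteratedLimsup

lemma eventually_eventually_lt_of_limsup_lt {α β : Type*} {l : Filter α} {l' : Filter β}
    {F : α → β → ℝ≥0∞} {c : ℝ≥0∞} (h : limsup (fun r => limsup (fun δ => F r δ) l') l < c) :
    ∀ᶠ r in l, ∀ᶠ δ in l', F r δ < c :=
  (eventually_lt_of_limsup_lt h).mono fun _ hr => eventually_lt_of_limsup_lt hr

lemma limsup_limsup_le {α β : Type*} {l : Filter α} {l' : Filter β}
    {F : α → β → ℝ≥0∞} {c : ℝ≥0∞} (h : ∀ᶠ r in l, ∀ᶠ δ in l', F r δ ≤ c) :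
    limsup (fun r => limsup (fun δ => F r δ) l') l ≤ c :=
  limsup_le_of_le (by isBoundedDefault) (h.mono fun _ hr =>
    limsup_le_of_le (by isBoundedDefault) hr)

/-- The reverse Fatou lemma for iterated upper limits. -/
lemma limsup_limsup_lintegral_le {α ι κ : Type*} [MeasurableSpace α] {m : Measure α}
    {l : Filter ι} {l' : Filter κ} [l.IsCountablyGenerated] [l'.IsCountablyGenerated]
    {F : ι → κ → α → ℝ≥0∞} {G : α → ℝ≥0∞} (hG : ∫⁻ x, G x ∂m ≠ ∞)
    (hF : ∀ᶠ i in l, ∀ᶠ k in l', Measurable (F i k) ∧ F i k ≤ᵐ[m] G) :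
    limsup (fun i => limsup (fun k => ∫⁻ x, F i k x ∂m) l') l ≤
      ∫⁻ x, limsup (fun i => limsup (fun k => F i k x) l') l ∂m := by
  refine le_of_forall_lt fun c hc => ?_
  obtain ⟨c', hcc', hc'⟩ := exists_between hc
  refine hcc'.trans_le ?_
  -- An iterated upper limit cannot be read along one sequence: a sequence of outer parameters
  -- nearly attains it, and each has its own sequence of inner ones. The sequential reverse Fatou
  -- lemma is then applied twice.
  have hfreq := (frequently_lt_of_lt_limsup (by isBoundedDefault) hc').and_eventually hF
  obtain ⟨r, hr, hrP⟩ := exists_seq_forall_of_frequently hfreq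
  have hδ : ∀ n, ∃ d : ℕ → κ, Tendsto d atTop l' ∧ ∀ j, c' < ∫⁻ x, F (r n) (d j) x ∂m ∧
      Measurable (F (r n) (d j)) ∧ F (r n) (d j) ≤ᵐ[m] G := fun n =>
    exists_seq_forall_of_frequently
      ((frequently_lt_of_lt_limsup (by isBoundedDefault) (hrP n).1).and_eventually (hrP n).2)
  choose d hd hdP using hδ
  have hinner : ∀ n, c' ≤ ∫⁻ x, limsup (fun j => F (r n) (d n j) x) atTop ∂m := by
    intro n
    refine le_trans ?_ (limsup_lintegral_le G (fun j => (hdP n j).2.1) (fun j => (hdP n j).2.2) hG)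
    exact le_limsup_of_frequently_le (Frequently.of_forall fun j => (hdP n j).1.le)
  have hmeas : ∀ n, Measurable fun x => limsup (fun j => F (r n) (d n j) x) atTop := fun n =>
    Measurable.limsup fun j => (hdP n j).2.1
  have hdom : ∀ n, (fun x => limsup (fun j => F (r n) (d n j) x) atTop) ≤ᵐ[m] G := by
    intro n
    filter_upwards [ae_all_iff.2 fun j => (hdP n j).2.2] with x hx
    exact limsup_le_of_le (by isBoundedDefault) (Eventually.of_forall hx)
  calc c' ≤ limsup (fun n => ∫⁻ x, limsup (fun j => F (r n) (d n j) x) atTop ∂m) atTop :=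
        le_limsup_of_frequently_le (Frequently.of_forall hinner)
    _ ≤ ∫⁻ x, limsup (fun n => limsup (fun j => F (r n) (d n j) x) atTop) atTop ∂m :=
        limsup_lintegral_le G hmeas hdom hG
    _ ≤ _ := by
        refine lintegral_mono fun x => ?_
        calc limsup (fun n => limsup (fun j => F (r n) (d n j) x) atTop) atTop
            ≤ limsup (fun n => limsup (fun k => F (r n) k x) l') atTop :=
              limsup_le_limsup (Eventually.of_forall fun n =>
                limsup_le_limsup_of_le (u := fun k => F (r n) k x) (hd n))
          _ ≤ _ := limsup_le_limsup_of_le (u := fun i => limsup (fun k => F i k x) l') hr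

end IteratedLimsup

/-! ### Layer-cake bounds for radially decreasing mollifiers. -/

section Mollifiers

variable {X : Type*} [MetricSpace X] {ρ : ℝ → X → X → ℝ≥0} {δ : ℝ}

lemma molSup_anti (ρ : ℝ → X → X → ℝ≥0) (δ : ℝ) (x : X) {s t : ℝ} (h : s ≤ t) :
    molSup ρ δ x t ≤ molSup ρ δ x s :=
  iSup_mono fun _ => iSup_mono' fun hy => ⟨fun hys => hy (closedBall_subset_closedBall h hys), le_rfl⟩

/-- Telescoping, as `molSup` decreases in the radius. The term k = 0 is the full value at r / h, so
n + 1 terms reach the radius r / h ^ (n + 1). -/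
lemma sum_molInc (ρ : ℝ → X → X → ℝ≥0) (δ : ℝ) (x : X) {r h : ℝ} (hr : 0 < r) (hh : 1 < h)
    (n : ℕ) : ∑ j ∈ Finset.range (n + 1), molInc ρ δ x r h j = molSup ρ δ x (r / h ^ (n + 1)) := by
  induction n with
  | zero => simp [molInc]
  | succ n ih =>
    have hle : molSup ρ δ x (r / h ^ (n + 1)) ≤ molSup ρ δ x (r / h ^ (n + 1 + 1)) :=
      molSup_anti ρ δ x (div_le_div_of_nonneg_left hr.le (by positivity)
        (pow_le_pow_right₀ hh.le (by omega)))
    rw [Finset.sum_range_succ, ih, molInc, if_neg (by omega), absDiff, tsub_eq_zero_of_le hle,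
      add_zero, add_tsub_cancel_of_le hle]

lemma exists_mem_annulus {d r h : ℝ} (hd : 0 < d) (hdr : d ≤ r) (hh : 1 < h) :
    ∃ k : ℕ, r / h ^ (k + 1) < d ∧ d ≤ r / h ^ k := by
  obtain ⟨k, h1, h2⟩ := exists_nat_pow_near ((one_le_div hd).2 hdr) hh
  refine ⟨k, ?_, ?_⟩
  · rw [div_lt_iff₀ (by positivity)]
    rwa [div_lt_iff₀ hd, mul_comm] at h2
  · rw [le_div_iff₀ (by positivity)]
    rwa [le_div_iff₀ hd, mul_comm] at h1

/-- If r / h ^ (k + 1) < d(x,y) ≤ r / h ^ k, then y lies in the balls with indices up to k, whose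
increments add up to the supremum outside B(x, r / h ^ (k + 1)). -/
lemma le_tsum_molInc (ρ : ℝ → X → X → ℝ≥0) (δ : ℝ) {x y : X} {r h : ℝ} (hr : 0 < r) (hh : 1 < h)
    (hxy : x ≠ y) (hy : y ∈ closedBall x r) :
    (ρ δ x y : ℝ≥0∞) ≤ ∑' k, (closedBall x (r / h ^ k)).indicator
      (fun _ => molInc ρ δ x r h k) y := by
  obtain ⟨k, h1, h2⟩ := exists_mem_annulus (dist_pos.2 hxy.symm) hy hh
  calc (ρ δ x y : ℝ≥0∞) ≤ molSup ρ δ x (r / h ^ (k + 1)) :=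
        le_iSup₂_of_le y (by rw [mem_closedBall]; exact not_le.2 h1) le_rfl
    _ = ∑ j ∈ Finset.range (k + 1), molInc ρ δ x r h j := (sum_molInc ρ δ x hr hh k).symm
    _ = ∑ j ∈ Finset.range (k + 1), (closedBall x (r / h ^ j)).indicator
          (fun _ => molInc ρ δ x r h j) y := by
        refine Finset.sum_congr rfl fun j hj => ?_
        rw [indicator_of_mem]
        refine h2.trans (div_le_div_of_nonneg_left hr.le (by positivity)
          (pow_le_pow_right₀ hh.le ?_))
        have := Finset.mem_range.1 hj
        omega
    _ ≤ _ := ENNReal.sum_le_tsum _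

/-- For y in the k-th annulus only indices below k survive. Their increments sum to the supremum
outside B(x, r / h ^ k), whose points are farther from x than y; monotonicity concludes. -/
lemma tsum_molInc_le (hanti : ∀ x y z : X, x ≠ y → dist x y ≤ dist x z → ρ δ x z ≤ ρ δ x y)
    {x y : X} {r h : ℝ} (hr : 0 < r) (hh : 1 < h) (hxy : x ≠ y) (hy : y ∈ closedBall x r) :
    ∑' k, (closedBall x (r / h ^ (k + 1))).indicator (fun _ => molInc ρ δ x r h k) y ≤
      (ρ δ x y : ℝ≥0∞) := by
  obtain ⟨k, h1, h2⟩ := exists_mem_annulus (dist_pos.2 hxy.symm) hy hh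
  have hzero : ∀ j ∉ Finset.range k,
      (closedBall x (r / h ^ (j + 1))).indicator (fun _ => molInc ρ δ x r h j) y = 0 := by
    intro j hj
    refine indicator_of_notMem (fun hmem => absurd h1 (not_lt.2 ?_)) _
    refine (mem_closedBall.1 hmem).trans (div_le_div_of_nonneg_left hr.le (by positivity)
      (pow_le_pow_right₀ hh.le ?_))
    have : ¬ j < k := fun h => hj (Finset.mem_range.2 h)
    omega
  rw [tsum_eq_sum hzero]
  refine (Finset.sum_le_sum fun j _ => indicator_le_self _ _ y).trans ?_
  rcases k with _ | k
  · simp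
  · rw [sum_molInc ρ δ x hr hh k]
    refine iSup₂_le fun z hz => ?_
    rw [mem_closedBall, not_le] at hz
    refine ENNReal.coe_le_coe.2 (hanti x y z hxy ?_)
    rw [dist_comm, dist_comm x]
    linarith

/-- Makes `molSup` a countable supremum, hence measurable in x. For y outside the ball,
connectedness supplies points at distances strictly between r and d(x,y). A point of the dense
sequence in that open shell has a value at least as large, by monotonicity. -/
lemma molSup_eq_iSup_denseSeq [TopologicalSpace.SeparableSpace X] [ConnectedSpace X]
    (hanti : ∀ x y z : X, x ≠ y → dist x y ≤ dist x z → ρ δ x z ≤ ρ δ x y) (x : X) {r : ℝ}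
    (hr : 0 ≤ r) :
    molSup ρ δ x r = ⨆ i : ℕ, {z : X | r < dist (TopologicalSpace.denseSeq X i) z}.indicator
      (fun z => (ρ δ z (TopologicalSpace.denseSeq X i) : ℝ≥0∞)) x := by
  refine le_antisymm (iSup₂_le fun y hy => ?_) (iSup_le fun i => ?_)
  · rw [mem_closedBall, not_le] at hy
    obtain ⟨w, hw⟩ := mem_range_of_exists_le_of_exists_ge (f := fun z => dist z x)
      (c := (r + dist y x) / 2) (by fun_prop) ⟨x, by simp only [dist_self]; linarith⟩
      ⟨y, by linarith⟩
    have hw : dist w x = (r + dist y x) / 2 := hw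
    have hopen : IsOpen ((fun z => dist z x) ⁻¹' Ioo r (dist y x)) :=
      isOpen_Ioo.preimage (by fun_prop)
    obtain ⟨i, hi1, hi2⟩ := (TopologicalSpace.denseRange_denseSeq X).exists_mem_open hopen
      ⟨w, (by linarith : r < dist w x), (by linarith : dist w x < dist y x)⟩
    refine le_iSup_of_le i ?_
    rw [indicator_of_mem (show x ∈ {z : X | r < dist (TopologicalSpace.denseSeq X i) z} from hi1)]
    refine ENNReal.coe_le_coe.2 (hanti x _ y ?_ ?_)
    · exact (dist_pos.1 (hr.trans_lt hi1)).symm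
    · rw [dist_comm, dist_comm x]
      exact hi2.le
  · by_cases hi : x ∈ {z : X | r < dist (TopologicalSpace.denseSeq X i) z}
    · rw [indicator_of_mem hi]
      exact le_iSup₂_of_le _ (by rw [mem_closedBall]; exact not_le.2 hi) le_rfl
    · rw [indicator_of_notMem hi]
      exact zero_le

variable [MeasurableSpace X]

lemma piL_le_piU (μ : Measure X) {p : ℝ} (hp : 0 ≤ p) (ρ : ℝ → X → X → ℝ≥0) (k : ℕ) (δ : ℝ) (x : X)
    {r h : ℝ} (hr : 0 < r) (hh : 1 < h) : piL μ p ρ k δ x r h ≤ piU μ p ρ k δ x r h := by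
  have hle : r / h ^ (k + 1) ≤ r / h ^ k := div_le_div_of_nonneg_left hr.le (by positivity)
    (pow_le_pow_right₀ hh.le (by omega))
  unfold piL piU
  gcongr

variable {μ : Measure X} {p : ℝ}

lemma ks_mul_eq {Y : Type*} [MetricSpace Y] (hp : 0 ≤ p) (f : X → Y) (E : Set X) {x : X} {s : ℝ}
    (hs : 0 < s) (h0 : 0 < μ (closedBall x s)) (ht : μ (closedBall x s) < ∞) :
    μ (closedBall x s) * ENNReal.ofReal s ^ p * ks μ p f E x s =
      ∫⁻ y in closedBall x s ∩ E, edist (f x) (f y) ^ p ∂μ := by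
  unfold ks
  rw [if_pos ⟨h0, ht⟩]
  have hs0 : ENNReal.ofReal s ^ p ≠ 0 := by simp [ENNReal.rpow_eq_zero_iff, hs]
  have hst : ENNReal.ofReal s ^ p ≠ ∞ := ENNReal.rpow_ne_top_of_nonneg hp ENNReal.ofReal_ne_top
  simp_rw [div_eq_mul_inv]
  rw [lintegral_mul_const' _ _ (ENNReal.inv_ne_top.2 hs0)]
  set J := ∫⁻ y in closedBall x s ∩ E, edist (f x) (f y) ^ p ∂μ
  calc μ (closedBall x s) * ENNReal.ofReal s ^ p *
        ((μ (closedBall x s))⁻¹ * (J * (ENNReal.ofReal s ^ p)⁻¹))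
      = (μ (closedBall x s) * (μ (closedBall x s))⁻¹) *
          (ENNReal.ofReal s ^ p * (ENNReal.ofReal s ^ p)⁻¹) * J := by ring
    _ = J := by
        rw [ENNReal.mul_inv_cancel h0.ne' ht.ne, ENNReal.mul_inv_cancel hs0 hst, one_mul, one_mul]

end Mollifiers

/-! ### The deviation of the weights from the limit density. -/

section WeightGap

variable {X : Type*} [MetricSpace X] [MeasurableSpace X]

/-- The deviation of the sums of the weights from `Θ`. -/
noncomputable def weightGap (μ : Measure X) (p : ℝ) (ρ : ℝ → X → X → ℝ≥0) (Θ : X → ℝ≥0)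
    (h r δ : ℝ) (x : X) : ℝ≥0∞ :=
  absDiff (Θ x) (∑' k : ℕ, piL μ p ρ k δ x r h) + absDiff (Θ x) (∑' k : ℕ, piU μ p ρ k δ x r h)

lemma tsum_piU_le_add_weightGap {μ : Measure X} {p : ℝ} {ρ : ℝ → X → X → ℝ≥0} {δ : ℝ}
    {Θ : X → ℝ≥0} {h r : ℝ} {x : X} :
    ∑' k : ℕ, piU μ p ρ k δ x r h ≤ Θ x + weightGap μ p ρ Θ h r δ x := by
  refine (le_add_absDiff _ (Θ x : ℝ≥0∞)).trans ?_
  unfold weightGap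
  rw [absDiff_comm]
  gcongr
  exact le_add_self

end WeightGap

/-! ### Mollified energies as weighted sums of Korevaar–Schoen energies. -/

section MollifiedEnergy

variable {X : Type*} [MetricSpace X] [MeasurableSpace X] [BorelSpace X]
  {Y : Type*} [MetricSpace Y] {μ : Measure X} {p : ℝ} {ρ : ℝ → X → X → ℝ≥0} {δ : ℝ}

/-- The upper layer-cake bound integrated against d_f^p. It fails on the diagonal, where d_f^p
vanishes because p > 0. -/
lemma lintegral_mollified_le (hp : 0 < p) {f : X → Y}
    {x : X} (hfx : Measurable fun y => edist (f x) (f y)) {E : Set X} {r h : ℝ} (hr : 0 < r)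
    (hh : 1 < h)
    (hμ : ∀ s : ℝ, 0 < s → s ≤ r → 0 < μ (closedBall x s) ∧ μ (closedBall x s) < ∞) :
    ∫⁻ y in E ∩ closedBall x r, edist (f x) (f y) ^ p * ρ δ x y ∂μ ≤
      ∑' k, piU μ p ρ k δ x r h * ks μ p f E x (r / h ^ k) := by
  have hs : ∀ k : ℕ, 0 < r / h ^ k ∧ r / h ^ k ≤ r := fun k =>
    ⟨by positivity, div_le_self hr.le (one_le_pow₀ hh.le)⟩
  have hterm : ∀ k : ℕ, piU μ p ρ k δ x r h * ks μ p f E x (r / h ^ k) =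
      ∫⁻ y in E, (closedBall x (r / h ^ k)).indicator
        (fun y => molInc ρ δ x r h k * edist (f x) (f y) ^ p) y ∂μ := by
    intro k
    obtain ⟨h0, ht⟩ := hμ _ (hs k).1 (hs k).2
    unfold piU
    rw [mul_assoc (molInc ρ δ x r h k), mul_assoc (molInc ρ δ x r h k),
      ks_mul_eq hp.le f E (hs k).1 h0 ht,
      lintegral_indicator measurableSet_closedBall, Measure.restrict_restrict
        measurableSet_closedBall, lintegral_const_mul _ (hfx.pow_const p)]
  simp_rw [hterm]
  rw [← lintegral_tsum fun k => ((hfx.pow_const p).const_mul _).indicator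
    measurableSet_closedBall |>.aemeasurable]
  rw [inter_comm, ← Measure.restrict_restrict measurableSet_closedBall,
    ← lintegral_indicator measurableSet_closedBall]
  refine lintegral_mono fun y => ?_
  by_cases hy : y ∈ closedBall x r
  · rw [indicator_of_mem hy]
    by_cases hxy : x = y
    · simp [hxy, hp]
    · calc edist (f x) (f y) ^ p * ρ δ x y
          ≤ edist (f x) (f y) ^ p * ∑' k, (closedBall x (r / h ^ k)).indicator
              (fun _ => molInc ρ δ x r h k) y := by
            gcongr; exact le_tsum_molInc ρ δ hr hh hxy hy
        _ = _ := by
            rw [← ENNReal.tsum_mul_left]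
            refine tsum_congr fun k => ?_
            by_cases hk : y ∈ closedBall x (r / h ^ k)
            · rw [indicator_of_mem hk, indicator_of_mem hk, mul_comm]
            · rw [indicator_of_notMem hk, indicator_of_notMem hk, mul_zero]
  · rw [indicator_of_notMem hy]
    exact zero_le

lemma le_lintegral_mollified (hp : 0 < p) {f : X → Y}
    (hanti : ∀ x y z : X, x ≠ y → dist x y ≤ dist x z → ρ δ x z ≤ ρ δ x y)
    {x : X} (hfx : Measurable fun y => edist (f x) (f y)) {E : Set X} {r h : ℝ} (hr : 0 < r)
    (hh : 1 < h)
    (hμ : ∀ s : ℝ, 0 < s → s ≤ r → 0 < μ (closedBall x s) ∧ μ (closedBall x s) < ∞) :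
    ∑' k, piL μ p ρ k δ x r h * ks μ p f E x (r / h ^ (k + 1)) ≤
      ∫⁻ y in E ∩ closedBall x r, edist (f x) (f y) ^ p * ρ δ x y ∂μ := by
  have hs : ∀ k : ℕ, 0 < r / h ^ k ∧ r / h ^ k ≤ r := fun k =>
    ⟨by positivity, div_le_self hr.le (one_le_pow₀ hh.le)⟩
  have hterm : ∀ k : ℕ, piL μ p ρ k δ x r h * ks μ p f E x (r / h ^ (k + 1)) =
      ∫⁻ y in E, (closedBall x (r / h ^ (k + 1))).indicator
        (fun y => molInc ρ δ x r h k * edist (f x) (f y) ^ p) y ∂μ := by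
    intro k
    obtain ⟨h0, ht⟩ := hμ _ (hs (k + 1)).1 (hs (k + 1)).2
    unfold piL
    rw [mul_assoc (molInc ρ δ x r h k), mul_assoc (molInc ρ δ x r h k),
      ks_mul_eq hp.le f E (hs (k + 1)).1 h0 ht,
      lintegral_indicator measurableSet_closedBall, Measure.restrict_restrict
        measurableSet_closedBall, lintegral_const_mul _ (hfx.pow_const p)]
  simp_rw [hterm]
  rw [← lintegral_tsum fun k => ((hfx.pow_const p).const_mul _).indicator
    measurableSet_closedBall |>.aemeasurable]
  rw [inter_comm, ← Measure.restrict_restrict measurableSet_closedBall,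
    ← lintegral_indicator measurableSet_closedBall]
  refine lintegral_mono fun y => ?_
  have heq : ∑' k, (closedBall x (r / h ^ (k + 1))).indicator
      (fun y => molInc ρ δ x r h k * edist (f x) (f y) ^ p) y =
      edist (f x) (f y) ^ p * ∑' k, (closedBall x (r / h ^ (k + 1))).indicator
        (fun _ => molInc ρ δ x r h k) y := by
    rw [← ENNReal.tsum_mul_left]
    refine tsum_congr fun k => ?_
    by_cases hk : y ∈ closedBall x (r / h ^ (k + 1))
    · rw [indicator_of_mem hk, indicator_of_mem hk, mul_comm]
    · rw [indicator_of_notMem hk, indicator_of_notMem hk, mul_zero]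
  rw [heq]
  by_cases hy : y ∈ closedBall x r
  · rw [indicator_of_mem hy]
    by_cases hxy : x = y
    · simp [hxy, hp]
    · gcongr
      exact tsum_molInc_le hanti hr hh hxy hy
  · have : ∀ k : ℕ, (closedBall x (r / h ^ (k + 1))).indicator
        (fun _ => molInc ρ δ x r h k) y = 0 := fun k =>
      indicator_of_notMem (fun hk => hy (closedBall_subset_closedBall (hs (k + 1)).2 hk)) _
    simp [this]

/-- In both layer-cake bounds each `ks` is replaced by e at the cost of its deviation, weighted by
at most Π_U. What remains is e times a sum of weights, compared with Θ through `weightGap`. -/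
lemma absDiff_mollified_le (hp : 0 < p) {f : X → Y}
    (hanti : ∀ x y z : X, x ≠ y → dist x y ≤ dist x z → ρ δ x z ≤ ρ δ x y)
    {x : X} (hfx : Measurable fun y => edist (f x) (f y)) {E : Set X} {r h : ℝ} (hr : 0 < r)
    (hh : 1 < h)
    (hμ : ∀ s : ℝ, 0 < s → s ≤ r → 0 < μ (closedBall x s) ∧ μ (closedBall x s) < ∞)
    (Θ e : X → ℝ≥0) :
    absDiff (∫⁻ y in E ∩ closedBall x r, edist (f x) (f y) ^ p * ρ δ x y ∂μ) (Θ x * e x) ≤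
      ∑' k, piU μ p ρ k δ x r h * (absDiff (ks μ p f E x (r / h ^ k)) (e x) +
        absDiff (ks μ p f E x (r / h ^ (k + 1))) (e x)) + e x * weightGap μ p ρ Θ h r δ x := by
  set I := ∫⁻ y in E ∩ closedBall x r, edist (f x) (f y) ^ p * ρ δ x y ∂μ
  set U := ∑' k : ℕ, piU μ p ρ k δ x r h with hU
  set V := ∑' k : ℕ, piL μ p ρ k δ x r h with hV
  have hupper : I ≤ Θ x * e x + (∑' k, piU μ p ρ k δ x r h *
      absDiff (ks μ p f E x (r / h ^ k)) (e x) + e x * absDiff (Θ x) U) := by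
    calc I ≤ ∑' k, piU μ p ρ k δ x r h * ks μ p f E x (r / h ^ k) :=
          lintegral_mollified_le hp hfx hr hh hμ
      _ ≤ ∑' k, piU μ p ρ k δ x r h * (e x + absDiff (ks μ p f E x (r / h ^ k)) (e x)) := by
          gcongr; exact le_add_absDiff _ _
      _ = U * e x + ∑' k, piU μ p ρ k δ x r h * absDiff (ks μ p f E x (r / h ^ k)) (e x) := by
          simp_rw [mul_add]
          rw [ENNReal.tsum_add, ENNReal.tsum_mul_right]
      _ ≤ (Θ x + absDiff (Θ x) U) * e x +
            ∑' k, piU μ p ρ k δ x r h * absDiff (ks μ p f E x (r / h ^ k)) (e x) := by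
          gcongr
          rw [absDiff_comm]
          exact le_add_absDiff _ _
      _ = _ := by ring
  have hlower : Θ x * e x ≤ I + (∑' k, piU μ p ρ k δ x r h *
      absDiff (ks μ p f E x (r / h ^ (k + 1))) (e x) + e x * absDiff (Θ x) V) := by
    calc (Θ x : ℝ≥0∞) * e x ≤ (V + absDiff (Θ x) V) * e x := by
          gcongr; exact le_add_absDiff _ _
      _ = ∑' k, piL μ p ρ k δ x r h * e x + e x * absDiff (Θ x) V := by
          rw [ENNReal.tsum_mul_right]; ring
      _ ≤ ∑' k, piL μ p ρ k δ x r h * (ks μ p f E x (r / h ^ (k + 1)) +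
            absDiff (ks μ p f E x (r / h ^ (k + 1))) (e x)) + e x * absDiff (Θ x) V := by
          gcongr
          rw [absDiff_comm]
          exact le_add_absDiff _ _
      _ = ∑' k, piL μ p ρ k δ x r h * ks μ p f E x (r / h ^ (k + 1)) +
            ∑' k, piL μ p ρ k δ x r h * absDiff (ks μ p f E x (r / h ^ (k + 1))) (e x) +
            e x * absDiff (Θ x) V := by
          simp_rw [mul_add]
          rw [ENNReal.tsum_add]
      _ ≤ I + ∑' k, piU μ p ρ k δ x r h * absDiff (ks μ p f E x (r / h ^ (k + 1))) (e x) +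
            e x * absDiff (Θ x) V := by
          gcongr
          · exact le_lintegral_mollified hp hanti hfx hr hh hμ
          · exact piL_le_piU μ hp.le ρ _ δ x hr hh
      _ = _ := by ring
  refine (absDiff_le_add hupper hlower).trans_eq ?_
  simp_rw [mul_add]
  rw [ENNReal.tsum_add]
  unfold weightGap
  ring

variable [TopologicalSpace.SeparableSpace X] [ConnectedSpace X] [SFinite μ]

lemma measurable_molSup (hanti : ∀ x y z : X, x ≠ y → dist x y ≤ dist x z → ρ δ x z ≤ ρ δ x y)
    (hm : Measurable fun z : X × X => ρ δ z.1 z.2) {r : ℝ} (hr : 0 ≤ r) :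
    Measurable fun x => molSup ρ δ x r := by
  simp_rw [molSup_eq_iSup_denseSeq hanti _ hr]
  refine Measurable.iSup fun i => Measurable.indicator ?_ ?_
  · exact (hm.comp (measurable_id.prodMk measurable_const)).coe_nnreal_ennreal
  · exact (isOpen_lt continuous_const (by fun_prop)).measurableSet

lemma measurable_molInc (hanti : ∀ x y z : X, x ≠ y → dist x y ≤ dist x z → ρ δ x z ≤ ρ δ x y)
    (hm : Measurable fun z : X × X => ρ δ z.1 z.2) {r h : ℝ} (hr : 0 < r) (hh : 1 < h) (k : ℕ) :
    Measurable fun x => molInc ρ δ x r h k := by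
  unfold molInc
  split_ifs
  · exact measurable_molSup hanti hm (by positivity)
  · exact measurable_absDiff (measurable_molSup hanti hm (by positivity))
      (measurable_molSup hanti hm (by positivity))

lemma measurable_weightGap
    (hanti : ∀ x y z : X, x ≠ y → dist x y ≤ dist x z → ρ δ x z ≤ ρ δ x y)
    (hm : Measurable fun z : X × X => ρ δ z.1 z.2) {r h : ℝ} (hr : 0 < r) (hh : 1 < h)
    {Θ : X → ℝ≥0} (hΘ : Measurable Θ) : Measurable (weightGap μ p ρ Θ h r δ) := by
  have := UniformSpace.secondCountable_of_separable X
  refine (measurable_absDiff hΘ.coe_nnreal_ennreal (Measurable.tsum fun k => ?_)).add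
    (measurable_absDiff hΘ.coe_nnreal_ennreal (Measurable.tsum fun k => ?_))
  · exact ((measurable_molInc hanti hm hr hh k).mul (measurable_measure_closedBall _)).mul
      measurable_const
  · exact ((measurable_molInc hanti hm hr hh k).mul (measurable_measure_closedBall _)).mul
      measurable_const

end MollifiedEnergy

/-! ### Limits of mollified energies, pointwise and in L¹. -/

section MollifierLimit

variable {X : Type*} [MetricSpace X] [MeasurableSpace X] {μ : Measure X} {p : ℝ}
  {ρ : ℝ → X → X → ℝ≥0} {Θ : X → ℝ≥0}

/-- The essential supremum inside the limit in h lets one h serve almost every x, which the L¹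
argument needs. -/
lemma IsMollifierDensity.exists_weightGap_lt (hΘ : IsMollifierDensity μ p ρ Θ) {τ : ℝ≥0∞}
    (hτ : 0 < τ) : ∃ h : ℝ, 1 < h ∧ ∀ᵐ x ∂μ,
      limsup (fun r : ℝ => limsup (fun δ : ℝ => weightGap μ p ρ Θ h r δ x) (𝓝[>] 0)) (𝓝[>] 0)
        < τ := by
  have hlim := hΘ.2
  have hev := eventually_lt_of_limsup_lt (hlim.trans_lt hτ)
  obtain ⟨h, hh, hh1⟩ := (hev.and self_mem_nhdsWithin).exists
  refine ⟨h, hh1, ?_⟩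
  filter_upwards [ENNReal.ae_le_essSup (μ := μ) (fun x : X =>
      limsup (fun r : ℝ => limsup (fun δ : ℝ =>
        absDiff (Θ x) (∑' k : ℕ, piL μ p ρ k δ x r h) +
          absDiff (Θ x) (∑' k : ℕ, piU μ p ρ k δ x r h)) (𝓝[>] 0)) (𝓝[>] 0))] with x hx
  exact hx.trans_lt hh

/-- A crude bound that supplies the dominating function for the reverse Fatou lemma. -/
lemma weightGap_le (hp : 0 ≤ p) {S : Set X} {x : X} (hx : x ∈ S) {r h δ : ℝ} (hr : 0 < r)
    (hh : 1 < h) : weightGap μ p ρ Θ h r δ x ≤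
      2 * Θ x + 2 * ∑' k : ℕ, ⨆ x ∈ S, piU μ p ρ k δ x r h := by
  have hU : ∑' k : ℕ, piU μ p ρ k δ x r h ≤ ∑' k : ℕ, ⨆ x ∈ S, piU μ p ρ k δ x r h :=
    ENNReal.tsum_le_tsum fun k => le_iSup₂ (f := fun x (_ : x ∈ S) => piU μ p ρ k δ x r h) x hx
  have hV : ∑' k : ℕ, piL μ p ρ k δ x r h ≤ ∑' k : ℕ, ⨆ x ∈ S, piU μ p ρ k δ x r h :=
    (ENNReal.tsum_le_tsum fun k => piL_le_piU μ hp ρ k δ x hr hh).trans hU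
  unfold weightGap
  calc absDiff (Θ x) (∑' k : ℕ, piL μ p ρ k δ x r h) +
        absDiff (Θ x) (∑' k : ℕ, piU μ p ρ k δ x r h)
      ≤ (Θ x + ∑' k : ℕ, piL μ p ρ k δ x r h) + (Θ x + ∑' k : ℕ, piU μ p ρ k δ x r h) :=
        add_le_add (absDiff_le_add_self _ _) (absDiff_le_add_self _ _)
    _ ≤ (Θ x + ∑' k : ℕ, ⨆ x ∈ S, piU μ p ρ k δ x r h) +
        (Θ x + ∑' k : ℕ, ⨆ x ∈ S, piU μ p ρ k δ x r h) := by gcongr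
    _ = _ := by ring

lemma weightGap_congr {Θ' : X → ℝ≥0} {h r δ : ℝ} {x : X} (hx : Θ x = Θ' x) :
    weightGap μ p ρ Θ h r δ x = weightGap μ p ρ Θ' h r δ x := by
  unfold weightGap
  rw [hx]

lemma tendsto_inv_nat_succ : Tendsto (fun n : ℕ => ((n + 1 : ℕ) : ℝ≥0∞)⁻¹) atTop (𝓝 0) :=
  ENNReal.tendsto_inv_nat_nhds_zero.comp (tendsto_add_atTop_nat 1)

variable [BorelSpace X] {Y : Type*} [MetricSpace Y]

/-- For small r all radii r / h ^ k are at most r, so every `ks` is within τ of e at once, while the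
weights sum to at most Θ + τ. Then τ = 1/(n+1) tends to 0. -/
lemma limsup_mollified_eq_zero (hp : 0 < p)
    (hanti : ∀ δ ∈ Ioo (0 : ℝ) 1, ∀ x y z : X, x ≠ y → dist x y ≤ dist x z → ρ δ x z ≤ ρ δ x y)
    {f : X → Y} {e : X → ℝ≥0} {x : X} (hfx : Measurable fun y => edist (f x) (f y)) {E : Set X}
    {R : ℝ} (hR : 0 < R)
    (hμ : ∀ s : ℝ, 0 < s → s ≤ R → 0 < μ (closedBall x s) ∧ μ (closedBall x s) < ∞)
    (hlim : Tendsto (fun r : ℝ => ks μ p f E x r) (𝓝[>] 0) (𝓝 (e x : ℝ≥0∞)))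
    (hgap : ∀ n : ℕ, ∃ h : ℝ, 1 < h ∧
      limsup (fun r : ℝ => limsup (fun δ : ℝ => weightGap μ p ρ Θ h r δ x) (𝓝[>] 0)) (𝓝[>] 0)
        < ((n + 1 : ℕ) : ℝ≥0∞)⁻¹) :
    limsup (fun r : ℝ => limsup (fun δ : ℝ =>
      absDiff (∫⁻ y in E ∩ closedBall x r, edist (f x) (f y) ^ p * ρ δ x y ∂μ)
        (Θ x * e x)) (𝓝[>] 0)) (𝓝[>] 0) = 0 := by
  have hbound : ∀ n : ℕ, limsup (fun r : ℝ => limsup (fun δ : ℝ =>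
      absDiff (∫⁻ y in E ∩ closedBall x r, edist (f x) (f y) ^ p * ρ δ x y ∂μ)
        (Θ x * e x)) (𝓝[>] 0)) (𝓝[>] 0) ≤
      (Θ x + ((n + 1 : ℕ) : ℝ≥0∞)⁻¹) * (((n + 1 : ℕ) : ℝ≥0∞)⁻¹ + ((n + 1 : ℕ) : ℝ≥0∞)⁻¹) +
        e x * ((n + 1 : ℕ) : ℝ≥0∞)⁻¹ := by
    intro n
    set τ : ℝ≥0∞ := ((n + 1 : ℕ) : ℝ≥0∞)⁻¹ with hτ
    have hτ0 : 0 < τ := by rw [hτ, ENNReal.inv_pos]; exact ENNReal.natCast_ne_top _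
    obtain ⟨h, hh, hlt⟩ := hgap n
    have hks : ∀ᶠ s in 𝓝[>] (0 : ℝ), absDiff (ks μ p f E x s) (e x) ≤ τ :=
      ENNReal.tendsto_nhds_zero.1 (tendsto_absDiff ENNReal.coe_ne_top hlim) τ hτ0
    obtain ⟨s₀, hs₀, hks⟩ := mem_nhdsGT_iff_exists_Ioc_subset.1 hks
    have hs₀ : 0 < s₀ := hs₀
    refine limsup_limsup_le ?_
    filter_upwards [eventually_eventually_lt_of_limsup_lt hlt,
      Ioc_mem_nhdsGT (lt_min hR hs₀)] with r hr hrI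
    have hrR : r ≤ R := hrI.2.trans (min_le_left _ _)
    have hrs : r ≤ s₀ := hrI.2.trans (min_le_right _ _)
    filter_upwards [hr, Ioo_mem_nhdsGT one_pos] with δ hδ hδ1
    have hr0 : 0 < r := hrI.1
    have hks' : ∀ k : ℕ, absDiff (ks μ p f E x (r / h ^ k)) (e x) ≤ τ := fun k =>
      hks ⟨by positivity, (div_le_self hr0.le (one_le_pow₀ hh.le)).trans hrs⟩
    refine (absDiff_mollified_le hp (hanti δ hδ1) hfx hr0 hh
      (fun s hs hsr => hμ s hs (hsr.trans hrR)) Θ e).trans ?_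
    gcongr
    calc ∑' k, piU μ p ρ k δ x r h * (absDiff (ks μ p f E x (r / h ^ k)) (e x) +
          absDiff (ks μ p f E x (r / h ^ (k + 1))) (e x))
        ≤ ∑' k, piU μ p ρ k δ x r h * (τ + τ) := by
          gcongr
          · exact hks' _
          · exact hks' _
      _ = (∑' k, piU μ p ρ k δ x r h) * (τ + τ) := ENNReal.tsum_mul_right
      _ ≤ (Θ x + τ) * (τ + τ) := by
          gcongr
          refine (tsum_piU_le_add_weightGap (Θ := Θ)).trans ?_
          gcongr
  have hc : Tendsto (fun n : ℕ =>
      (Θ x + ((n + 1 : ℕ) : ℝ≥0∞)⁻¹) * (((n + 1 : ℕ) : ℝ≥0∞)⁻¹ + ((n + 1 : ℕ) : ℝ≥0∞)⁻¹) +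
        e x * ((n + 1 : ℕ) : ℝ≥0∞)⁻¹) atTop (𝓝 ((Θ x + 0) * (0 + 0) + e x * 0)) := by
    have h0 := tendsto_inv_nat_succ
    refine (ENNReal.Tendsto.mul (tendsto_const_nhds.add h0) (Or.inr (by simp)) (h0.add h0)
      (Or.inr (by simp))).add (ENNReal.Tendsto.const_mul h0 (Or.inr ENNReal.coe_ne_top))
  simp only [add_zero, mul_zero] at hc
  exact le_antisymm (ge_of_tendsto' hc hbound) zero_le

/-- Suprema of the weights over E come out of the integral, leaving the L¹ deviations J at the radii
r / h ^ k. The gap term converges only pointwise and is treated by reverse Fatou. -/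
lemma limsup_lintegral_mollified_eq_zero [TopologicalSpace.SeparableSpace X] [ConnectedSpace X]
    [SFinite μ] (hp : 0 < p) (hρ : StronglyAdmissible μ p ρ) (hΘ : IsMollifierDensity μ p ρ Θ)
    {f : X → Y} (hf : StronglyMeasurable f) {e : X → ℝ≥0} {E : Set X} (hE : MeasurableSet E)
    (hW : WellContained E univ) (he : AEMeasurable e (μ.restrict E)) {R : ℝ} (hR : 0 < R)
    (hμ : ∀ x ∈ E, ∀ s : ℝ, 0 < s → s ≤ R → 0 < μ (closedBall x s) ∧ μ (closedBall x s) < ∞)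
    (hefin : ∫⁻ x in E, e x ∂μ < ∞)
    (hlim : Tendsto (fun r : ℝ => ∫⁻ x in E, absDiff (ks μ p f E x r) (e x) ∂μ) (𝓝[>] 0) (𝓝 0)) :
    limsup (fun r : ℝ => limsup (fun δ : ℝ => ∫⁻ x in E,
      absDiff (∫⁻ y in E ∩ closedBall x r, edist (f x) (f y) ^ p * ρ δ x y ∂μ)
        (Θ x * e x) ∂μ) (𝓝[>] 0)) (𝓝[>] 0) = 0 := by
  have := UniformSpace.secondCountable_of_separable X
  have hΘm := hΘ.1
  set J : ℝ → ℝ≥0∞ := fun s => ∫⁻ x in E, absDiff (ks μ p f E x s) (e x) ∂μ with hJ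
  -- The reverse Fatou lemma asks for measurable integrands, hence the measurable representatives of
  -- e and Θ.
  set e' := he.mk e with he'
  set Θ' := hΘm.mk Θ with hΘ'
  have hee' : ∀ᵐ x ∂μ.restrict E, e x = e' x := he.ae_eq_mk
  have hΘΘ' : ∀ᵐ x ∂μ.restrict E, Θ x = Θ' x := ae_restrict_of_ae hΘm.ae_eq_mk
  have hinte : ∫⁻ x in E, e' x ∂μ = ∫⁻ x in E, e x ∂μ :=
    lintegral_congr_ae (hee'.mono fun x hx => by simp only [hx])
  have hEmem : ∀ᵐ x ∂μ.restrict E, x ∈ E := ae_restrict_mem hE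
  have hbound : ∀ n : ℕ, limsup (fun r : ℝ => limsup (fun δ : ℝ => ∫⁻ x in E,
      absDiff (∫⁻ y in E ∩ closedBall x r, edist (f x) (f y) ^ p * ρ δ x y ∂μ)
        (Θ x * e x) ∂μ) (𝓝[>] 0)) (𝓝[>] 0) ≤
      ((n + 1 : ℕ) : ℝ≥0∞)⁻¹ + (((n + 1 : ℕ) : ℝ≥0∞)⁻¹ * ∫⁻ x in E, e x ∂μ +
        ((n + 1 : ℕ) : ℝ≥0∞)⁻¹) := by
    intro n
    set τ : ℝ≥0∞ := ((n + 1 : ℕ) : ℝ≥0∞)⁻¹ with hτ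
    have hτ0 : 0 < τ := by rw [hτ, ENNReal.inv_pos]; exact ENNReal.natCast_ne_top _
    have hτt : τ ≠ ∞ := by simp [hτ]
    obtain ⟨h, hh, hgap⟩ := hΘ.exists_weightGap_lt hτ0
    have hgap := ae_restrict_of_ae (s := E) hgap
    obtain ⟨M, hM, hMt⟩ := exists_between (hρ.bounds_all E hW h hh)
    have hM0 : M ≠ 0 := (bot_le.trans_lt hM).ne'
    have hevM := eventually_eventually_lt_of_limsup_lt hM
    -- A single pair (r, δ), depending on x, with small gap and with weights summing to less than M
    -- already bounds Θ.
    have hΘbound : ∀ᵐ x ∂μ.restrict E, (Θ x : ℝ≥0∞) ≤ τ + M := by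
      filter_upwards [hgap, hEmem] with x hx hxE
      obtain ⟨r, hr⟩ := ((eventually_eventually_lt_of_limsup_lt hx).and hevM).exists
      obtain ⟨δ, hδ1, hδ2⟩ := (hr.1.and hr.2).exists
      calc (Θ x : ℝ≥0∞) ≤ ∑' k : ℕ, piU μ p ρ k δ x r h +
            absDiff (Θ x) (∑' k : ℕ, piU μ p ρ k δ x r h) := le_add_absDiff _ _
        _ ≤ M + τ := by
            gcongr
            · refine le_trans (ENNReal.tsum_le_tsum fun k => ?_) hδ2.le
              exact le_iSup₂ (f := fun x (_ : x ∈ E) => piU μ p ρ k δ x r h) x hxE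
            · refine le_trans ?_ hδ1.le
              unfold weightGap
              exact le_add_self
        _ = τ + M := add_comm _ _
    set F : ℝ → ℝ → X → ℝ≥0∞ := fun r δ x => e' x * weightGap μ p ρ Θ' h r δ x with hF
    have hFm : ∀ r > 0, ∀ δ ∈ Ioo (0 : ℝ) 1, Measurable (F r δ) := fun r hr δ hδ =>
      he.measurable_mk.coe_nnreal_ennreal.mul
        (measurable_weightGap (hρ.antitone δ hδ) (hρ.measurable δ hδ) hr hh hΘm.measurable_mk)
    have hFatou := limsup_limsup_lintegral_le (m := μ.restrict E) (l := 𝓝[>] (0 : ℝ))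
      (l' := 𝓝[>] (0 : ℝ)) (F := F) (G := fun x => e' x * (2 * (τ + M) + 2 * M)) (by
        rw [lintegral_mul_const' _ _ (by finiteness), hinte]
        exact (ENNReal.mul_lt_top hefin (by finiteness)).ne) (by
        filter_upwards [hevM, self_mem_nhdsWithin] with r hr hr0
        filter_upwards [hr, Ioo_mem_nhdsGT one_pos] with δ hδ hδ1
        refine ⟨hFm r hr0 δ hδ1, ?_⟩
        filter_upwards [hΘbound, hΘΘ', hEmem] with x hx hx' hxE
        simp only [hF]
        gcongr
        rw [← weightGap_congr hx']
        refine (weightGap_le hp.le hxE hr0 hh).trans ?_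
        gcongr)
    have hFlt : limsup (fun r : ℝ => limsup (fun δ : ℝ => ∫⁻ x in E, F r δ x ∂μ) (𝓝[>] 0))
        (𝓝[>] 0) < τ * ∫⁻ x in E, e x ∂μ + τ := by
      have hle : ∫⁻ x in E, limsup (fun r : ℝ => limsup (fun δ : ℝ => F r δ x) (𝓝[>] 0))
          (𝓝[>] 0) ∂μ ≤ τ * ∫⁻ x in E, e x ∂μ := by
        rw [← hinte, ← lintegral_const_mul' _ _ hτt]
        refine lintegral_mono_ae ?_
        filter_upwards [hgap, hΘΘ'] with x hx hx'
        refine limsup_limsup_le ?_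
        filter_upwards [eventually_eventually_lt_of_limsup_lt hx] with r hr
        filter_upwards [hr] with δ hδ
        simp only [hF]
        rw [mul_comm, ← weightGap_congr hx']
        gcongr
      refine (hFatou.trans hle).trans_lt (ENNReal.lt_add_right ?_ hτ0.ne')
      exact (ENNReal.mul_lt_top hτt.lt_top hefin).ne
    -- Two deviations occur for each k and the weights sum to at most M, so these terms contribute
    -- at most τ in total.
    have hJev : ∀ᶠ s in 𝓝[>] (0 : ℝ), J s ≤ τ / (2 * M) :=
      ENNReal.tendsto_nhds_zero.1 hlim _ (ENNReal.div_pos hτ0.ne' (by finiteness))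
    obtain ⟨s₀, hs₀, hJev⟩ := mem_nhdsGT_iff_exists_Ioc_subset.1 hJev
    have hs₀ : 0 < s₀ := hs₀
    refine limsup_limsup_le ?_
    filter_upwards [eventually_eventually_lt_of_limsup_lt hFlt, hevM,
      Ioc_mem_nhdsGT (lt_min hR hs₀)] with r hr hrM hrI
    have hr0 : 0 < r := hrI.1
    have hrR : r ≤ R := hrI.2.trans (min_le_left _ _)
    have hrs : r ≤ s₀ := hrI.2.trans (min_le_right _ _)
    filter_upwards [hr, hrM, Ioo_mem_nhdsGT one_pos] with δ hδ hδM hδ1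
    have hJk : ∀ k : ℕ, J (r / h ^ k) ≤ τ / (2 * M) := fun k =>
      hJev ⟨by positivity, (div_le_self hr0.le (one_le_pow₀ hh.le)).trans hrs⟩
    set a : ℕ → ℝ≥0∞ := fun k => ⨆ x ∈ E, piU μ p ρ k δ x r h with ha
    have hEm : ∀ s, AEMeasurable (fun x => absDiff (ks μ p f E x s) (e x)) (μ.restrict E) :=
      fun s => aemeasurable_absDiff (measurable_ks hf E s).aemeasurable he.coe_nnreal_ennreal
    have hEm₂ : ∀ s t, AEMeasurable (fun x => absDiff (ks μ p f E x s) (e x) +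
        absDiff (ks μ p f E x t) (e x)) (μ.restrict E) := fun s t => (hEm s).add (hEm t)
    calc ∫⁻ x in E, absDiff (∫⁻ y in E ∩ closedBall x r, edist (f x) (f y) ^ p * ρ δ x y ∂μ)
          (Θ x * e x) ∂μ
        ≤ ∫⁻ x in E, (∑' k, a k * (absDiff (ks μ p f E x (r / h ^ k)) (e x) +
            absDiff (ks μ p f E x (r / h ^ (k + 1))) (e x)) + F r δ x) ∂μ := by
          refine lintegral_mono_ae ?_
          filter_upwards [hEmem, hee', hΘΘ'] with x hxE hx1 hx2
          have hfx : Measurable fun y => edist (f x) (f y) :=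
            (measurable_edist_of_stronglyMeasurable hf).comp measurable_prodMk_left
          refine (absDiff_mollified_le hp (hρ.antitone δ hδ1) hfx hr0 hh
            (fun s hs hsr => hμ x hxE s hs (hsr.trans hrR)) Θ e).trans ?_
          simp only [hF]
          rw [weightGap_congr hx2, ← hx1]
          gcongr with k
          exact le_iSup₂ (f := fun x (_ : x ∈ E) => piU μ p ρ k δ x r h) x hxE
      _ = ∑' k, a k * (J (r / h ^ k) + J (r / h ^ (k + 1))) + ∫⁻ x in E, F r δ x ∂μ := by
          rw [lintegral_add_right _ (hFm r hr0 δ hδ1),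
            lintegral_tsum fun k => (hEm₂ _ _).const_mul _]
          congr 1
          refine tsum_congr fun k => ?_
          rw [lintegral_const_mul'' _ (hEm₂ _ _), lintegral_add_left' (hEm _)]
      _ ≤ ∑' k, a k * (τ / (2 * M) + τ / (2 * M)) + ∫⁻ x in E, F r δ x ∂μ := by
          gcongr
          · exact hJk _
          · exact hJk _
      _ = (∑' k, a k) * (τ / (2 * M) + τ / (2 * M)) + ∫⁻ x in E, F r δ x ∂μ := by
          rw [ENNReal.tsum_mul_right]
      _ ≤ M * (τ / (2 * M) + τ / (2 * M)) + (τ * ∫⁻ x in E, e x ∂μ + τ) := by gcongr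
      _ = (2 * M) * (τ / (2 * M)) + (τ * ∫⁻ x in E, e x ∂μ + τ) := by ring
      _ ≤ _ := by gcongr; exact ENNReal.mul_div_le
  have hc : Tendsto (fun n : ℕ => ((n + 1 : ℕ) : ℝ≥0∞)⁻¹ +
      (((n + 1 : ℕ) : ℝ≥0∞)⁻¹ * ∫⁻ x in E, e x ∂μ + ((n + 1 : ℕ) : ℝ≥0∞)⁻¹)) atTop
      (𝓝 (0 + (0 * ∫⁻ x in E, e x ∂μ + 0))) := by
    have h0 := tendsto_inv_nat_succ
    exact h0.add ((ENNReal.Tendsto.mul_const h0 (Or.inr hefin.ne)).add h0)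
  simp only [add_zero, zero_mul] at hc
  exact le_antisymm (ge_of_tendsto' hc hbound) zero_le

end MollifierLimit

end MetricBBM

/-! ### Proof of the theorem. -/

theorem theorem3p6 {X : Type*} [MetricSpace X] [TopologicalSpace.SeparableSpace X]
    [ConnectedSpace X] [Nontrivial X] [MeasurableSpace X] [BorelSpace X]
    (hX : LocallyComplete X)
    (μ : Measure X) [IsLocallyFiniteMeasure μ] [NeZero μ]
    (p : ℝ) (hp : 1 ≤ p)
    (hD : InternallyDoubling μ) (hP : InternalPoincare μ p)
    {Y : Type*} [MetricSpace Y]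
    (Ω : Set X) (hΩ : IsOpen Ω) (f : X → Y)
    (hfL : MemLpLoc μ p Ω f) (hfS : MemSobolevClass μ p Ω f)
    (e : X → ℝ≥0) (he : AEMeasurable e (μ.restrict Ω))
    (hV : ∀ᵐ x ∂μ.restrict Ω, ∃ V : ℕ → Set X,
      (∀ n, MeasurableSet (V n) ∧ V n ⊆ Ω ∧ IsDensityPoint μ (V n) x) ∧
      limsup (fun n : ℕ => limsup (fun r : ℝ =>
        absDiff (ks μ p f (V n) x r) (e x)) (𝓝[>] 0)) atTop = 0) :
    IsEnergyDensity μ p Ω f e ∧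
    ∀ ρ : ℝ → X → X → ℝ≥0, StronglyAdmissible μ p ρ →
      ∀ Θ : X → ℝ≥0, IsMollifierDensity μ p ρ Θ →
        ∀ Ω' : Set X, IsOpen Ω' → WellContained Ω' Ω →
          (∀ᵐ x ∂μ.restrict Ω',
            limsup (fun r : ℝ => limsup (fun δ : ℝ =>
              absDiff (∫⁻ y in Ω' ∩ closedBall x r, edist (f x) (f y) ^ p * ρ δ x y ∂μ)
                (Θ x * e x)) (𝓝[>] 0)) (𝓝[>] 0) = 0) ∧
          limsup (fun r : ℝ => limsup (fun δ : ℝ =>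
            ∫⁻ x in Ω',
              absDiff (∫⁻ y in Ω' ∩ closedBall x r, edist (f x) (f y) ^ p * ρ δ x y ∂μ)
                (Θ x * e x) ∂μ) (𝓝[>] 0)) (𝓝[>] 0) = 0 := by
  have := UniformSpace.secondCountable_of_separable X
  have hp0 : 0 < p := by linarith
  obtain ⟨hfm, ν, ⟨hν, -⟩, hνfin, hνac⟩ := hfS
  -- A strongly measurable representative is used throughout: the relaxed energies ignore null sets,
  -- and `ks` is unchanged at points where the two maps agree.
  set f' := hfm.mk f with hf'def
  have hf' : StronglyMeasurable f' := hfm.stronglyMeasurable_mk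
  have hff' : f =ᵐ[μ.restrict Ω] f' := hfm.ae_eq_mk
  have hν' : ∀ φ : Y → ℝ, LipschitzWith 1 φ → (∃ C : ℝ, ∀ y, |φ y| ≤ C) →
      ∀ S : Set X, S ⊆ Ω → cheegerSet μ p Ω (φ ∘ f') S ≤ ν S := fun φ h1 h2 S hS =>
    (cheegerSet_le_of_ae_eq (hff'.fun_comp φ) S).trans (hν φ h1 h2 S hS)
  have hV' : ∀ᵐ x ∂μ.restrict Ω, ∃ V : ℕ → Set X,
      (∀ n, MeasurableSet (V n) ∧ V n ⊆ Ω ∧ IsDensityPoint μ (V n) x) ∧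
      limsup (fun n : ℕ => limsup (fun r : ℝ =>
        absDiff (ks μ p f' (V n) x r) (e x)) (𝓝[>] 0)) atTop = 0 := by
    filter_upwards [hV, hff'] with x ⟨V, hV1, hV2⟩ hx
    refine ⟨V, hV1, ?_⟩
    simp_rw [← fun n => ks_congr (p := p) hff' (hV1 n).2.1 hx]
    exact hV2
  have hcore := fun {Ω' E : Set X} (hΩ' : IsOpen Ω') (hW : WellContained Ω' Ω) (hE : IsOpen E)
      (h1 : Ω' ⊆ E) (h2 : E ⊆ Ω) => tendsto_ks_of_wellContained hX hp hD hP hΩ hf' hν' hνfin hνac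
    he hV' hΩ' hW hE h1 h2
  refine ⟨⟨he, fun Ω' hΩ' hW => ?_⟩, fun ρ hρ Θ hΘ Ω' hΩ' hW => ?_⟩
  -- The energy density integrates over Ω, so the intermediate open set is Ω.
  · obtain ⟨hpt, hfin, hL1⟩ := hcore hΩ' hW hΩ hW.1 Subset.rfl
    have hff := ae_mono (Measure.restrict_mono hW.1 le_rfl) hff'
    refine ⟨hfin, hL1.congr fun r => lintegral_congr_ae ?_, ?_⟩
    · filter_upwards [hff] with x hx
      rw [ks_congr hff' Subset.rfl hx]
    · filter_upwards [hpt, hff] with x hx hfx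
      exact hx.congr fun r => (ks_congr hff' Subset.rfl hfx r).symm
  -- The mollified integrals run over Ω' only, so the intermediate open set is Ω' itself.
  · obtain ⟨hpt, hfin, hL1⟩ := hcore hΩ' hW hΩ' Subset.rfl hW.1
    have hff := ae_mono (Measure.restrict_mono hW.1 le_rfl) hff'
    obtain ⟨C, P, l, R, hR, hL⟩ := exists_localPoincare hD hP hW
    have hμ : ∀ x ∈ Ω', ∀ s : ℝ, 0 < s → s ≤ R →
        0 < μ (closedBall x s) ∧ μ (closedBall x s) < ∞ := fun x hx s hs hsR =>
      have h := hL.doubling.2 x (self_subset_cthickening _ hx) s hs hsR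
      ⟨h.1, h.2.1⟩
    have hint : ∀ x, f x = f' x → ∀ r δ : ℝ,
        ∫⁻ y in Ω' ∩ closedBall x r, edist (f x) (f y) ^ p * ρ δ x y ∂μ =
        ∫⁻ y in Ω' ∩ closedBall x r, edist (f' x) (f' y) ^ p * ρ δ x y ∂μ := by
      intro x hx r δ
      refine lintegral_congr_ae ?_
      filter_upwards [ae_mono (Measure.restrict_mono inter_subset_left le_rfl) hff] with y hy
      rw [hx, hy]
    constructor
    · have hgap : ∀ᵐ x ∂μ, ∀ n : ℕ, ∃ h : ℝ, 1 < h ∧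
          limsup (fun r : ℝ => limsup (fun δ : ℝ => weightGap μ p ρ Θ h r δ x) (𝓝[>] 0)) (𝓝[>] 0)
            < ((n + 1 : ℕ) : ℝ≥0∞)⁻¹ := by
        rw [ae_all_iff]
        intro n
        obtain ⟨h, hh, hlt⟩ := hΘ.exists_weightGap_lt
          (ENNReal.inv_pos.2 (ENNReal.natCast_ne_top (n + 1)))
        filter_upwards [hlt] with x hx
        exact ⟨h, hh, hx⟩
      filter_upwards [hpt, hff, ae_restrict_of_ae hgap, ae_restrict_mem hΩ'.measurableSet]
        with x hx hfx hgx hxΩ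
      simp_rw [hint x hfx]
      exact limsup_mollified_eq_zero hp0 hρ.antitone
        ((measurable_edist_of_stronglyMeasurable hf').comp measurable_prodMk_left) hR (hμ x hxΩ)
        hx hgx
    · have heq : ∀ r δ : ℝ, ∫⁻ x in Ω',
          absDiff (∫⁻ y in Ω' ∩ closedBall x r, edist (f x) (f y) ^ p * ρ δ x y ∂μ)
            (Θ x * e x) ∂μ = ∫⁻ x in Ω',
          absDiff (∫⁻ y in Ω' ∩ closedBall x r, edist (f' x) (f' y) ^ p * ρ δ x y ∂μ)
            (Θ x * e x) ∂μ := fun r δ => by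
        refine lintegral_congr_ae ?_
        filter_upwards [hff] with x hx
        rw [hint x hx]
      simp_rw [heq]
      exact limsup_lintegral_mollified_eq_zero hp0 hρ hΘ hf' hΩ'.measurableSet hW.to_univ
        (he.mono_measure (Measure.restrict_mono hW.1 le_rfl)) hR hμ hfin hL1
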